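/- Let $\rho,\mu,J,\delta,\xi,\mu_1,\mu_2,\tau>0$ and let $b\neq 0$ satisfy $b^2\le\mu\xi$. Let $f:\mathbb R\to\mathbb R$ be such that, for some constants $k_0,\theta>0$, $$|f(x)-f(y)|\le k_0\,(|x|^\theta+|y|^\theta)\,|x-y|\qquad(x,y\in\mathbb R),$$ and $$0\le \hat f(x)\le f(x)\,x\qquad(x\in\mathbb R),\qquad \hat f(x)=\int_0^x f(s)\,ds .$$ Assume $\mu_2\le\mu_1$ and let $\eta>0$ satisfy $\tau\mu_2\le\eta\le\tau(2\mu_1-\mu_2)$. Let $$\mathcal H=H^1_0(0,1)\times L^2(0,1)\times H^1_0(0,1)\times L^2(0,1)\times L^2(0,1;L^2(0,1))$$ be the real Hilbert space of $U=(u,v,\phi,\psi,z)$, $z=z(x,y)$, with the norm $$\|U\|_{\mathcal H}^2=\int_0^1\big[\rho v^2+J\psi^2+\delta\phi_x^2+\mu u_x^2+2b\,u_x\phi+\xi\phi^2\big]\,dx+\eta\int_0^1\!\!\int_0^1 z^2\,dy\,dx$$ and the inner product obtained from it by polarization. Define $$\mathcal AU=\Big(v,\ \tfrac{\mu}{\rho}u_{xx}+\tfrac{b}{\rho}\phi_x,\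 \psi,\ \tfrac{\delta}{J}\phi_{xx}-\tfrac{b}{J}u_x-\tfrac{\xi}{J}\phi-\tfrac{\mu_1}{J}\psi-\tfrac{\mu_2}{J}z(\cdot,1),\ -\tfrac1\tau z_y\Big)$$ for $U$ in the domain $D(\mathcal A)$ of all $U\in\mathcal H$ with $u,\phi\in H^2(0,1)\cap H^1_0(0,1)$, $v,\psi\in H^1_0(0,1)$, $z\in L^2(0,1;H^1(0,1))$ ($H^1$ in the variable $y$) and $\psi=z(\cdot,0)$, and let $\mathcal F(U)=(0,0,0,-\tfrac1J f(\phi),0)$. Consider the problem $$U'(t)=\mathcal AU(t)+\mathcal F(U(t)),\quad t>0,\qquad U(0)=U_0. \tag{P}$$ Then $\mathcal A$ is the infinitesimal generator of a $C_0$-semigroup of contractions $(S(t))_{t\ge0}$ on $\mathcal H$. A mild solution of (P) on $[0,T]$ (on $[0,\infty)$) is a function $U\in C([0,T],\mathcal H)$ (in $C([0,\infty),\mathcal H)$) with $U(t)=S(t)U_0+\int_0^tS(t-s)\mathcal F(U(s))\,ds$ for all $t\in[0,T]$ (all $t\ge0$), and the following holds. (i) For every $U_0\in\mathcal H$, problem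 (P) has a unique mild solution $U\in C([0,\infty),\mathcal H)$, and $U(0)=U_0$. (ii) For any two initial values $X_1,X_2\in\mathcal H$ there is a constant $C_0=C(X_1,X_2)>0$, depending on the solutions and on $T$ only through these initial values, such that for every $T\ge0$ and all mild solutions $U_1,U_2$ on $[0,T]$ with $U_1(0)=X_1$, $U_2(0)=X_2$, $$\|U_1(t)-U_2(t)\|_{\mathcal H}\le e^{C_0T}\,\|U_1(0)-U_2(0)\|_{\mathcal H}\qquad(0\le t\le T).$$ (iii) If $U_0\in D(\mathcal A)$, then the mild solution on $[0,\infty)$ is a strong solution: there is a locally integrable $U':[0,\infty)\to\mathcal H$ such that $U(t)=U_0+\int_0^tU'(s)\,ds$ for all $t\ge0$, and for almost every $t>0$, $U$ is differentiable at $t$ with derivative $U'(t)$, $U(t)\in D(\mathcal A)$ and $U'(t)=\mathcal AU(t)+\mathcal F(U(t))$. -/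

import Mathlib

open MeasureTheory Set Filter Topology
open scoped ContDiff

noncomputable section

namespace Porous

/-! ### Function spaces on the unit interval -/

/-- Lebesgue measure on `(0,1)`. -/
abbrev leb : Measure ℝ := volume.restrict (Ioo (0 : ℝ) 1)

instance : IsProbabilityMeasure leb := ⟨by simp⟩

/-- The real Lebesgue space `L²(0,1)`. -/
abbrev L2 : Type := Lp ℝ 2 leb

/-- The Bochner space `L²(0,1; L²(0,1))`; for `z` in it, `z x y` is the value at `(x, y)`. -/
abbrev L2L2 : Type := Lp L2 2 leb

/-- Test functions: smooth with compact support contained in `(0,1)`. -/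
structure IsTest (χ : ℝ → ℝ) : Prop where
  smooth : ContDiff ℝ ∞ χ
  compact : HasCompactSupport χ
  supp : tsupport χ ⊆ Ioo (0 : ℝ) 1

/-- `g ∈ L²(0,1)` is the weak derivative of `u ∈ L²(0,1)` on `(0,1)`. -/
def HasWeakDeriv (u g : L2) : Prop :=
  ∀ χ : ℝ → ℝ, IsTest χ → ∫ x, u x * deriv χ x ∂leb = - ∫ x, g x * χ x ∂leb

/-- The continuous representative on `[0,1]` of `u ∈ L²(0,1)` exists and has the value `a` at the
point `y₀` of `[0,1]`. -/
def HasTraceAt (u : L2) (y₀ a : ℝ) : Prop :=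
  ∃ c : ℝ → ℝ, ContinuousOn c (Icc 0 1) ∧ (∀ᵐ y ∂leb, u y = c y) ∧ c y₀ = a

/-- The pairs `(χ, χ')` with `χ` a test function, as a subspace of `L²(0,1) × L²(0,1)`. -/
def testGraph : Submodule ℝ (L2 × L2) where
  carrier := {p | ∃ χ : ℝ → ℝ, IsTest χ ∧ p.1 =ᵐ[leb] χ ∧ p.2 =ᵐ[leb] deriv χ}
  zero_mem' := by
    refine ⟨fun _ => 0, ⟨contDiff_const, HasCompactSupport.zero, ?_⟩, ?_, ?_⟩
    · have : tsupport (fun _ : ℝ => (0 : ℝ)) = ∅ := by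
        rw [tsupport_eq_empty_iff]; rfl
      rw [this]; exact empty_subset _
    · exact Lp.coeFn_zero _ _ _
    · have : deriv (fun _ : ℝ => (0 : ℝ)) = 0 := by ext; simp
      rw [this]; exact Lp.coeFn_zero _ _ _
  add_mem' := by
    rintro p q ⟨χ, hχ, h1, h2⟩ ⟨χ', hχ', k1, k2⟩
    refine ⟨χ + χ', ⟨hχ.smooth.add hχ'.smooth, hχ.compact.add hχ'.compact,
      (tsupport_add χ χ').trans (union_subset hχ.supp hχ'.supp)⟩, ?_, ?_⟩
    · exact (Lp.coeFn_add p.1 q.1).trans (h1.add k1)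
    · have : deriv (χ + χ') = deriv χ + deriv χ' := by
        ext x
        exact deriv_add (hχ.smooth.differentiable (by simp) x)
          (hχ'.smooth.differentiable (by simp) x)
      rw [this]
      exact (Lp.coeFn_add p.2 q.2).trans (h2.add k2)
  smul_mem' := by
    rintro c p ⟨χ, hχ, h1, h2⟩
    refine ⟨c • χ, ⟨hχ.smooth.const_smul c, hχ.compact.smul_left (f := fun _ => c),
      (tsupport_smul_subset_right (fun _ => c) χ).trans hχ.supp⟩, ?_, ?_⟩
    · exact (Lp.coeFn_smul c p.1).trans (h1.const_smul c)
    · have : deriv (c • χ) = c • deriv χ := by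
        ext x
        exact deriv_const_smul c (hχ.smooth.differentiable (by simp) x)
      rw [this]
      exact (Lp.coeFn_smul c p.2).trans (h2.const_smul c)

/-- The closure of `testGraph`, that is, of the test functions in the norm of `H¹(0,1)`. -/
def H10Sub : Submodule ℝ (L2 × L2) := testGraph.topologicalClosure

/-- The Sobolev space `H¹₀(0,1)`, the closure of the test functions in `H¹(0,1)`.
Its elements are the pairs `(u, u_x)` of a function and its weak derivative. -/
abbrev H10 : Type := H10Sub

/-- The underlying function of an element of `H¹₀(0,1)`. -/
def H10.fn (u : H10) : L2 := u.1.1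

/-- The weak derivative of an element of `H¹₀(0,1)`. -/
def H10.dx (u : H10) : L2 := u.1.2

theorem testGraph_ae_bound (p : L2 × L2) (hp : p ∈ testGraph) :
    ∀ᵐ x ∂leb, |p.1 x| ≤ ‖p.2‖ := by
  obtain ⟨χ, hχ, h1, h2⟩ := hp
  have hd : Continuous (deriv χ) := hχ.smooth.continuous_deriv (by simp)
  have hχ0 : χ 0 = 0 := by
    by_contra h
    exact absurd (hχ.supp (subset_tsupport χ h)).1 (lt_irrefl _)
  have hL1 : ∫ y, |deriv χ y| ∂leb ≤ ‖p.2‖ := by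
    have e1 : eLpNorm p.2 1 leb ≤ eLpNorm p.2 2 leb :=
      eLpNorm_le_eLpNorm_of_exponent_le (by norm_num) (Lp.aestronglyMeasurable p.2)
    have e2 : ∫ y, |deriv χ y| ∂leb = (eLpNorm p.2 1 leb).toReal := by
      rw [eLpNorm_congr_ae h2, eLpNorm_one_eq_lintegral_enorm,
        ← integral_norm_eq_lintegral_enorm hd.aestronglyMeasurable]
      rfl
    rw [e2, Lp.norm_def]
    exact ENNReal.toReal_mono (Lp.eLpNorm_ne_top p.2) e1
  have hmem : ∀ᵐ x ∂leb, x ∈ Ioo (0 : ℝ) 1 := ae_restrict_mem measurableSet_Ioo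
  filter_upwards [h1, hmem] with x hx hx'
  rw [hx]
  have hftc : ∫ y in (0 : ℝ)..x, deriv χ y = χ x - χ 0 :=
    intervalIntegral.integral_deriv_eq_sub
      (fun y _ => hχ.smooth.differentiable (by simp) y) (hd.intervalIntegrable _ _)
  have hint : IntegrableOn (fun y => |deriv χ y|) (Ioo 0 1) :=
    (hd.abs.integrableOn_Icc (a := 0) (b := 1)).mono_set Ioo_subset_Icc_self
  calc |χ x| = |∫ y in (0 : ℝ)..x, deriv χ y| := by rw [hftc, hχ0, sub_zero]
    _ ≤ ∫ y in (0 : ℝ)..x, |deriv χ y| :=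
        intervalIntegral.abs_integral_le_integral_abs hx'.1.le
    _ = ∫ y in Ioc 0 x, |deriv χ y| := intervalIntegral.integral_of_le hx'.1.le
    _ ≤ ∫ y, |deriv χ y| ∂leb :=
        setIntegral_mono_set hint (ae_of_all _ fun _ => abs_nonneg _)
          (Eventually.of_forall fun y hy => ⟨hy.1, hy.2.trans_lt hx'.2⟩)
    _ ≤ ‖p.2‖ := hL1

/-- `H¹₀(0,1)` embeds in `L^∞(0,1)`. -/
theorem H10.ae_bound (u : H10) : ∀ᵐ x ∂leb, |u.fn x| ≤ ‖u.dx‖ := by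
  obtain ⟨p, hp, hlim⟩ := mem_closure_iff_seq_limit.1
    (show u.1 ∈ closure (testGraph : Set (L2 × L2)) from u.2)
  have l1 : Tendsto (fun n => (p n).1) atTop (𝓝 u.fn) :=
    (continuous_fst.tendsto _).comp hlim
  have l2 : Tendsto (fun n => ‖(p n).2‖) atTop (𝓝 ‖u.dx‖) :=
    ((continuous_snd.norm).tendsto u.1).comp hlim
  obtain ⟨ns, hns, hae⟩ := (tendstoInMeasure_of_tendsto_Lp l1).exists_seq_tendsto_ae
  have hb : ∀ᵐ x ∂leb, ∀ n, |(p n).1 x| ≤ ‖(p n).2‖ :=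
    ae_all_iff.2 fun n => testGraph_ae_bound (p n) (hp n)
  filter_upwards [hae, hb] with x hx hbx
  exact le_of_tendsto_of_tendsto' hx.abs (l2.comp hns.tendsto_atTop) fun n => hbx (ns n)

/-! ### The energy space -/

/-- The constants of the system, with the weight `η` of the inner product of the energy space. -/
structure Params where
  (ρ μ J δ ξ μ₁ μ₂ τ b η : ℝ)
  ρ_pos : 0 < ρ
  μ_pos : 0 < μ
  J_pos : 0 < J
  δ_pos : 0 < δ
  ξ_pos : 0 < ξ
  μ₁_pos : 0 < μ₁
  μ₂_pos : 0 < μ₂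
  τ_pos : 0 < τ
  η_pos : 0 < η
  b_ne : b ≠ 0
  b_sq_le : b ^ 2 ≤ μ * ξ

/-- The energy space `H¹₀ × L² × H¹₀ × L² × L²(0,1; L²(0,1))`; it carries the inner product
defined below, not the product norm. -/
def Energy (_P : Params) : Type := H10 × L2 × H10 × L2 × L2L2

namespace Energy

variable {P : Params}

instance : AddCommGroup (Energy P) := inferInstanceAs (AddCommGroup (H10 × L2 × H10 × L2 × L2L2))
instance : Module ℝ (Energy P) := inferInstanceAs (Module ℝ (H10 × L2 × H10 × L2 × L2L2))

/-- The element `(u, v, φ, ψ, z)` of the energy space. -/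
def mk (u : H10) (v : L2) (φ : H10) (ψ : L2) (z : L2L2) : Energy P := (u, v, φ, ψ, z)

def u (U : Energy P) : H10 := U.1
def v (U : Energy P) : L2 := U.2.1
def φ (U : Energy P) : H10 := U.2.2.1
def ψ (U : Energy P) : L2 := U.2.2.2.1
def z (U : Energy P) : L2L2 := U.2.2.2.2

/-- The energy inner product; `inner ℝ` on the right is the inner product of `L²(0,1)`,
respectively of `L²(0,1; L²(0,1))`. -/
def innerE (U V : Energy P) : ℝ :=
  P.ρ * inner ℝ U.v V.v + P.J * inner ℝ U.ψ V.ψ + P.δ * inner ℝ U.φ.dx V.φ.dx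
    + P.μ * inner ℝ U.u.dx V.u.dx
    + P.b * (inner ℝ U.u.dx V.φ.fn + inner ℝ V.u.dx U.φ.fn)
    + P.ξ * inner ℝ U.φ.fn V.φ.fn + P.η * inner ℝ U.z V.z

theorem elastic_eq (P : Params) (a c : L2) :
    P.μ * inner ℝ a a + P.b * (inner ℝ a c + inner ℝ a c) + P.ξ * inner ℝ c c
      = (P.μ - P.b ^ 2 / P.ξ) * ‖a‖ ^ 2 + P.ξ * ‖c + (P.b / P.ξ) • a‖ ^ 2 := by
  have hξ := P.ξ_pos.ne'
  rw [← real_inner_self_eq_norm_sq, ← real_inner_self_eq_norm_sq]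
  simp only [inner_add_left, inner_add_right, real_inner_smul_left, real_inner_smul_right,
    real_inner_comm a c]
  field_simp
  ring

theorem defect_nonneg (P : Params) : 0 ≤ P.μ - P.b ^ 2 / P.ξ := by
  rw [sub_nonneg, div_le_iff₀ P.ξ_pos]; exact P.b_sq_le

theorem innerE_self (U : Energy P) : innerE U U =
    P.ρ * ‖U.v‖ ^ 2 + P.J * ‖U.ψ‖ ^ 2 + P.δ * ‖U.φ.dx‖ ^ 2
      + ((P.μ - P.b ^ 2 / P.ξ) * ‖U.u.dx‖ ^ 2 + P.ξ * ‖U.φ.fn + (P.b / P.ξ) • U.u.dx‖ ^ 2)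
      + P.η * ‖U.z‖ ^ 2 := by
  rw [← elastic_eq]
  simp only [innerE, real_inner_self_eq_norm_sq]
  ring

theorem innerE_nonneg (U : Energy P) : 0 ≤ innerE U U := by
  rw [innerE_self]
  have := P.ρ_pos
  have := P.J_pos
  have := P.δ_pos
  have := P.ξ_pos
  have := P.η_pos
  have := defect_nonneg P
  positivity

theorem H10_eq_zero (u : H10) (h : u.dx = 0) : u = 0 := by
  have h0 : u.fn = 0 := by
    refine Lp.ext ?_
    filter_upwards [u.ae_bound, Lp.coeFn_zero ℝ 2 leb] with x hx hz
    rw [hz]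
    simpa [h] using hx
  exact Subtype.ext (Prod.ext h0 h)

theorem innerE_definite (U : Energy P) (h : innerE U U = 0) : U = 0 := by
  rw [innerE_self] at h
  have h1 := mul_nonneg P.ρ_pos.le (sq_nonneg ‖U.v‖)
  have h2 := mul_nonneg P.J_pos.le (sq_nonneg ‖U.ψ‖)
  have h3 := mul_nonneg P.δ_pos.le (sq_nonneg ‖U.φ.dx‖)
  have h4 := mul_nonneg (defect_nonneg P) (sq_nonneg ‖U.u.dx‖)
  have h5 := mul_nonneg P.ξ_pos.le (sq_nonneg ‖U.φ.fn + (P.b / P.ξ) • U.u.dx‖)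
  have h6 := mul_nonneg P.η_pos.le (sq_nonneg ‖U.z‖)
  have key : ∀ {E : Type} [NormedAddCommGroup E] {c : ℝ} {e : E}, 0 < c → c * ‖e‖ ^ 2 = 0 →
      e = 0 := by
    intro E _ c e hc he
    simpa [hc.ne'] using he
  have hv : U.v = 0 := key P.ρ_pos (by linarith)
  have hψ : U.ψ = 0 := key P.J_pos (by linarith)
  have hφ : U.φ = 0 := H10_eq_zero _ (key P.δ_pos (by linarith))
  have hz : U.z = 0 := key P.η_pos (by linarith)
  have hw : U.φ.fn + (P.b / P.ξ) • U.u.dx = 0 := key P.ξ_pos (by linarith)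
  have hu : U.u = 0 := by
    refine H10_eq_zero _ ?_
    rw [hφ] at hw
    have : (P.b / P.ξ) • U.u.dx = 0 := by simpa [H10.fn] using hw
    exact (smul_eq_zero.1 this).resolve_left (div_ne_zero P.b_ne P.ξ_pos.ne')
  exact Prod.ext hu (Prod.ext hv (Prod.ext hφ (Prod.ext hψ hz)))

/-- `innerE` is an inner product. -/
@[reducible] def core (P : Params) : InnerProductSpace.Core ℝ (Energy P) where
  inner := innerE
  conj_inner_symm U V := by
    simp only [innerE, conj_trivial, real_inner_comm V.v, real_inner_comm V.ψ,
      real_inner_comm V.φ.dx, real_inner_comm V.z]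
    rw [real_inner_comm U.u.dx V.u.dx, real_inner_comm U.φ.fn V.φ.fn]
    ring
  re_inner_nonneg U := by simpa using innerE_nonneg U
  add_left U V W := by
    have e1 : (U + V).v = U.v + V.v := rfl
    have e2 : (U + V).ψ = U.ψ + V.ψ := rfl
    have e3 : (U + V).z = U.z + V.z := rfl
    have e4 : (U + V).u.dx = U.u.dx + V.u.dx := rfl
    have e5 : (U + V).φ.dx = U.φ.dx + V.φ.dx := rfl
    have e6 : (U + V).φ.fn = U.φ.fn + V.φ.fn := rfl
    simp only [innerE, e1, e2, e3, e4, e5, e6, inner_add_left, inner_add_right]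
    ring
  smul_left U V r := by
    have e1 : (r • U).v = r • U.v := rfl
    have e2 : (r • U).ψ = r • U.ψ := rfl
    have e3 : (r • U).z = r • U.z := rfl
    have e4 : (r • U).u.dx = r • U.u.dx := rfl
    have e5 : (r • U).φ.dx = r • U.φ.dx := rfl
    have e6 : (r • U).φ.fn = r • U.φ.fn := rfl
    simp only [innerE, e1, e2, e3, e4, e5, e6, real_inner_smul_left, real_inner_smul_right,
      conj_trivial]
    ring
  definite U h := innerE_definite U h

instance : NormedAddCommGroup (Energy P) :=
  @InnerProductSpace.Core.toNormedAddCommGroup ℝ (Energy P) _ _ _ (core P)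

instance : InnerProductSpace ℝ (Energy P) := InnerProductSpace.ofCore (core P).toCore

theorem norm_sq_eq (U : Energy P) : ‖U‖ ^ 2 = innerE U U :=
  (real_inner_self_eq_norm_sq U).symm

theorem H10_norm_fn_le (u : H10) : ‖u.fn‖ ≤ ‖u.dx‖ := by
  have := Lp.norm_le_of_ae_bound (p := 2) (f := u.fn) (norm_nonneg u.dx) u.ae_bound
  simpa [measureUnivNNReal] using this

/-- The energy space is complete, so it is a Hilbert space. -/
instance : CompleteSpace (Energy P) := by
  have hH : CompleteSpace H10 :=
    (Submodule.isClosed_topologicalClosure testGraph).completeSpace_coe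
  have hρ := P.ρ_pos
  have hJ := P.J_pos
  have hδ := P.δ_pos
  have hξ := P.ξ_pos
  have hη := P.η_pos
  have hd := defect_nonneg P
  let e : Energy P ≃ₗ[ℝ] (H10 × L2 × H10 × L2 × L2L2) := LinearEquiv.refl ℝ _
  have key : ∀ {c a r N : ℝ}, 0 < c → 0 ≤ a → 0 ≤ r → 0 ≤ N → c * a ^ 2 + r = N ^ 2 →
      a ≤ (√c)⁻¹ * N := by
    intro c a r N hc ha hr hN h
    have hs : 0 < √c := Real.sqrt_pos.2 hc
    rw [inv_mul_eq_div, le_div_iff₀ hs]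
    refine abs_le_of_sq_le_sq' ?_ hN |>.2
    rw [mul_pow, Real.sq_sqrt hc.le]
    linarith
  have bd : ∀ U : Energy P, ‖e U‖ ≤ ((√P.ρ)⁻¹ + (√P.J)⁻¹ + (√P.δ)⁻¹ + (√P.η)⁻¹
      + |P.b / P.ξ|⁻¹ * ((√P.ξ)⁻¹ + (√P.δ)⁻¹)) * ‖U‖ := by
    intro U
    have h := (innerE_self U).symm.trans (norm_sq_eq U).symm
    have hN := norm_nonneg U
    have i1 := inv_nonneg.2 (Real.sqrt_nonneg P.ρ)
    have i2 := inv_nonneg.2 (Real.sqrt_nonneg P.J)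
    have i3 := inv_nonneg.2 (Real.sqrt_nonneg P.δ)
    have i4 := inv_nonneg.2 (Real.sqrt_nonneg P.η)
    have i5 := inv_nonneg.2 (Real.sqrt_nonneg P.ξ)
    have i6 : 0 ≤ |P.b / P.ξ|⁻¹ := inv_nonneg.2 (abs_nonneg _)
    have kv : ‖U.v‖ ≤ (√P.ρ)⁻¹ * ‖U‖ := key (r := P.J * ‖U.ψ‖ ^ 2 + P.δ * ‖U.φ.dx‖ ^ 2
      + ((P.μ - P.b ^ 2 / P.ξ) * ‖U.u.dx‖ ^ 2 + P.ξ * ‖U.φ.fn + (P.b / P.ξ) • U.u.dx‖ ^ 2)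
      + P.η * ‖U.z‖ ^ 2) hρ (norm_nonneg _) (by positivity) hN (by linarith)
    have kψ : ‖U.ψ‖ ≤ (√P.J)⁻¹ * ‖U‖ := key (r := P.ρ * ‖U.v‖ ^ 2 + P.δ * ‖U.φ.dx‖ ^ 2
      + ((P.μ - P.b ^ 2 / P.ξ) * ‖U.u.dx‖ ^ 2 + P.ξ * ‖U.φ.fn + (P.b / P.ξ) • U.u.dx‖ ^ 2)
      + P.η * ‖U.z‖ ^ 2) hJ (norm_nonneg _) (by positivity) hN (by linarith)
    have kφ : ‖U.φ.dx‖ ≤ (√P.δ)⁻¹ * ‖U‖ := key (r := P.ρ * ‖U.v‖ ^ 2 + P.J * ‖U.ψ‖ ^ 2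
      + ((P.μ - P.b ^ 2 / P.ξ) * ‖U.u.dx‖ ^ 2 + P.ξ * ‖U.φ.fn + (P.b / P.ξ) • U.u.dx‖ ^ 2)
      + P.η * ‖U.z‖ ^ 2) hδ (norm_nonneg _) (by positivity) hN (by linarith)
    have kz : ‖U.z‖ ≤ (√P.η)⁻¹ * ‖U‖ := key (r := P.ρ * ‖U.v‖ ^ 2 + P.J * ‖U.ψ‖ ^ 2
      + P.δ * ‖U.φ.dx‖ ^ 2
      + ((P.μ - P.b ^ 2 / P.ξ) * ‖U.u.dx‖ ^ 2 + P.ξ * ‖U.φ.fn + (P.b / P.ξ) • U.u.dx‖ ^ 2))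
      hη (norm_nonneg _) (by positivity) hN (by linarith)
    have kw : ‖U.φ.fn + (P.b / P.ξ) • U.u.dx‖ ≤ (√P.ξ)⁻¹ * ‖U‖ := key (r := P.ρ * ‖U.v‖ ^ 2
      + P.J * ‖U.ψ‖ ^ 2 + P.δ * ‖U.φ.dx‖ ^ 2
      + ((P.μ - P.b ^ 2 / P.ξ) * ‖U.u.dx‖ ^ 2) + P.η * ‖U.z‖ ^ 2)
      hξ (norm_nonneg _) (by positivity) hN (by linarith)
    have kf := H10_norm_fn_le U.φ
    have ku : ‖U.u.dx‖ ≤ |P.b / P.ξ|⁻¹ * ((√P.ξ)⁻¹ + (√P.δ)⁻¹) * ‖U‖ := by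
      have hb : 0 < |P.b / P.ξ| := abs_pos.2 (div_ne_zero P.b_ne hξ.ne')
      have h1 : |P.b / P.ξ| * ‖U.u.dx‖ ≤ ((√P.ξ)⁻¹ + (√P.δ)⁻¹) * ‖U‖ := by
        have h2 := norm_sub_le (U.φ.fn + (P.b / P.ξ) • U.u.dx) U.φ.fn
        rw [add_sub_cancel_left, norm_smul, Real.norm_eq_abs] at h2
        linarith
      rw [mul_assoc, inv_mul_eq_div, le_div_iff₀ hb]
      linarith
    have ku' := H10_norm_fn_le U.u
    have n1 := mul_nonneg i1 hN
    have n2 := mul_nonneg i2 hN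
    have n3 := mul_nonneg i3 hN
    have n4 := mul_nonneg i4 hN
    have n5 := (norm_nonneg U.u.dx).trans ku
    have hu : ‖U.u‖ ≤ ‖U.u.dx‖ := max_le ku' le_rfl
    have hφ : ‖U.φ‖ ≤ ‖U.φ.dx‖ := max_le kf le_rfl
    change max ‖U.u‖ (max ‖U.v‖ (max ‖U.φ‖ (max ‖U.ψ‖ ‖U.z‖))) ≤ _
    simp only [max_le_iff, add_mul _ _ ‖U‖]
    refine ⟨?_, ?_, ?_, ?_, ?_⟩ <;> linarith
  have bd' : ∀ x, ‖e.symm x‖ ≤ √(P.ρ + P.J + P.δ + ((P.μ - P.b ^ 2 / P.ξ)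
      + P.ξ * (1 + |P.b / P.ξ|) ^ 2) + P.η) * ‖x‖ := by
    intro x
    set U : Energy P := e.symm x with hU
    have kv : ‖U.v‖ ≤ ‖x‖ := (norm_fst_le x.2).trans (norm_snd_le x)
    have ku : ‖U.u.dx‖ ≤ ‖x‖ := (norm_snd_le x.1.1).trans (norm_fst_le x)
    have kφ' : ‖U.φ‖ ≤ ‖x‖ :=
      (norm_fst_le x.2.2).trans ((norm_snd_le x.2).trans (norm_snd_le x))
    have kφ : ‖U.φ.dx‖ ≤ ‖x‖ := (norm_snd_le U.φ.1).trans kφ'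
    have kf : ‖U.φ.fn‖ ≤ ‖x‖ := (norm_fst_le U.φ.1).trans kφ'
    have kψ : ‖U.ψ‖ ≤ ‖x‖ := (norm_fst_le x.2.2.2).trans
      ((norm_snd_le x.2.2).trans ((norm_snd_le x.2).trans (norm_snd_le x)))
    have kz : ‖U.z‖ ≤ ‖x‖ := (norm_snd_le x.2.2.2).trans
      ((norm_snd_le x.2.2).trans ((norm_snd_le x.2).trans (norm_snd_le x)))
    have kw : ‖U.φ.fn + (P.b / P.ξ) • U.u.dx‖ ≤ (1 + |P.b / P.ξ|) * ‖x‖ := by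
      refine (norm_add_le _ _).trans ?_
      rw [norm_smul, Real.norm_eq_abs, add_mul, one_mul]
      gcongr
    refine abs_le_of_sq_le_sq' ?_ (by positivity) |>.2
    rw [mul_pow, Real.sq_sqrt (by positivity), norm_sq_eq, innerE_self]
    calc _ ≤ P.ρ * ‖x‖ ^ 2 + P.J * ‖x‖ ^ 2 + P.δ * ‖x‖ ^ 2
          + ((P.μ - P.b ^ 2 / P.ξ) * ‖x‖ ^ 2 + P.ξ * ((1 + |P.b / P.ξ|) * ‖x‖) ^ 2)
          + P.η * ‖x‖ ^ 2 := by gcongr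
      _ = _ := by ring
  let E : Energy P ≃L[ℝ] (H10 × L2 × H10 × L2 × L2L2) :=
    e.toContinuousLinearEquivOfBounds _ _ bd bd'
  exact (completeSpace_congr (e := E.toEquiv) E.isUniformEmbedding).2 inferInstance

end Energy

/-! ### The operators of the abstract problem -/

variable {P : Params}

/-- The domain `D(𝒜)`: `u, φ ∈ H² ∩ H¹₀`, `v, ψ ∈ H¹₀`, `z ∈ L²(0,1; H¹(0,1))` (that is, `z` has a
weak derivative in `y` which belongs to `L²(0,1; L²(0,1))`) and `ψ = z(·, 0)`. -/
structure InDomain (U : Energy P) : Prop where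
  u_mem : ∃ uxx : L2, HasWeakDeriv U.u.dx uxx
  v_mem : ∃ w : H10, w.fn = U.v
  φ_mem : ∃ φxx : L2, HasWeakDeriv U.φ.dx φxx
  ψ_mem : ∃ w : H10, w.fn = U.ψ
  z_mem : ∃ zy : L2L2, ∀ᵐ x ∂leb, HasWeakDeriv (U.z x) (zy x)
  trace : ∀ᵐ x ∂leb, HasTraceAt (U.z x) 0 (U.ψ x)

/-- The graph of the operator `𝒜`: `U ∈ D(𝒜)` and `𝒜 U = W`. Here `uxx`, `φxx`, `zy` are weak
derivatives and `z1` is the trace `z(·, 1)`. -/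
def IsA (U W : Energy P) : Prop :=
  InDomain U ∧ ∃ (uxx φxx z1 : L2) (zy : L2L2),
    HasWeakDeriv U.u.dx uxx ∧ HasWeakDeriv U.φ.dx φxx ∧
    (∀ᵐ x ∂leb, HasTraceAt (U.z x) 1 (z1 x)) ∧
    (∀ᵐ x ∂leb, HasWeakDeriv (U.z x) (zy x)) ∧
    W.u.fn = U.v ∧
    W.v = (P.μ / P.ρ) • uxx + (P.b / P.ρ) • U.φ.dx ∧
    W.φ.fn = U.ψ ∧
    W.ψ = (P.δ / P.J) • φxx - (P.b / P.J) • U.u.dx - (P.ξ / P.J) • U.φ.fn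
      - (P.μ₁ / P.J) • U.ψ - (P.μ₂ / P.J) • z1 ∧
    W.z = -(1 / P.τ) • zy

/-- The growth condition on the forcing term. -/
def Growth (f : ℝ → ℝ) : Prop :=
  ∃ k₀ > (0 : ℝ), ∃ θ > (0 : ℝ), ∀ x y : ℝ,
    |f x - f y| ≤ k₀ * (|x| ^ θ + |y| ^ θ) * |x - y|

theorem Growth.continuous {f : ℝ → ℝ} (hf : Growth f) : Continuous f := by
  obtain ⟨k, hk, θ, hθ, h⟩ := hf
  rw [continuous_iff_continuousAt]
  intro x
  rw [ContinuousAt, tendsto_iff_norm_sub_tendsto_zero]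
  have hc : Continuous fun y : ℝ => k * (|y| ^ θ + |x| ^ θ) * |y - x| := by
    have : Continuous fun y : ℝ => |y| ^ θ :=
      continuous_abs.rpow_const fun _ => Or.inr hθ.le
    fun_prop
  refine squeeze_zero (fun _ => norm_nonneg _) (fun y => h y x) ?_
  simpa using hc.tendsto x

/-- The composition of the forcing term with an element of `H¹₀(0,1)` is in `L²(0,1)`. -/
theorem Growth.memLp {f : ℝ → ℝ} (hf : Growth f) (φ : H10) :
    MemLp (fun x => f (φ.fn x)) 2 leb := by
  obtain ⟨C, hC⟩ := (isCompact_Icc (a := -‖φ.dx‖) (b := ‖φ.dx‖)).exists_bound_of_continuousOn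
    hf.continuous.continuousOn
  refine MemLp.of_bound
    (hf.continuous.comp_aestronglyMeasurable (Lp.aestronglyMeasurable φ.fn)) C ?_
  filter_upwards [φ.ae_bound] with x hx
  exact hC _ (abs_le.1 hx)

/-- The nonlinearity `ℱ(U) = (0, 0, 0, -f(φ)/J, 0)`. -/
def opF {f : ℝ → ℝ} (hf : Growth f) (U : Energy P) : Energy P :=
  Energy.mk 0 0 0 (-(1 / P.J) • (hf.memLp U.φ).toLp (fun x => f (U.φ.fn x))) 0

/-! ### Semigroups and solutions -/

section Abstract

variable {H : Type} [NormedAddCommGroup H] [NormedSpace ℝ H]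

/-- `S(t)`, `t ≥ 0`, is a `C₀`-semigroup of contractions on `H`. -/
structure IsContractionSemigroup (S : ℝ → H →L[ℝ] H) : Prop where
  zero : S 0 = ContinuousLinearMap.id ℝ H
  add : ∀ s t : ℝ, 0 ≤ s → 0 ≤ t → S (s + t) = (S s).comp (S t)
  tendsto : ∀ x : H, Tendsto (fun t => S t x) (𝓝[>] 0) (𝓝 x)
  contraction : ∀ t : ℝ, 0 ≤ t → ‖S t‖ ≤ 1

/-- The operator with graph `A` is the infinitesimal generator of `S`. -/
def IsGenerator (A : H → H → Prop) (S : ℝ → H →L[ℝ] H) : Prop :=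
  ∀ x y : H, A x y ↔ Tendsto (fun t : ℝ => t⁻¹ • (S t x - x)) (𝓝[>] 0) (𝓝 y)

/-- `U ∈ C([0,T], H)` is a mild solution on `[0,T]` of `U' = A U + F(U)`, `U(0) = U₀`, where `A`
generates `S`. -/
def IsMildOn (S : ℝ → H →L[ℝ] H) (F : H → H) (U₀ : H) (T : ℝ) (U : ℝ → H) : Prop :=
  ContinuousOn U (Icc 0 T) ∧
    ∀ t ∈ Icc 0 T, U t = S t U₀ + ∫ s in (0 : ℝ)..t, S (t - s) (F (U s))

/-- `U ∈ C([0,∞), H)` is a global mild solution of `U' = A U + F(U)`, `U(0) = U₀`. -/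
def IsMild (S : ℝ → H →L[ℝ] H) (F : H → H) (U₀ : H) (U : ℝ → H) : Prop :=
  ContinuousOn U (Ici 0) ∧
    ∀ t : ℝ, 0 ≤ t → U t = S t U₀ + ∫ s in (0 : ℝ)..t, S (t - s) (F (U s))

/-- `U` is a strong solution on `[0,∞)` of `U' = A U + F(U)`, `U(0) = U₀`: it is the integral of a
locally integrable function `U'`, is differentiable with derivative `U'` almost everywhere, and
satisfies the equation almost everywhere (in particular, takes values in the domain there). -/
def IsStrong (A : H → H → Prop) (F : H → H) (U₀ : H) (U : ℝ → H) : Prop :=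
  ContinuousOn U (Ici 0) ∧ U 0 = U₀ ∧ ∃ U' : ℝ → H,
    (∀ T : ℝ, 0 ≤ T → IntervalIntegrable U' volume 0 T) ∧
    (∀ t : ℝ, 0 ≤ t → U t = U₀ + ∫ s in (0 : ℝ)..t, U' s) ∧
    ∀ᵐ t ∂(volume.restrict (Ioi (0 : ℝ))),
      HasDerivAt U (U' t) t ∧ ∃ w : H, A (U t) w ∧ U' t = w + F (U t)

end Abstract

end Porous

end

/-!
The operator `𝒜` generates a contraction semigroup because it is maximal dissipative (Lumer–Phillips,
`IsMaxDissipative.exists_semigroup`, through Yosida approximations). It is handled in a weak form,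
`graphA`, in which the delay variable is eliminated by the Volterra operator `V`: a function `z` with
`z(·, 0) = ψ` and weak derivative `z_y` is `ψ + V z_y`, with trace `z(·, 1)` equal to `ψ` plus the mean
of `z_y` (`isA_iff`, by the lemma of du Bois-Reymond). Dissipativity is the energy identity together
with Young's inequality, where the two bounds on `η` are used. For maximality, the transport equation
`k z + z_y = w` is solved by inverting the coercive operator `1 + k V`, its trace at `y = 1` is
`β ψ + r` with `|β| ≤ 1`, and what remains is an elliptic problem for `(u, φ)` that Lax–Milgram solves
in the energy space itself, since `μ₂ ≤ μ₁` makes the additional terms nonnegative (`graphA_surj`).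

The forcing term `f` is only locally Lipschitz, so it is truncated at a level `R`. The truncated
operator is globally Lipschitz, and agrees with the original one where `‖φ_x‖ ≤ R`, because
`|φ| ≤ ‖φ_x‖` on `H¹₀(0,1)`. The truncated problem has global mild solutions, which depend on the
initial value in a Lipschitz way (Picard and Gronwall). The energy
`‖U‖² / 2 + ∫ f̂(φ)` does not increase along mild solutions: its upper right derivative is nonpositive
(`eventually_totalEnergy_lt`), as the semigroup contracts and as the work of the forcing term cancels
against the change of the potential. As `f̂ ≥ 0`, this bounds `‖φ_x(t)‖` by a number `radius f X` that
depends only on the initial value `X`, neither on time nor on `R`. Above this level, the truncated and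
the original problem have the same mild solutions (`norm_φ_dx_le_of_trunc`, `norm_φ_dx_le`), which gives
global existence, uniqueness, and continuous dependence with a constant that is independent of `T`.

If `U₀ ∈ D(𝒜)`, comparison of a solution with its translates shows that it is Lipschitz continuous in
time on bounded intervals. Separable Hilbert spaces have the Radon–Nikodým property
(`exists_hasDerivAt_of_lipschitzWith`), so the solution is the integral of its derivative, which exists
almost everywhere; where it exists, the variation of constants formula puts the solution in `D(𝒜)`
(`generator_of_hasDerivAt`).
-/

namespace Porous

/-! ### Maximal dissipative operators and the Lumer–Phillips theorem -/

section MaxDissipative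

variable {H : Type} [NormedAddCommGroup H] [InnerProductSpace ℝ H]

/-- `A` is the graph of a linear operator that is dissipative and for which `l - A` is onto for every
`l > 0`. Linear operators with a domain are encoded by their graphs, and `single` says that `A` is a
graph; the domain is then automatically dense. -/
structure IsMaxDissipative (A : Submodule ℝ (H × H)) : Prop where
  single : ∀ y, ((0 : H), y) ∈ A → y = 0
  dissipative : ∀ x y, (x, y) ∈ A → inner ℝ y x ≤ 0
  surj : ∀ l : ℝ, 0 < l → ∀ w : H, ∃ x y, (x, y) ∈ A ∧ l • x - y = w

namespace IsMaxDissipative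

variable {A : Submodule ℝ (H × H)}

theorem norm_le (hA : IsMaxDissipative A) {l : ℝ} {x y : H} (h : (x, y) ∈ A) :
    l * ‖x‖ ≤ ‖l • x - y‖ := by
  have h1 := hA.dissipative x y h
  have h2 : inner ℝ (l • x - y) x = l * ‖x‖ ^ 2 - inner ℝ y x := by
    rw [inner_sub_left, real_inner_smul_left, real_inner_self_eq_norm_sq]
  have h3 := real_inner_le_norm (l • x - y) x
  rcases (norm_nonneg x).eq_or_lt with h0 | h0
  · rw [← h0]; simp
  · nlinarith

/-- The resolvent operators. -/
theorem exists_resolvent (hA : IsMaxDissipative A) {l : ℝ} (hl : 0 < l) :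
    ∃ R : H →L[ℝ] H, (∀ w, (R w, l • R w - w) ∈ A) ∧ (∀ w, l * ‖R w‖ ≤ ‖w‖) ∧
      ∀ x y, (x, y) ∈ A → R (l • x - y) = x := by
  choose r s hrs hw using hA.surj l hl
  have uniq : ∀ x y x' y', (x, y) ∈ A → (x', y') ∈ A → l • x - y = l • x' - y' → x = x' := by
    intro x y x' y' h h' he
    have h1 := hA.norm_le (l := l) (A.sub_mem h h')
    have h2 : l • (x - x') - (y - y') = 0 := by
      rw [smul_sub, sub_sub_sub_comm, he, sub_self]
    change l * ‖x - x'‖ ≤ ‖l • (x - x') - (y - y')‖ at h1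
    rw [h2, norm_zero] at h1
    have : ‖x - x'‖ ≤ 0 := by
      by_contra hc
      push Not at hc
      nlinarith
    exact sub_eq_zero.1 (norm_le_zero_iff.1 this)
  have hs : ∀ w, s w = l • r w - w := fun w => by
    rw [eq_sub_iff_add_eq, add_comm]
    exact (sub_eq_iff_eq_add.1 (hw w)).symm
  have hb : ∀ w, l * ‖r w‖ ≤ ‖w‖ := fun w => by
    simpa only [hw w] using hA.norm_le (l := l) (hrs w)
  let R : H →ₗ[ℝ] H :=
    { toFun := r
      map_add' := fun a b => by
        refine uniq _ _ _ _ (hrs (a + b)) (A.add_mem (hrs a) (hrs b)) ?_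
        rw [hw, smul_add, add_sub_add_comm, hw, hw]
      map_smul' := fun c a => by
        refine uniq _ _ _ _ (hrs (c • a)) (A.smul_mem c (hrs a)) ?_
        rw [hw, RingHom.id_apply, smul_comm, ← smul_sub, hw] }
  refine ⟨R.mkContinuous l⁻¹ fun w => ?_, fun w => ?_, hb, fun x y h => ?_⟩
  · rw [inv_mul_eq_div, le_div_iff₀ hl, mul_comm]; exact hb w
  · have := hrs w
    rwa [hs] at this
  · exact uniq _ _ _ _ (hrs _) h (hw _)

variable [CompleteSpace H]

/-- The domain is dense: if `w = x - A x` is orthogonal to it, then dissipativity forces `x = 0`. -/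
theorem dense_domain (hA : IsMaxDissipative A) (w : H) {ε : ℝ} (hε : 0 < ε) :
    ∃ x y, (x, y) ∈ A ∧ ‖w - x‖ < ε := by
  set D : Submodule ℝ H := A.map (LinearMap.fst ℝ H H) with hD
  have hDense : Dense (D : Set H) := by
    rw [Submodule.dense_iff_topologicalClosure_eq_top, Submodule.topologicalClosure_eq_top_iff,
      Submodule.eq_bot_iff]
    intro w hw
    obtain ⟨x, y, hxy, he⟩ := hA.surj 1 one_pos w
    have h0 : inner ℝ x w = 0 := hw x ⟨(x, y), hxy, rfl⟩
    rw [← he, one_smul, inner_sub_right, real_inner_self_eq_norm_sq, real_inner_comm] at h0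
    have h1 := hA.dissipative x y hxy
    have h2 : ‖x‖ ^ 2 = 0 := le_antisymm (by linarith) (sq_nonneg _)
    have hx : x = 0 := by simpa using h2
    subst hx
    have h3 : w = -y := by rw [← he]; simp
    rw [h3, hA.single y hxy, neg_zero]
  obtain ⟨x, hx, hd⟩ := hDense.exists_dist_lt w hε
  obtain ⟨⟨a, y⟩, ha, rfl⟩ := hx
  exact ⟨a, y, ha, by rwa [dist_eq_norm] at hd⟩

/-- The Yosida approximations of a maximal dissipative operator: bounded dissipative operators
`B n`, commuting with each other, with `B n x = J n y` for `(x, y) ∈ A`, where the contractions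
`J n` converge strongly to the identity. -/
theorem exists_yosida (hA : IsMaxDissipative A) :
    ∃ B J : ℕ → H →L[ℝ] H, (∀ n x, inner ℝ (B n x) x ≤ 0) ∧ (∀ n m, Commute (B n) (B m)) ∧
      (∀ n x y, (x, y) ∈ A → B n x = J n y) ∧ (∀ n x, ‖J n x‖ ≤ ‖x‖) ∧
      ∀ x, Tendsto (fun n => J n x) atTop (𝓝 x) := by
  set c : ℕ → ℝ := fun n => n + 1 with hc
  have hc0 : ∀ n, 0 < c n := fun n => by positivity
  choose R hR hRn hRi using fun n => hA.exists_resolvent (hc0 n)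
  -- The resolvent identity.
  have hdiff : ∀ n m w, R n w - R m w = (c m - c n) • R n (R m w) := by
    intro n m w
    have h := A.sub_mem (hR n w) (hR m w)
    have h1 := hRi n _ _ h
    rw [← map_smul]
    rw [← h1]
    simp only [smul_sub, sub_smul, map_sub, map_smul]
    abel
  have hcomm : ∀ n m, Commute (R n) (R m) := by
    intro n m
    ext w
    change R n (R m w) = R m (R n w)
    by_cases h : c m - c n = 0
    · have : n = m := by
        have : (m : ℝ) = n := by simp only [hc] at h; linarith
        exact_mod_cast this.symm
      rw [this]
    · have h1 := hdiff n m w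
      have h2 := hdiff m n w
      have h3 : (c m - c n) • R n (R m w) = (c m - c n) • R m (R n w) := by
        rw [← h1, ← neg_sub (c n) (c m), neg_smul, ← h2, neg_sub]
      exact smul_right_injective _ h h3
  have hJ : ∀ n x, ‖c n • R n x‖ ≤ ‖x‖ := fun n x => by
    rw [norm_smul, Real.norm_of_nonneg (hc0 n).le]; exact hRn n x
  have hBx : ∀ n x y, (x, y) ∈ A → c n • (c n • R n x - x) = c n • R n y := by
    intro n x y h
    have := hRi n x y h
    rw [map_sub, map_smul] at this
    congr 1
    rw [sub_eq_iff_eq_add] at this ⊢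
    rw [this, add_comm]
  refine ⟨fun n => c n • (c n • R n - 1), fun n => c n • R n, ?_, ?_, ?_, ?_, ?_⟩
  · intro n x
    change inner ℝ (c n • (c n • R n x - x)) x ≤ 0
    rw [real_inner_smul_left, inner_sub_left, real_inner_self_eq_norm_sq]
    have h1 := (real_inner_le_norm (c n • R n x) x).trans
      (mul_le_mul_of_nonneg_right (hJ n x) (norm_nonneg x))
    exact mul_nonpos_of_nonneg_of_nonpos (hc0 n).le (by nlinarith)
  · intro n m
    refine Commute.smul_left (Commute.smul_right ?_ _) _
    refine Commute.sub_left (Commute.sub_right ?_ (Commute.one_right _)) (Commute.one_left _)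
    exact Commute.smul_left (Commute.smul_right (hcomm n m) _) _
  · exact hBx
  · exact hJ
  · intro x
    rw [Metric.tendsto_atTop]
    intro ε hε
    obtain ⟨x', y', h', hd⟩ := hA.dense_domain x (show 0 < ε / 4 by linarith)
    obtain ⟨N, hN⟩ := exists_nat_gt (‖y'‖ / (ε / 4))
    refine ⟨N, fun n hn => ?_⟩
    have h1 : c n • R n x' - x' = R n y' := by
      have := hBx n x' y' h'
      exact smul_right_injective _ (hc0 n).ne' this
    have h2 : ‖R n y'‖ ≤ ε / 4 := by
      have h3 := hRn n y'
      have h4 : ‖y'‖ ≤ c n * (ε / 4) := by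
        rw [div_lt_iff₀ (by linarith)] at hN
        have : (N : ℝ) ≤ n := by exact_mod_cast hn
        simp only [hc]
        nlinarith
      exact le_of_mul_le_mul_left (h3.trans h4) (hc0 n)
    have h5 : c n • R n x - x = c n • R n (x - x') + R n y' - (x - x') := by
      rw [← h1, map_sub, smul_sub]; abel
    rw [dist_eq_norm]
    change ‖c n • R n x - x‖ < ε
    rw [h5]
    calc _ ≤ ‖c n • R n (x - x')‖ + ‖R n y'‖ + ‖x - x'‖ :=
          (norm_sub_le _ _).trans (by gcongr; exact norm_add_le _ _)
      _ < ε := by linarith [hJ n (x - x')]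

end IsMaxDissipative

/-- The exponential of a bounded dissipative operator is a contraction. -/
theorem norm_exp_smul_le [CompleteSpace H] {B : H →L[ℝ] H} (hB : ∀ x, inner ℝ (B x) x ≤ 0) {t : ℝ}
    (ht : 0 ≤ t) (x : H) : ‖NormedSpace.exp (t • B) x‖ ≤ ‖x‖ := by
  have hd : ∀ s : ℝ, HasDerivAt (fun s : ℝ => NormedSpace.exp (s • B) x)
      (B (NormedSpace.exp (s • B) x)) s := fun s =>
    ((ContinuousLinearMap.apply ℝ H x).hasFDerivAt.comp_hasDerivAt s
      (hasDerivAt_exp_smul_const' B s))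
  have hn : ∀ s : ℝ, HasDerivAt (fun s : ℝ => ‖NormedSpace.exp (s • B) x‖ ^ 2)
      (2 * inner ℝ (NormedSpace.exp (s • B) x) (B (NormedSpace.exp (s • B) x))) s :=
    fun s => (hd s).norm_sq
  have ha : Antitone fun s : ℝ => ‖NormedSpace.exp (s • B) x‖ ^ 2 := by
    refine antitone_of_deriv_nonpos (fun s => (hn s).differentiableAt) fun s => ?_
    rw [(hn s).deriv, real_inner_comm]
    linarith [hB (NormedSpace.exp (s • B) x)]
  have := ha ht
  simp only [zero_smul, NormedSpace.exp_zero] at this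
  exact abs_le_of_sq_le_sq' this (norm_nonneg _) |>.2

/-- Integrate the derivative of `s ↦ exp (s B) exp ((t - s) C) x` over `[0, t]`. -/
theorem norm_exp_sub_exp_le [CompleteSpace H] {B C : H →L[ℝ] H} (hB : ∀ x, inner ℝ (B x) x ≤ 0)
    (hC : ∀ x, inner ℝ (C x) x ≤ 0) (hcomm : Commute B C) {t : ℝ} (ht : 0 ≤ t) (x : H) :
    ‖NormedSpace.exp (t • B) x - NormedSpace.exp (t • C) x‖ ≤ t * ‖B x - C x‖ := by
  have hd : ∀ s : ℝ, HasDerivAt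
      (fun s : ℝ => (NormedSpace.exp (s • B) * NormedSpace.exp ((t - s) • C)) x)
      ((NormedSpace.exp (s • B) * NormedSpace.exp ((t - s) • C)) (B x - C x)) s := by
    intro s
    have h1 := hasDerivAt_exp_smul_const B s
    have h2 := (hasDerivAt_exp_smul_const C (t - s)).scomp s ((hasDerivAt_id s).const_sub t)
    have h3 := (ContinuousLinearMap.apply ℝ H x).hasFDerivAt.comp_hasDerivAt s (h1.mul h2)
    have hc : Commute B (NormedSpace.exp ((t - s) • C)) := (hcomm.smul_right _).exp_right
    refine h3.congr_deriv ?_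
    have e1 : NormedSpace.exp (s • B) * B * NormedSpace.exp ((t - s) • C)
        = NormedSpace.exp (s • B) * NormedSpace.exp ((t - s) • C) * B := by
      rw [mul_assoc, hc.eq, mul_assoc]
    simp only [Function.comp, neg_smul, one_smul, mul_neg, e1]
    simp [sub_eq_add_neg]
  have hb : ∀ s ∈ Ico 0 t,
      ‖(NormedSpace.exp (s • B) * NormedSpace.exp ((t - s) • C)) (B x - C x)‖ ≤ ‖B x - C x‖ :=
    fun s hs => (norm_exp_smul_le hB hs.1 _).trans (norm_exp_smul_le hC (by linarith [hs.2]) _)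
  have := norm_image_sub_le_of_norm_deriv_le_segment' (fun s _ => (hd s).hasDerivWithinAt) hb t
    ⟨ht, le_rfl⟩
  simp only [sub_self, sub_zero, zero_smul, NormedSpace.exp_zero, mul_one, one_mul] at this
  rwa [mul_comm]

/-- The **Lumer–Phillips theorem** in a Hilbert space: a maximal dissipative operator generates a
`C₀`-semigroup of contractions (extended by the identity to negative times). -/
theorem IsMaxDissipative.exists_semigroup [CompleteSpace H] {A : Submodule ℝ (H × H)}
    (hA : IsMaxDissipative A) :
    ∃ S : ℝ → H →L[ℝ] H, IsContractionSemigroup S ∧ IsGenerator (fun x y => (x, y) ∈ A) S ∧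
      ∀ t ≤ 0, S t = ContinuousLinearMap.id ℝ H := by
  obtain ⟨B, J, hB, hcomm, hBJ, hJ, hJlim⟩ := hA.exists_yosida
  set E : ℕ → ℝ → H →L[ℝ] H := fun n t => NormedSpace.exp (t • B n) with hE
  have hEc : ∀ n t x, 0 ≤ t → ‖E n t x‖ ≤ ‖x‖ := fun n t x ht => norm_exp_smul_le (hB n) ht x
  have hEs : ∀ n t x z, 0 ≤ t → ‖E n t x - E n t z‖ ≤ ‖x - z‖ := fun n t x z ht => by
    rw [← map_sub]; exact hEc n t _ ht
  have hcauchy : ∀ t x, 0 ≤ t → CauchySeq fun n => E n t x := by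
    intro t x ht
    rw [Metric.cauchySeq_iff]
    intro ε hε
    obtain ⟨x', y', h', hd⟩ := hA.dense_domain x (show 0 < ε / 4 by linarith)
    obtain ⟨N, hN⟩ := Metric.cauchySeq_iff.1 (hJlim y').cauchySeq (ε / (2 * (t + 1)))
      (by positivity)
    refine ⟨N, fun n hn m hm => ?_⟩
    have h1 := norm_exp_sub_exp_le (hB n) (hB m) (hcomm n m) ht x'
    rw [hBJ n _ _ h', hBJ m _ _ h', ← dist_eq_norm (J n y')] at h1
    have h2 : t * dist (J n y') (J m y') < ε / 2 := by
      have := hN n hn m hm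
      rw [lt_div_iff₀ (by positivity)] at this
      have h0 : 0 ≤ dist (J n y') (J m y') := dist_nonneg
      nlinarith
    have h3 := hEs n t x x' ht
    have h4 := hEs m t x x' ht
    rw [dist_eq_norm]
    have e : E n t x - E m t x
        = (E n t x - E n t x') + (E n t x' - E m t x') - (E m t x - E m t x') := by abel
    rw [e]
    refine (norm_sub_le _ _).trans_lt ((add_le_add_left (norm_add_le _ _) _).trans_lt ?_)
    change ‖E n t x' - E m t x'‖ ≤ _ at h1
    linarith
  choose! L hL using fun t x ht => cauchySeq_tendsto_of_complete (hcauchy t x ht)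
  have hLS : ∀ t, ∃ T : H →L[ℝ] H, ‖T‖ ≤ 1 ∧ ∀ x, T x = L (max t 0) x := by
    intro t
    have ht : 0 ≤ max t 0 := le_max_right _ _
    let T : H →ₗ[ℝ] H :=
      { toFun := L (max t 0)
        map_add' := fun x z => tendsto_nhds_unique (hL _ (x + z) ht) <| by
          simpa only [map_add] using (hL _ x ht).add (hL _ z ht)
        map_smul' := fun a x => tendsto_nhds_unique (hL _ (a • x) ht) <| by
          simpa only [map_smul, RingHom.id_apply] using (hL _ x ht).const_smul a }
    have hT : ∀ x, ‖T x‖ ≤ 1 * ‖x‖ := fun x => by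
      rw [one_mul]
      exact le_of_tendsto' (hL _ x ht).norm fun n => hEc n _ x ht
    exact ⟨T.mkContinuous 1 hT, T.mkContinuous_norm_le zero_le_one hT, fun x => rfl⟩
  choose S hS1 hSL using hLS
  have hSt : ∀ t x, 0 ≤ t → Tendsto (fun n => E n t x) atTop (𝓝 (S t x)) := fun t x ht => by
    have := hL t x ht
    rwa [hSL, max_eq_left ht]
  have hneg : ∀ t ≤ 0, S t = ContinuousLinearMap.id ℝ H := by
    intro t ht
    ext x
    rw [hSL, max_eq_right ht]
    refine tendsto_nhds_unique (hL 0 x le_rfl) ?_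
    simp [hE]
  -- Equicontinuity of the approximating semigroups at `t = 0`.
  have hequi : ∀ y, ∀ ε > 0, ∃ δ > 0, ∀ s, 0 ≤ s → s ≤ δ → ∀ n, ‖E n s y - y‖ ≤ ε := by
    intro y ε hε
    obtain ⟨x', y', h', hd⟩ := hA.dense_domain y (show 0 < ε / 4 by linarith)
    refine ⟨ε / (2 * (‖y'‖ + 1)), by positivity, fun s hs hsδ n => ?_⟩
    have h1 := norm_exp_sub_exp_le (hB n) (C := 0) (by simp) (Commute.zero_right _) hs x'
    rw [hBJ n _ _ h'] at h1
    simp only [smul_zero, NormedSpace.exp_zero, one_apply_eq_self,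
      zero_apply, sub_zero] at h1
    change ‖E n s x' - x'‖ ≤ _ at h1
    have h2 : s * ‖J n y'‖ ≤ ε / 2 := by
      rw [le_div_iff₀ (by positivity)] at hsδ
      have := hJ n y'
      have := norm_nonneg (J n y')
      nlinarith
    have h3 := hEs n s y x' hs
    have e : E n s y - y = (E n s y - E n s x') + (E n s x' - x') - (y - x') := by abel
    rw [e]
    refine (norm_sub_le _ _).trans ((add_le_add_left (norm_add_le _ _) _).trans ?_)
    linarith
  have hlim : ∀ x, Tendsto (fun t => S t x) (𝓝[>] 0) (𝓝 x) := by
    intro x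
    rw [Metric.tendsto_nhds]
    intro ε hε
    obtain ⟨δ, hδ, h⟩ := hequi x (ε / 2) (by linarith)
    filter_upwards [Ioc_mem_nhdsGT hδ] with t ht
    rw [dist_eq_norm]
    have := le_of_tendsto' ((hSt t x ht.1.le).sub_const x).norm fun n => h t ht.1.le ht.2 n
    linarith
  have hgen : ∀ x y, (x, y) ∈ A → Tendsto (fun t : ℝ => t⁻¹ • (S t x - x)) (𝓝[>] 0) (𝓝 y) := by
    intro x y hxy
    rw [Metric.tendsto_nhds]
    intro ε hε
    obtain ⟨δ, hδ, h⟩ := hequi y (ε / 2) (by linarith)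
    filter_upwards [Ioc_mem_nhdsGT hδ] with t ht
    have hn : ∀ n, ‖E n t x - x - t • y‖ ≤ (ε / 2 + ‖J n y - y‖) * t := by
      intro n
      have hd : ∀ s : ℝ, HasDerivAt (fun s : ℝ => E n s x - s • y) (E n s (J n y) - y) s := by
        intro s
        have h1 := (ContinuousLinearMap.apply ℝ H x).hasFDerivAt.comp_hasDerivAt s
          (hasDerivAt_exp_smul_const (B n) s)
        have h2 := h1.sub ((hasDerivAt_id s).smul_const y)
        refine h2.congr_deriv ?_
        simp [← hBJ n x y hxy, hE]
      have hb : ∀ s ∈ Ico 0 t, ‖E n s (J n y) - y‖ ≤ ε / 2 + ‖J n y - y‖ := by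
        intro s hs
        have h1 := hEs n s (J n y) y hs.1
        have h2 := h s hs.1 (hs.2.le.trans ht.2) n
        have e : E n s (J n y) - y = (E n s y - y) + (E n s (J n y) - E n s y) := by abel
        rw [e]
        exact (norm_add_le _ _).trans (add_le_add h2 h1)
      have := norm_image_sub_le_of_norm_deriv_le_segment' (fun s _ => (hd s).hasDerivWithinAt) hb
        t ⟨ht.1.le, le_rfl⟩
      have e : E n t x - t • y - (E n 0 x - (0 : ℝ) • y) = E n t x - x - t • y := by
        simp only [hE, zero_smul, NormedSpace.exp_zero, one_apply_eq_self]
        abel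
      rwa [e, sub_zero] at this
    have h0 : ‖S t x - x - t • y‖ ≤ (ε / 2 + 0) * t := by
      refine le_of_tendsto_of_tendsto' (((hSt t x ht.1.le).sub_const x).sub_const _).norm ?_ hn
      refine Tendsto.mul_const _ (tendsto_const_nhds.add ?_)
      simpa using ((hJlim y).sub_const y).norm
    have e : t⁻¹ • (S t x - x) - y = t⁻¹ • (S t x - x - t • y) := by
      rw [smul_sub t⁻¹ (S t x - x), inv_smul_smul₀ ht.1.ne']
    rw [dist_eq_norm, e, norm_smul, Real.norm_of_nonneg (inv_nonneg.2 ht.1.le), inv_mul_eq_div,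
      div_lt_iff₀ ht.1]
    nlinarith [ht.1]
  refine ⟨S, ⟨hneg 0 le_rfl, ?_, hlim, fun t _ => hS1 t⟩, ?_, hneg⟩
  · intro s t hs ht
    ext x
    refine tendsto_nhds_unique (hSt (s + t) x (by linarith)) ?_
    have e : ∀ n, E n (s + t) x = E n s (E n t x) := fun n => by
      let := NormedAlgebra.restrictScalars ℚ ℝ (H →L[ℝ] H)
      simp only [hE, add_smul]
      rw [NormedSpace.exp_add_of_commute (((Commute.refl (B n)).smul_left s).smul_right t)]
      rfl
    simp only [e]
    have h1 : Tendsto (fun n => E n s (S t x)) atTop (𝓝 (S s (S t x))) := hSt s _ hs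
    have h2 : Tendsto (fun n => E n s (E n t x) - E n s (S t x)) atTop (𝓝 0) :=
      squeeze_zero_norm (fun n => hEs n s _ _ hs)
        (by simpa using ((hSt t x ht).sub_const (S t x)).norm)
    simpa using h2.add h1
  · -- A dissipative extension of a maximal dissipative operator does not enlarge its domain.
    intro x y
    refine ⟨hgen x y, fun h => ?_⟩
    obtain ⟨x', y', h', he⟩ := hA.surj 1 one_pos (x - y)
    rw [one_smul] at he
    have hd : y - y' = x - x' := by
      rw [sub_eq_sub_iff_add_eq_add] at he ⊢
      rw [add_comm, ← he, add_comm]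
    have h1 : Tendsto (fun t : ℝ => t⁻¹ • (S t (x - x') - (x - x'))) (𝓝[>] 0) (𝓝 (y - y')) := by
      refine (h.sub (hgen x' y' h')).congr fun t => ?_
      rw [map_sub, ← smul_sub]; congr 1; abel
    have h2 : inner ℝ (y - y') (x - x') ≤ 0 := by
      refine le_of_tendsto (h1.inner tendsto_const_nhds) ?_
      filter_upwards [self_mem_nhdsWithin] with t ht
      rw [real_inner_smul_left, inner_sub_left, real_inner_self_eq_norm_sq]
      have h3 := (real_inner_le_norm (S t (x - x')) (x - x')).trans
        (mul_le_mul_of_nonneg_right (((S t).le_of_opNorm_le (hS1 t) _).trans_eq (one_mul _))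
          (norm_nonneg _))
      exact mul_nonpos_of_nonneg_of_nonpos (inv_nonneg.2 (le_of_lt ht)) (by nlinarith)
    rw [hd, real_inner_self_eq_norm_sq] at h2
    have h3 : x - x' = 0 := by
      have : ‖x - x'‖ ^ 2 = 0 := le_antisymm h2 (sq_nonneg _)
      simpa using this
    have h4 : x = x' := sub_eq_zero.1 h3
    have h5 : y = y' := sub_eq_zero.1 (hd.trans h3)
    change (x, y) ∈ A
    rwa [h4, h5]

end MaxDissipative

/-! ### Contraction semigroups and the variation of constants formula -/

section Mild

variable {H : Type} [NormedAddCommGroup H] [NormedSpace ℝ H] {S : ℝ → H →L[ℝ] H}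

/-- A contraction semigroup, extended by the identity to negative times. With this choice the orbits
are continuous on the whole line, and no integrand has to be restricted to nonnegative times. -/
structure IsExtendedSemigroup (S : ℝ → H →L[ℝ] H) : Prop extends IsContractionSemigroup S where
  of_nonpos : ∀ t ≤ 0, S t = ContinuousLinearMap.id ℝ H

namespace IsExtendedSemigroup

theorem norm_le (hS : IsExtendedSemigroup S) (t : ℝ) (x : H) : ‖S t x‖ ≤ ‖x‖ := by
  rcases le_total t 0 with h | h
  · rw [hS.of_nonpos t h]; rfl
  · simpa using (S t).le_of_opNorm_le (hS.contraction t h) x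

theorem add_apply (hS : IsExtendedSemigroup S) {s t : ℝ} (hs : 0 ≤ s) (ht : 0 ≤ t) (x : H) :
    S (s + t) x = S s (S t x) := by
  rw [hS.add s t hs ht]; rfl

theorem continuous_orbit (hS : IsExtendedSemigroup S) (x : H) : Continuous fun t => S t x := by
  have h0 : Tendsto (fun t => S t x) (𝓝 0) (𝓝 x) := by
    rw [← nhdsLE_sup_nhdsGT (0 : ℝ)]
    refine Tendsto.sup (tendsto_const_nhds.congr' ?_) (hS.tendsto x)
    filter_upwards [self_mem_nhdsWithin] with t ht
    rw [hS.of_nonpos t ht]; rfl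
  have hmax : ∀ t, S t x = S (max t 0) x := fun t => by
    rcases le_total t 0 with h | h
    · rw [max_eq_right h, hS.of_nonpos t h, hS.of_nonpos 0 le_rfl]
    · rw [max_eq_left h]
  have key : ∀ s t : ℝ, 0 ≤ s → s ≤ t → ‖S t x - S s x‖ ≤ ‖S |t - s| x - x‖ := by
    intro s t hs hst
    rw [abs_of_nonneg (sub_nonneg.2 hst)]
    have : S t x = S s (S (t - s) x) := by
      rw [← hS.add_apply hs (sub_nonneg.2 hst), add_sub_cancel]
    rw [this, ← map_sub]
    exact hS.norm_le _ _
  have key' : ∀ s t : ℝ, ‖S t x - S s x‖ ≤ ‖S |max t 0 - max s 0| x - x‖ := by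
    intro s t
    rw [hmax s, hmax t]
    rcases le_total (max s 0) (max t 0) with h | h
    · exact key _ _ (le_max_right _ _) h
    · rw [norm_sub_rev, abs_sub_comm]
      exact key _ _ (le_max_right _ _) h
  rw [continuous_iff_continuousAt]
  intro s
  rw [ContinuousAt, tendsto_iff_norm_sub_tendsto_zero]
  refine squeeze_zero (fun _ => norm_nonneg _) (fun t => key' s t) ?_
  have h1 : Tendsto (fun t => |max t 0 - max s 0|) (𝓝 s) (𝓝 0) := by
    have : Continuous fun t : ℝ => |max t 0 - max s 0| := by fun_prop
    simpa using this.tendsto s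
  simpa using ((h0.comp h1).sub_const x).norm

theorem continuous_uncurry (hS : IsExtendedSemigroup S) :
    Continuous fun p : ℝ × H => S p.1 p.2 := by
  rw [continuous_iff_continuousAt]
  rintro ⟨t, x⟩
  have h1 : Tendsto (fun p : ℝ × H => S p.1 x) (𝓝 (t, x)) (𝓝 (S t x)) :=
    ((hS.continuous_orbit x).comp continuous_fst).tendsto _
  have h2 : Tendsto (fun p : ℝ × H => S p.1 p.2 - S p.1 x) (𝓝 (t, x)) (𝓝 0) := by
    refine squeeze_zero_norm (a := fun p : ℝ × H => ‖p.2 - x‖) (fun p => ?_) ?_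
    · rw [← map_sub]; exact hS.norm_le _ _
    · have : Continuous fun p : ℝ × H => ‖p.2 - x‖ := by fun_prop
      simpa using this.tendsto (t, x)
  simpa [ContinuousAt] using h2.add h1

theorem continuous_apply (hS : IsExtendedSemigroup S) {X : Type*} [TopologicalSpace X] {a : X → ℝ}
    {g : X → H} (ha : Continuous a) (hg : Continuous g) : Continuous fun x => S (a x) (g x) :=
  hS.continuous_uncurry.comp (ha.prodMk hg)

theorem intervalIntegrable (hS : IsExtendedSemigroup S) {g : ℝ → H} (hg : Continuous g)
    (t a b : ℝ) : IntervalIntegrable (fun s => S (t - s) (g s)) volume a b :=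
  (hS.continuous_apply (by fun_prop) hg).intervalIntegrable a b

end IsExtendedSemigroup

/-- The mild solution of `U' = A U + g(t)`, `U(0) = 0`, where `A` generates `S`. -/
noncomputable def duhamel (S : ℝ → H →L[ℝ] H) (g : ℝ → H) (t : ℝ) : H :=
  ∫ s in (0 : ℝ)..t, S (t - s) (g s)

theorem duhamel_congr {g h : ℝ → H} {t : ℝ} (ht : 0 ≤ t) (hgh : EqOn g h (Icc 0 t)) :
    duhamel S g t = duhamel S h t := by
  refine intervalIntegral.integral_congr fun s hs => ?_
  rw [uIcc_of_le ht] at hs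
  simp only [hgh hs]

namespace IsExtendedSemigroup

theorem continuous_duhamel (hS : IsExtendedSemigroup S) {g : ℝ → H} (hg : Continuous g) :
    Continuous (duhamel S g) :=
  intervalIntegral.continuous_parametric_intervalIntegral_of_continuous
    (hS.continuous_apply (X := ℝ × ℝ) (by fun_prop) (hg.comp continuous_snd)) continuous_id

theorem duhamel_sub (hS : IsExtendedSemigroup S) {g h : ℝ → H} (hg : Continuous g)
    (hh : Continuous h) (t : ℝ) :
    duhamel S g t - duhamel S h t = duhamel S (fun s => g s - h s) t := by
  simp only [duhamel, map_sub]
  exact (intervalIntegral.integral_sub (hS.intervalIntegrable hg _ _ _)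
    (hS.intervalIntegrable hh _ _ _)).symm

theorem norm_duhamel_le_integral (hS : IsExtendedSemigroup S) (g : ℝ → H) {b : ℝ → ℝ}
    (hb : Continuous b) {t : ℝ} (ht : 0 ≤ t) (hgb : ∀ s ∈ Icc 0 t, ‖g s‖ ≤ b s) :
    ‖duhamel S g t‖ ≤ ∫ s in (0 : ℝ)..t, b s := by
  refine intervalIntegral.norm_integral_le_of_norm_le ht ?_ (hb.intervalIntegrable _ _)
  exact Eventually.of_forall fun s hs => (hS.norm_le _ _).trans (hgb s ⟨hs.1.le, hs.2⟩)

/-- The cocycle property of the variation of constants formula. -/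
theorem duhamel_add [CompleteSpace H] (hS : IsExtendedSemigroup S) {g : ℝ → H} (hg : Continuous g)
    {a h : ℝ} (ha : 0 ≤ a) (hh : 0 ≤ h) :
    duhamel S g (a + h) = S h (duhamel S g a) + duhamel S (fun s => g (a + s)) h := by
  unfold duhamel
  rw [← intervalIntegral.integral_add_adjacent_intervals (b := a)
    (hS.intervalIntegrable hg _ _ _) (hS.intervalIntegrable hg _ _ _)]
  congr 1
  · rw [← ContinuousLinearMap.intervalIntegral_comp_comm _ (hS.intervalIntegrable hg _ _ _)]
    refine intervalIntegral.integral_congr fun s hs => ?_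
    rw [uIcc_of_le ha] at hs
    rw [← hS.add_apply hh (sub_nonneg.2 hs.2)]
    congr 2; ring
  · have := intervalIntegral.integral_comp_add_left (a := 0) (b := h)
      (fun s => S (a + h - s) (g s)) a
    rw [add_zero] at this
    rw [← this]
    refine intervalIntegral.integral_congr fun s _ => ?_
    simp only [add_sub_add_left_eq_sub]

theorem tendsto_duhamel [CompleteSpace H] (hS : IsExtendedSemigroup S) {g : ℝ → H}
    (hg : Continuous g) :
    Tendsto (fun k : ℝ => k⁻¹ • duhamel S g k) (𝓝[>] 0) (𝓝 (g 0)) := by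
  have hc : Continuous fun p : ℝ × ℝ => S (p.1 - p.2) (g p.2) :=
    hS.continuous_apply (by fun_prop) (hg.comp continuous_snd)
  rw [Metric.tendsto_nhds]
  intro ε hε
  have h0 := Metric.tendsto_nhds.1 (hc.tendsto (0, 0)) (ε / 2) (by linarith)
  obtain ⟨δ, hδ, h⟩ := Metric.eventually_nhds_iff.1 h0
  simp only [sub_zero, hS.of_nonpos 0 le_rfl, ContinuousLinearMap.id_apply] at h
  filter_upwards [Ioo_mem_nhdsGT hδ] with k hk
  have h1 : duhamel S g k - k • g 0 = ∫ s in (0 : ℝ)..k, (S (k - s) (g s) - g 0) := by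
    rw [intervalIntegral.integral_sub (hS.intervalIntegrable hg _ _ _) (by simp),
      intervalIntegral.integral_const, sub_zero]
    rfl
  have h2 : ‖duhamel S g k - k • g 0‖ ≤ ε / 2 * |k - 0| := by
    rw [h1]
    refine intervalIntegral.norm_integral_le_of_norm_le_const fun s hs => ?_
    rw [uIoc_of_le hk.1.le] at hs
    rw [← dist_eq_norm]
    refine (h (y := (k, s)) ?_).le
    rw [Prod.dist_eq]
    refine max_lt ?_ ?_
    · simpa [Real.dist_eq, abs_of_pos hk.1] using hk.2
    · simpa [Real.dist_eq, abs_of_pos hs.1] using hs.2.trans_lt hk.2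
  have e : k⁻¹ • duhamel S g k - g 0 = k⁻¹ • (duhamel S g k - k • g 0) := by
    rw [smul_sub, inv_smul_smul₀ hk.1.ne']
  rw [sub_zero, abs_of_pos hk.1] at h2
  rw [dist_eq_norm, e, norm_smul, Real.norm_of_nonneg (inv_nonneg.2 hk.1.le), inv_mul_eq_div,
    div_lt_iff₀ hk.1]
  nlinarith [hk.1]

/-- Time averages of orbits lie in the domain of the generator. -/
theorem generator_integral [CompleteSpace H] (hS : IsExtendedSemigroup S) {A : H → H → Prop}
    (hA : IsGenerator A S) (x : H) {h : ℝ} (hh : 0 ≤ h) :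
    A (∫ s in (0 : ℝ)..h, S s x) (S h x - x) := by
  rw [hA]
  have hc := hS.continuous_orbit x
  set G : ℝ → H := fun t => ∫ s in (0 : ℝ)..t, S s x with hG
  have hd : ∀ t, HasDerivAt G (S t x) t := fun t => hc.integral_hasStrictDerivAt 0 t |>.hasDerivAt
  have h1 := (hd h).tendsto_slope_zero_right
  have h2 := (hd 0).tendsto_slope_zero_right
  rw [hS.of_nonpos 0 le_rfl] at h2
  refine (h1.sub h2).congr' ?_
  filter_upwards [self_mem_nhdsWithin] with k hk
  have hk : (0 : ℝ) < k := hk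
  have e : S k (G h) = G (h + k) - G k := by
    simp only [hG]
    rw [← ContinuousLinearMap.intervalIntegral_comp_comm _ (hc.intervalIntegrable _ _),
      intervalIntegral.integral_interval_sub_left (hc.intervalIntegrable _ _)
        (hc.intervalIntegrable _ _)]
    have := intervalIntegral.integral_comp_add_left (a := 0) (b := h) (fun s => S s x) k
    rw [add_zero, add_comm k h] at this
    rw [← this]
    refine intervalIntegral.integral_congr fun s hs => ?_
    rw [uIcc_of_le hh] at hs
    rw [hS.add_apply hk.le hs.1]
  change _ = k⁻¹ • (S k (G h) - G h)
  rw [e, ← smul_sub]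
  congr 1
  simp only [hG, zero_add, intervalIntegral.integral_same]
  abel

/-- Orbits that start in the domain of the generator are Lipschitz continuous. -/
theorem norm_orbit_sub_le (hS : IsExtendedSemigroup S) {A : H → H → Prop} (hA : IsGenerator A S)
    {x y : H} (hxy : A x y) {h : ℝ} (hh : 0 ≤ h) : ‖S h x - x‖ ≤ ‖y‖ * h := by
  have hd : ∀ t ∈ Ico 0 h, HasDerivWithinAt (fun t => S t x) (S t y) (Ici t) t := by
    intro t ht
    rw [← hasDerivWithinAt_Ioi_iff_Ici,
      hasDerivWithinAt_iff_tendsto_slope' (show t ∉ Ioi t from lt_irrefl t)]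
    have h1 : Tendsto (fun z => z - t) (𝓝[>] t) (𝓝[>] 0) := by
      refine tendsto_nhdsWithin_iff.2 ⟨?_, ?_⟩
      · have : Continuous fun z : ℝ => z - t := by fun_prop
        simpa using (this.tendsto t).mono_left nhdsWithin_le_nhds
      · filter_upwards [self_mem_nhdsWithin] with z hz
        exact sub_pos.2 (mem_Ioi.1 hz)
    refine ((((S t).continuous.tendsto y).comp ((hA x y).1 hxy)).comp h1).congr' ?_
    filter_upwards [self_mem_nhdsWithin] with z hz
    have hz : t < z := hz
    have e : S z x = S t (S (z - t) x) := by
      rw [← hS.add_apply ht.1 (sub_pos.2 hz).le, add_sub_cancel]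
    simp only [Function.comp, slope_def_module, map_smul, map_sub, e]
  have := norm_image_sub_le_of_norm_deriv_right_le_segment (hS.continuous_orbit x).continuousOn hd
    (fun t _ => hS.norm_le t y) h ⟨hh, le_rfl⟩
  simpa [hS.of_nonpos 0 le_rfl] using this

end IsExtendedSemigroup

/-! ### Mild solutions of semilinear equations -/

variable {F : H → H}

theorem IsMildOn.congr {X : H} {T : ℝ} {U V : ℝ → H} (h : IsMildOn S F X T U)
    (hUV : EqOn V U (Icc 0 T)) : IsMildOn S F X T V := by
  refine ⟨h.1.congr hUV, fun t ht => ?_⟩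
  rw [hUV ht, h.2 t ht]
  congr 1
  exact duhamel_congr ht.1 fun s hs => by rw [hUV ⟨hs.1, hs.2.trans ht.2⟩]

theorem IsMildOn.congr_nonlinearity {X : H} {T : ℝ} {U : ℝ → H} {G : H → H}
    (h : IsMildOn S F X T U) (hFG : ∀ t ∈ Icc 0 T, F (U t) = G (U t)) : IsMildOn S G X T U := by
  refine ⟨h.1, fun t ht => ?_⟩
  rw [h.2 t ht]
  congr 1
  refine duhamel_congr (g := fun s => F (U s)) (h := fun s => G (U s)) ht.1 fun s hs => ?_
  exact hFG s ⟨hs.1, hs.2.trans ht.2⟩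

theorem IsMild.isMildOn {X : H} {U : ℝ → H} (h : IsMild S F X U) (T : ℝ) : IsMildOn S F X T U :=
  ⟨h.1.mono Icc_subset_Ici_self, fun t ht => h.2 t ht.1⟩

theorem isMild_of_isMildOn {X : H} {U : ℝ → H} (h : ∀ T, 0 ≤ T → IsMildOn S F X T U) :
    IsMild S F X U := by
  refine ⟨fun t ht => ?_, fun t ht => (h t ht).2 t ⟨ht, le_rfl⟩⟩
  have h1 := (h (t + 1) (by linarith [mem_Ici.1 ht])).1 t ⟨ht, by linarith⟩
  refine h1.mono_of_mem_nhdsWithin ?_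
  rw [← Ici_inter_Iic]
  exact inter_mem_nhdsWithin _ (Iic_mem_nhds (by linarith))

/-- A mild solution on `[0, T]` may be taken continuous on the line, by constant extension. -/
theorem IsMildOn.exists_continuous {X : H} {T : ℝ} {U : ℝ → H} (h : IsMildOn S F X T U)
    (hT : 0 ≤ T) : ∃ V, Continuous V ∧ EqOn V U (Icc 0 T) ∧ IsMildOn S F X T V := by
  have hEq : EqOn (IccExtend hT (domRestrict (Icc 0 T) U)) U (Icc 0 T) := fun t ht => by
    rw [IccExtend_of_mem _ _ ht]; rfl
  exact ⟨_, (continuousOn_iff_continuous_domRestrict.1 h.1).Icc_extend', hEq, h.congr hEq⟩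

namespace IsExtendedSemigroup

theorem mild_zero (hS : IsExtendedSemigroup S) {X : H} {T : ℝ} {U : ℝ → H}
    (h : IsMildOn S F X T U) (hT : 0 ≤ T) : U 0 = X := by
  simpa [hS.of_nonpos 0 le_rfl] using h.2 0 ⟨le_rfl, hT⟩

variable [CompleteSpace H]

/-- A mild solution restarted at time `a` is a mild solution. -/
theorem mild_restart (hS : IsExtendedSemigroup S) (hF : Continuous F) {X : H} {T : ℝ} {U : ℝ → H}
    (hU : Continuous U) (h : IsMildOn S F X T U) {a : ℝ} (ha : 0 ≤ a) :
    IsMildOn S F (U a) (T - a) fun s => U (a + s) := by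
  refine ⟨(hU.comp (continuous_const.add continuous_id)).continuousOn, fun t ht => ?_⟩
  have h1 := h.2 (a + t) ⟨by linarith [ht.1], by linarith [ht.2]⟩
  have h2 := h.2 a ⟨ha, by linarith [ht.1, ht.2]⟩
  have h3 := hS.duhamel_add (hF.comp hU) ha ht.1
  change U (a + t) = S (a + t) X + duhamel S (F ∘ U) (a + t) at h1
  change U (a + t) = S t (U a) + duhamel S (fun s => F (U (a + s))) t
  rw [h1, h3, h2, map_add, add_comm a t, hS.add_apply ht.1 ha, add_assoc]
  rfl

/-- At a point of differentiability, a mild solution takes its value in the domain of the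
generator, and satisfies the equation. -/
theorem generator_of_hasDerivAt (hS : IsExtendedSemigroup S) {A : H → H → Prop}
    (hA : IsGenerator A S) (hF : Continuous F) {X : H} {T : ℝ} {U : ℝ → H} (hU : Continuous U)
    (h : IsMildOn S F X T U) {t : ℝ} (ht : t ∈ Ico 0 T) {u' : H} (hd : HasDerivAt U u' t) :
    A (U t) (u' - F (U t)) := by
  rw [hA]
  have hg : Continuous fun s => F (U (t + s)) := by fun_prop
  have h1 := hS.tendsto_duhamel hg
  rw [add_zero] at h1
  refine (hd.tendsto_slope_zero_right.sub h1).congr' ?_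
  filter_upwards [Ioo_mem_nhdsGT (sub_pos.2 ht.2)] with k hk
  have := (hS.mild_restart hF hU h ht.1).2 k ⟨hk.1.le, hk.2.le⟩
  change U (t + k) = S k (U t) + duhamel S (fun s => F (U (t + s))) k at this
  rw [← smul_sub, this]
  congr 1
  abel

end IsExtendedSemigroup

/-- Gronwall's inequality in integral form. -/
theorem integral_gronwall {d : ℝ → ℝ} (hd : Continuous d) {a K T : ℝ} (hK : 0 ≤ K)
    (hd0 : ∀ t, 0 ≤ d t) (h : ∀ t ∈ Icc 0 T, d t ≤ a + K * ∫ s in (0 : ℝ)..t, d s)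
    {t : ℝ} (ht : t ∈ Icc 0 T) : d t ≤ a * Real.exp (K * t) := by
  have ha : 0 ≤ a := by
    have := h 0 ⟨le_rfl, ht.1.trans ht.2⟩
    simp only [intervalIntegral.integral_same, mul_zero, add_zero] at this
    exact (hd0 0).trans this
  set f : ℝ → ℝ := fun t => a + K * ∫ s in (0 : ℝ)..t, d s with hf
  have hfd : ∀ t, HasDerivAt f (K * d t) t := fun t =>
    ((hd.integral_hasStrictDerivAt 0 t).hasDerivAt.const_mul K).const_add a
  have hf0 : ∀ t ∈ Icc 0 T, 0 ≤ f t := fun t ht => (hd0 t).trans (h t ht)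
  have := norm_le_gronwallBound_of_norm_deriv_right_le (f := f) (f' := fun t => K * d t) (δ := a)
    (K := K) (ε := 0) (a := 0) (b := T) (fun t _ => (hfd t).continuousAt.continuousWithinAt)
    (fun t _ => (hfd t).hasDerivWithinAt) (by simp [hf, abs_of_nonneg ha])
    (fun t ht => by
      have ht' : t ∈ Icc 0 T := ⟨ht.1, ht.2.le⟩
      rw [Real.norm_of_nonneg (mul_nonneg hK (hd0 t)), Real.norm_of_nonneg (hf0 t ht'), add_zero]
      exact mul_le_mul_of_nonneg_left (h t ht') hK) t ht
  rw [gronwallBound_ε0, sub_zero, Real.norm_of_nonneg (hf0 t ht)] at this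
  exact (h t ht).trans this

namespace IsExtendedSemigroup

open scoped NNReal

/-- Lipschitz dependence of mild solutions on the initial value. -/
theorem mild_dist_le (hS : IsExtendedSemigroup S) {K : ℝ≥0} (hF : LipschitzWith K F) {X Y : H}
    {T : ℝ} {U V : ℝ → H} (hU : IsMildOn S F X T U) (hV : IsMildOn S F Y T V) {t : ℝ}
    (ht : t ∈ Icc 0 T) : ‖U t - V t‖ ≤ ‖X - Y‖ * Real.exp (K * t) := by
  have hT : 0 ≤ T := ht.1.trans ht.2
  obtain ⟨U', hUc, hUU, hU'⟩ := hU.exists_continuous hT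
  obtain ⟨V', hVc, hVV, hV'⟩ := hV.exists_continuous hT
  rw [← hUU ht, ← hVV ht]
  refine integral_gronwall (d := fun t => ‖U' t - V' t‖) (by fun_prop) K.2
    (fun _ => norm_nonneg _) (fun t ht => ?_) ht
  have h1 := hU'.2 t ht
  have h2 := hV'.2 t ht
  change U' t = _ + duhamel S (fun s => F (U' s)) t at h1
  change V' t = _ + duhamel S (fun s => F (V' s)) t at h2
  have hc := hF.continuous
  have h3 := hS.duhamel_sub (hc.comp hUc) (hc.comp hVc) t
  have e : U' t - V' t = S t (X - Y) + duhamel S (fun s => F (U' s) - F (V' s)) t := by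
    rw [h1, h2, map_sub]
    refine Eq.trans ?_ (congrArg (fun w => S t X - S t Y + w) h3)
    simp only [Function.comp_def]
    abel
  have h4 : ‖duhamel S (fun s => F (U' s) - F (V' s)) t‖ ≤ ∫ s in (0 : ℝ)..t, K * ‖U' s - V' s‖ :=
    hS.norm_duhamel_le_integral _ (by fun_prop) ht.1 fun s _ => hF.norm_sub_le _ _
  rw [intervalIntegral.integral_const_mul] at h4
  calc ‖U' t - V' t‖ = ‖S t (X - Y) + duhamel S (fun s => F (U' s) - F (V' s)) t‖ := by rw [e]
    _ ≤ _ := (norm_add_le _ _).trans (add_le_add (hS.norm_le _ _) h4)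

/-- Mild solutions with initial value in the domain of the generator are Lipschitz continuous in
time, on bounded time intervals: `U` and its translate `U (h + ·)` are two mild solutions, whose
initial values differ by `O(h)`. -/
theorem mild_lipschitzOn [CompleteSpace H] (hS : IsExtendedSemigroup S) {A : H → H → Prop}
    (hA : IsGenerator A S) {K : ℝ≥0} (hF : LipschitzWith K F) {X Y : H} (hXY : A X Y) {T : ℝ}
    (hT : 0 ≤ T) {U : ℝ → H} (hU : Continuous U) (h : IsMildOn S F X T U) :
    ∃ C : ℝ≥0, LipschitzOnWith C U (Icc 0 T) := by
  obtain ⟨M, hM⟩ := isCompact_Icc.exists_bound_of_continuousOn (s := Icc 0 T)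
    (hF.continuous.comp hU).continuousOn
  have hM0 : 0 ≤ M := (norm_nonneg _).trans (hM 0 ⟨le_rfl, hT⟩)
  have h1 : ∀ t ∈ Icc 0 T, ‖U t - X‖ ≤ (‖Y‖ + M) * t := by
    intro t ht
    have h2 : ‖duhamel S (fun s => F (U s)) t‖ ≤ ∫ s in (0 : ℝ)..t, M :=
      hS.norm_duhamel_le_integral _ continuous_const ht.1 fun s hs =>
        hM s ⟨hs.1, hs.2.trans ht.2⟩
    rw [intervalIntegral.integral_const, sub_zero, smul_eq_mul] at h2
    have e : U t - X = (S t X - X) + duhamel S (fun s => F (U s)) t := by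
      rw [h.2 t ht]; unfold duhamel; abel
    rw [e]
    refine (norm_add_le _ _).trans ((add_le_add (hS.norm_orbit_sub_le hA hXY ht.1) h2).trans_eq ?_)
    ring
  set C : ℝ := (‖Y‖ + M) * Real.exp (K * T) with hC
  have hC0 : 0 ≤ C := by positivity
  have key : ∀ s t, 0 ≤ s → s ≤ t → t ≤ T → ‖U t - U s‖ ≤ C * (t - s) := by
    intro s t hs hst htT
    have hts := sub_nonneg.2 hst
    have h2 := hS.mild_restart hF.continuous hU h hts
    have h3 : IsMildOn S F X (T - (t - s)) U :=
      ⟨hU.continuousOn, fun r hr => h.2 r ⟨hr.1, by linarith [hr.2]⟩⟩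
    have h4 := hS.mild_dist_le hF h2 h3 (t := s) ⟨hs, by linarith⟩
    simp only [sub_add_cancel] at h4
    refine h4.trans ?_
    rw [hC, mul_right_comm]
    gcongr
    · exact h1 _ ⟨hts, by linarith⟩
    · linarith
  refine ⟨⟨C, hC0⟩, LipschitzOnWith.of_dist_le_mul fun s hs t ht => ?_⟩
  rw [dist_eq_norm, Real.dist_eq]
  rcases le_total s t with hst | hst
  · rw [norm_sub_rev, abs_sub_comm, abs_of_nonneg (sub_nonneg.2 hst)]
    exact key s t hs.1 hst ht.2
  · rw [abs_of_nonneg (sub_nonneg.2 hst)]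
    exact key t s ht.1 hst hs.2

/-- In the norm `sup e^{-Mt}‖U(t)‖`, the variation of constants operator has norm at most `1/M`. -/
theorem norm_duhamel_le_exp (hS : IsExtendedSemigroup S) {g : ℝ → H} {C M t : ℝ} (hM : 0 < M)
    (hC : 0 ≤ C) (ht : 0 ≤ t) (hg : ∀ s ∈ Icc 0 t, ‖g s‖ ≤ C * Real.exp (M * s)) :
    ‖Real.exp (-(M * t)) • duhamel S g t‖ ≤ C / M := by
  have h1 := hS.norm_duhamel_le_integral g (b := fun s => C * Real.exp (M * s)) (by fun_prop) ht hg
  have hd : ∀ s ∈ uIcc 0 t,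
      HasDerivAt (fun s => C / M * Real.exp (M * s)) (C * Real.exp (M * s)) s := by
    intro s _
    have := (((hasDerivAt_id s).const_mul M).exp).const_mul (C / M)
    refine this.congr_deriv ?_
    simp only [id, mul_one]
    field_simp
  rw [intervalIntegral.integral_eq_sub_of_hasDerivAt hd
    (Continuous.intervalIntegrable (by fun_prop) _ _)] at h1
  rw [norm_smul, Real.norm_of_nonneg (Real.exp_pos _).le]
  calc _ ≤ Real.exp (-(M * t)) * (C / M * Real.exp (M * t)) := by
        gcongr
        refine h1.trans (sub_le_self _ (by positivity))
    _ = C / M * (Real.exp (-(M * t)) * Real.exp (M * t)) := by ring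
    _ = C / M := by rw [← Real.exp_add]; simp

/-- Global existence of mild solutions for a globally Lipschitz nonlinearity: the Picard iteration
contracts the weighted norm `sup e^{-Mt}‖U(t)‖` with `M = 2K + 1`. -/
theorem exists_mild [CompleteSpace H] (hS : IsExtendedSemigroup S) {K : ℝ≥0}
    (hF : LipschitzWith K F) (X : H) : ∃ U : ℝ → H, IsMild S F X U := by
  set M : ℝ := 2 * K + 1 with hM
  have hM0 : 0 < M := by positivity
  -- The functions `e^{-Mt} U(t)`, bounded on `[0,∞)`, are extended by constants to `(-∞,0]`.
  set Θ : (ℝ → H) → ℝ → H := fun V t => Real.exp (-(M * max t 0)) •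
    (S (max t 0) X + duhamel S (fun s => F (Real.exp (M * s) • V s)) (max t 0)) with hΘ
  have hFc := hF.continuous
  have hgc : ∀ V : ℝ → H, Continuous V → Continuous fun s => F (Real.exp (M * s) • V s) :=
    fun V hV => by fun_prop
  have hΘc : ∀ V : ℝ → H, Continuous V → Continuous (Θ V) := by
    intro V hV
    have h1 : Continuous fun t : ℝ => S (max t 0) X :=
      hS.continuous_apply (by fun_prop) continuous_const
    have h2 := (hS.continuous_duhamel (hgc V hV)).comp
      (show Continuous fun t : ℝ => max t 0 by fun_prop)
    have h3 : Continuous fun t : ℝ => Real.exp (-(M * max t 0)) := by fun_prop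
    exact h3.smul (h1.add h2)
  have hsub : ∀ V W : BoundedContinuousFunction ℝ H, ∀ t,
      ‖Θ V t - Θ W t‖ ≤ 1 / 2 * dist V W := by
    intro V W t
    have h0 : 0 ≤ max t 0 := le_max_right _ _
    have e : Θ V t - Θ W t = Real.exp (-(M * max t 0)) • duhamel S (fun s =>
        F (Real.exp (M * s) • V s) - F (Real.exp (M * s) • W s)) (max t 0) := by
      rw [← hS.duhamel_sub (hgc V V.continuous) (hgc W W.continuous), hΘ]
      simp only [← smul_sub, add_sub_add_left_eq_sub]
    rw [e]
    refine (hS.norm_duhamel_le_exp (C := K * dist V W) hM0 (by positivity) h0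
      fun s _ => ?_).trans ?_
    · refine (hF.norm_sub_le _ _).trans ?_
      rw [← smul_sub, norm_smul, Real.norm_of_nonneg (Real.exp_pos _).le, ← dist_eq_norm, mul_assoc,
        mul_comm (dist V W)]
      gcongr
      exact V.dist_coe_le_dist s
    · rw [div_le_iff₀ hM0]
      have : 0 ≤ dist V W := dist_nonneg
      nlinarith
  have hbdd : ∀ V : BoundedContinuousFunction ℝ H, ∃ C, ∀ t, ‖Θ V t‖ ≤ C := by
    intro V
    refine ⟨‖X‖ + (‖F 0‖ + K * ‖V‖) / M, fun t => ?_⟩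
    have h0 : 0 ≤ max t 0 := le_max_right _ _
    simp only [hΘ, smul_add]
    refine (norm_add_le _ _).trans (add_le_add ?_ (hS.norm_duhamel_le_exp hM0 (by positivity) h0
      fun s hs => ?_))
    · rw [norm_smul, Real.norm_of_nonneg (Real.exp_pos _).le]
      have h1 : Real.exp (-(M * max t 0)) ≤ 1 := Real.exp_le_one_iff.2 (by
        have := mul_nonneg hM0.le h0
        linarith)
      exact (mul_le_of_le_one_left (norm_nonneg _) h1).trans (hS.norm_le _ _)
    · have h1 := hF.norm_sub_le (Real.exp (M * s) • V s) 0
      rw [sub_zero, norm_smul, Real.norm_of_nonneg (Real.exp_pos _).le] at h1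
      have h2 := norm_sub_norm_le (F (Real.exp (M * s) • V s)) (F 0)
      have h3 : (1 : ℝ) ≤ Real.exp (M * s) := Real.one_le_exp (mul_nonneg hM0.le hs.1)
      have h4 := V.norm_coe_le_norm s
      have h5 : ‖F 0‖ ≤ ‖F 0‖ * Real.exp (M * s) := le_mul_of_one_le_right (norm_nonneg _) h3
      have h6 : K * (Real.exp (M * s) * ‖V s‖) ≤ K * ‖V‖ * Real.exp (M * s) := by
        rw [mul_assoc, mul_comm ‖V‖]; gcongr
      linarith
  choose C hC using hbdd
  set Ψ : BoundedContinuousFunction ℝ H → BoundedContinuousFunction ℝ H := fun V =>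
    BoundedContinuousFunction.ofNormedAddCommGroup (Θ V) (hΘc V V.continuous) (C V) (hC V) with hΨ
  have hcon : ContractingWith (1 / 2) Ψ := by
    refine ⟨by rw [div_lt_one] <;> norm_num, LipschitzWith.of_dist_le_mul fun V W => ?_⟩
    rw [BoundedContinuousFunction.dist_le (by positivity)]
    intro t
    rw [dist_eq_norm]
    change ‖Θ V t - Θ W t‖ ≤ _
    simpa using hsub V W t
  set V := ContractingWith.fixedPoint Ψ hcon with hV
  have hfix : ∀ t, Θ V t = V t := fun t => by
    conv_rhs => rw [hV, ← hcon.fixedPoint_isFixedPt (f := Ψ)]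
    rfl
  refine ⟨fun t => Real.exp (M * t) • V t, ?_, fun t ht => ?_⟩
  · have := V.continuous
    exact Continuous.continuousOn (by fun_prop)
  · have h1 := hfix t
    simp only [hΘ, max_eq_left ht] at h1
    change Real.exp (M * t) • V t = _
    rw [← h1, smul_smul, ← Real.exp_add, add_neg_cancel, Real.exp_zero, one_smul]
    rfl

end IsExtendedSemigroup

end Mild

/-! ### The Radon–Nikodým property and strong solutions -/

section RadonNikodym

open scoped NNReal

variable {H : Type} [NormedAddCommGroup H] [InnerProductSpace ℝ H]

/-- The balls of radius `1/2` about the vectors of an orthonormal family are disjoint. -/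
theorem countable_of_orthonormal [TopologicalSpace.SeparableSpace H] {ι : Type*} {v : ι → H}
    (hv : Orthonormal ℝ v) : Countable ι := by
  refine Pairwise.countable_of_isOpen_disjoint (s := fun i => Metric.ball (v i) (1 / 2))
    (fun i j hij => ?_) (fun _ => Metric.isOpen_ball)
    (fun i => ⟨v i, Metric.mem_ball_self (by norm_num)⟩)
  refine Metric.ball_disjoint_ball ?_
  have h1 : ‖v i - v j‖ ^ 2 = 2 := by
    rw [norm_sub_sq_real, hv.1 i, hv.1 j, hv.2 hij]; norm_num
  rw [dist_eq_norm]
  nlinarith [norm_nonneg (v i - v j)]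

/-- The Radon–Nikodým property of separable Hilbert spaces: a Lipschitz function of a real variable
is the integral of a bounded function, hence differentiable almost everywhere. The derivatives of
the coordinates in an orthonormal basis are square summable, by Bessel's inequality for the
difference quotients, and their sum is the required function. -/
theorem exists_hasDerivAt_of_lipschitzWith [CompleteSpace H] [TopologicalSpace.SeparableSpace H]
    {C : ℝ≥0} {g : ℝ → H} (hg : LipschitzWith C g) :
    ∃ h : ℝ → H, (∀ a b, IntervalIntegrable h volume a b) ∧
      (∀ a b, ∫ t in a..b, h t = g b - g a) ∧ ∀ᵐ t, HasDerivAt g (h t) t := by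
  obtain ⟨w, b, -⟩ := exists_hilbertBasis ℝ H
  have : Countable w := countable_of_orthonormal b.orthonormal
  have hφ : ∀ i, LipschitzWith C fun t => inner ℝ (b i) (g t) := by
    intro i
    refine LipschitzWith.of_dist_le_mul fun s t => ?_
    rw [Real.dist_eq, ← inner_sub_right]
    refine (abs_real_inner_le_norm _ _).trans ?_
    rw [b.orthonormal.1 i, one_mul, ← dist_eq_norm]
    exact hg.dist_le_mul s t
  set d : w → ℝ → ℝ := fun i => deriv fun t => inner ℝ (b i) (g t) with hd
  have hdiff : ∀ᵐ t, ∀ i, HasDerivAt (fun t => inner ℝ (b i) (g t)) (d i t) t :=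
    ae_all_iff.2 fun i => (hφ i).ae_differentiableAt_real.mono fun t ht => ht.hasDerivAt
  have hbessel : ∀ᵐ t, ∀ s : Finset w, ∑ i ∈ s, ‖d i t‖ ^ 2 ≤ (C : ℝ) ^ 2 := by
    filter_upwards [hdiff] with t ht s
    have h1 : Tendsto (fun k : ℝ => ∑ i ∈ s, ‖inner ℝ (b i) (k⁻¹ • (g (t + k) - g t))‖ ^ 2)
        (𝓝[>] 0) (𝓝 (∑ i ∈ s, ‖d i t‖ ^ 2)) := by
      refine tendsto_finsetSum _ fun i _ => ?_
      refine ((ht i).tendsto_slope_zero_right.norm.pow 2).congr fun k => ?_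
      rw [inner_smul_right, inner_sub_right]; rfl
    refine le_of_tendsto h1 ?_
    filter_upwards [self_mem_nhdsWithin] with k hk
    have hk : (0 : ℝ) < k := hk
    refine (b.orthonormal.sum_inner_products_le _).trans ?_
    gcongr
    rw [norm_smul, Real.norm_of_nonneg (inv_nonneg.2 hk.le), inv_mul_eq_div, div_le_iff₀ hk,
      ← dist_eq_norm]
    simpa [Real.dist_eq, abs_of_pos hk] using hg.dist_le_mul (t + k) t
  have hsum : ∀ᵐ t, ∃ y : H, HasSum (fun i => d i t • b i) y ∧ (∀ i, inner ℝ (b i) y = d i t) ∧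
      ‖y‖ ≤ C := by
    filter_upwards [hbessel] with t ht
    have hm : Memℓp (fun i => d i t) 2 := memℓp_gen' (C := (C : ℝ) ^ 2) (by simpa using ht)
    have h1 := b.hasSum_repr_symm ⟨_, hm⟩
    refine ⟨_, h1, fun i => ?_, ?_⟩
    · rw [← b.repr_apply_apply, LinearIsometryEquiv.apply_symm_apply]
    · refine le_of_tendsto h1.norm (Eventually.of_forall fun s => ?_)
      refine abs_le_of_sq_le_sq' ?_ C.2 |>.2
      refine le_trans (le_of_eq ?_) (ht s)
      rw [← real_inner_self_eq_norm_sq, b.orthonormal.inner_sum]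
      simp [sq]
  set h : ℝ → H := fun t => ∑' i, d i t • b i with hh
  have hh' : ∀ᵐ t, Tendsto (fun s : Finset w => ∑ i ∈ s, d i t • b i) atTop (𝓝 (h t)) ∧
      (∀ i, inner ℝ (b i) (h t) = d i t) ∧ ‖h t‖ ≤ C := by
    filter_upwards [hsum] with t ⟨y, h1, h2, h3⟩
    have : h t = y := h1.tsum_eq
    rw [this]
    exact ⟨h1, h2, h3⟩
  have hmeas : AEStronglyMeasurable h volume := by
    refine aestronglyMeasurable_of_tendsto_ae atTop
      (f := fun (s : Finset w) t => ∑ i ∈ s, d i t • b i) (fun s => ?_) (hh'.mono fun t ht => ht.1)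
    refine Finset.aestronglyMeasurable_fun_sum _ fun i _ => ?_
    exact (measurable_deriv _).aestronglyMeasurable.smul_const _
  have hint : ∀ a c, IntervalIntegrable h volume a c := by
    intro a c
    refine (intervalIntegrable_const (c := (C : ℝ))).mono_fun hmeas.restrict ?_
    refine ae_restrict_of_ae (hh'.mono fun t ht => ?_)
    simpa using ht.2.2
  have hftc : ∀ a c, ∫ t in a..c, h t = g c - g a := by
    intro a c
    refine b.repr.injective (lp.ext (funext fun i => ?_))
    rw [b.repr_apply_apply, b.repr_apply_apply]
    have h1 := ContinuousLinearMap.intervalIntegral_comp_comm (innerSL ℝ (b i)) (hint a c)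
    simp only [innerSL_apply_apply] at h1
    rw [← h1, inner_sub_right,
      ← ((hφ i).lipschitzOnWith (s := uIcc a c)).absolutelyContinuousOnInterval.integral_deriv_eq_sub]
    exact intervalIntegral.integral_congr_ae (hh'.mono fun t ht _ => ht.2.1 i)
  refine ⟨h, hint, hftc, ?_⟩
  have hloc : LocallyIntegrable h volume := fun t =>
    ⟨Ioc (t - 1) (t + 1), Ioc_mem_nhds (by linarith) (by linarith), (hint _ _).1⟩
  filter_upwards [_root_.LocallyIntegrable.ae_hasDerivAt_integral hloc] with t ht
  have h1 := (ht 0).add_const (g 0)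
  refine h1.congr_of_eventuallyEq (Eventually.of_forall fun s => ?_)
  simp only [hftc, sub_add_cancel]

end RadonNikodym

section Strong

open scoped NNReal

variable {H : Type} [NormedAddCommGroup H] [InnerProductSpace ℝ H] [CompleteSpace H]
  {S : ℝ → H →L[ℝ] H} {F : H → H}

/-- A mild solution that is Lipschitz continuous on bounded time intervals is a strong solution: it
is differentiable almost everywhere, and `generator_of_hasDerivAt` applies at such times. -/
theorem IsExtendedSemigroup.isStrong_of_lipschitzOn [TopologicalSpace.SeparableSpace H]
    (hS : IsExtendedSemigroup S) {A : H → H → Prop} (hA : IsGenerator A S) (hF : Continuous F)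
    {X : H} {U : ℝ → H} (h : IsMild S F X U)
    (hL : ∀ T, 0 ≤ T → ∃ C : ℝ≥0, LipschitzOnWith C U (Icc 0 T)) : IsStrong A F X U := by
  have h0 : U 0 = X := hS.mild_zero (h.isMildOn 0) le_rfl
  have key : ∀ T, 0 ≤ T → IntervalIntegrable (deriv U) volume 0 T ∧
      (∫ s in (0 : ℝ)..T, deriv U s = U T - U 0) ∧ ∀ᵐ t, t ∈ Ioo 0 T → DifferentiableAt ℝ U t := by
    intro T hT
    obtain ⟨C, hC⟩ := hL T hT
    set g : ℝ → H := fun t => U (projIcc 0 T hT t) with hg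
    have hgL : LipschitzWith C g := by
      have h1 : LipschitzWith C fun x : Icc (0 : ℝ) T => U x := lipschitzOnWith_iff_restrict.1 hC
      have := h1.comp (LipschitzWith.projIcc hT)
      rwa [mul_one] at this
    have hgU : ∀ t ∈ Icc 0 T, g t = U t := fun t ht => by
      simp only [hg, projIcc_of_mem hT ht]
    obtain ⟨d, hd1, hd2, hd3⟩ := exists_hasDerivAt_of_lipschitzWith hgL
    have hdU : ∀ᵐ t, t ∈ Ioo 0 T → HasDerivAt U (d t) t := by
      filter_upwards [hd3] with t ht htT
      refine ht.congr_of_eventuallyEq ?_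
      filter_upwards [Icc_mem_nhds htT.1 htT.2] with s hs
      exact (hgU s hs).symm
    have hne : ∀ᵐ t : ℝ, t ≠ T := by simp [ae_iff]
    have hae : ∀ᵐ t, t ∈ uIoc 0 T → d t = deriv U t := by
      filter_upwards [hdU, hne] with t ht htT hm
      rw [uIoc_of_le hT] at hm
      exact (ht ⟨hm.1, lt_of_le_of_ne hm.2 htT⟩).deriv.symm
    refine ⟨(hd1 0 T).congr_ae ((ae_restrict_iff' measurableSet_uIoc).2 hae), ?_,
      hdU.mono fun t ht hm => (ht hm).differentiableAt⟩
    rw [← intervalIntegral.integral_congr_ae hae, hd2, hgU T ⟨hT, le_rfl⟩, hgU 0 ⟨le_rfl, hT⟩]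
  refine ⟨h.1, h0, deriv U, fun T hT => (key T hT).1, fun t ht => ?_, ?_⟩
  · rw [(key t ht).2.1, h0]; abel
  · rw [ae_restrict_iff' measurableSet_Ioi]
    have h1 : ∀ᵐ t, ∀ n : ℕ, t ∈ Ioo (0 : ℝ) n → DifferentiableAt ℝ U t :=
      ae_all_iff.2 fun n => (key n n.cast_nonneg).2.2
    filter_upwards [h1] with t ht ht0
    obtain ⟨n, hn⟩ := exists_nat_gt t
    have hd := (ht n ⟨ht0, hn⟩).hasDerivAt
    refine ⟨hd, deriv U t - F (U t), ?_, by abel⟩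
    obtain ⟨V, hVc, hVU, hV⟩ := (h.isMildOn n).exists_continuous (n.cast_nonneg (α := ℝ))
    have ht' : t ∈ Icc (0 : ℝ) n := ⟨(mem_Ioi.1 ht0).le, hn.le⟩
    rw [← hVU ht']
    refine hS.generator_of_hasDerivAt hA hF hVc hV ⟨ht'.1, hn⟩ (hd.congr_of_eventuallyEq ?_)
    filter_upwards [Icc_mem_nhds ht0 hn] with s hs
    exact hVU hs

end Strong

/-! ### Weak derivatives and traces on the unit interval -/

theorem integral_leb (h : ℝ → ℝ) : ∫ x, h x ∂leb = ∫ x in (0 : ℝ)..1, h x := by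
  rw [intervalIntegral.integral_of_le zero_le_one, integral_Ioc_eq_integral_Ioo]

theorem integrable_L2 (g : L2) : Integrable g leb := (Lp.memLp g).integrable one_le_two

theorem intervalIntegrable_L2 (g : L2) : IntervalIntegrable g volume 0 1 :=
  (intervalIntegrable_iff_integrableOn_Ioo_of_le zero_le_one).2 (integrable_L2 g)

theorem intervalIntegrable_L2_of_mem (g : L2) {y : ℝ} (hy : y ∈ Icc (0 : ℝ) 1) :
    IntervalIntegrable g volume 0 y :=
  (intervalIntegrable_L2 g).mono_set (by
    rw [uIcc_of_le hy.1, uIcc_of_le zero_le_one]; exact Icc_subset_Icc le_rfl hy.2)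

theorem integral_abs_L2_le (g : L2) : ∫ y, |g y| ∂leb ≤ ‖g‖ := by
  have e1 : eLpNorm g 1 leb ≤ eLpNorm g 2 leb :=
    eLpNorm_le_eLpNorm_of_exponent_le (by norm_num) (Lp.aestronglyMeasurable g)
  have e2 : ∫ y, |g y| ∂leb = (eLpNorm g 1 leb).toReal := by
    rw [eLpNorm_one_eq_lintegral_enorm,
      ← integral_norm_eq_lintegral_enorm (Lp.aestronglyMeasurable g)]
    rfl
  rw [e2, Lp.norm_def]
  exact ENNReal.toReal_mono (Lp.eLpNorm_ne_top g) e1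

theorem inner_L2 (f g : L2) : inner ℝ f g = ∫ x, f x * g x ∂leb := by
  rw [L2.inner_def]
  refine integral_congr_ae (Eventually.of_forall fun x => ?_)
  simp only [RCLike.inner_apply, conj_trivial]
  ring

/-- The primitive of `g ∈ L²(0,1)` that vanishes at `0`. -/
noncomputable def prim (g : L2) (y : ℝ) : ℝ := ∫ s in (0 : ℝ)..y, g s

theorem prim_zero_right (g : L2) : prim g 0 = 0 := intervalIntegral.integral_same

theorem prim_ac (g : L2) : AbsolutelyContinuousOnInterval (prim g) 0 1 :=
  (intervalIntegrable_L2 g).absolutelyContinuousOnInterval_intervalIntegral (by simp)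

theorem prim_continuousOn (g : L2) : ContinuousOn (prim g) (Icc 0 1) := by
  simpa using (prim_ac g).continuousOn

theorem prim_deriv_ae (g : L2) : ∀ᵐ x, x ∈ uIoc (0 : ℝ) 1 → deriv (prim g) x = g x := by
  filter_upwards [(intervalIntegrable_L2 g).ae_hasDerivAt_integral] with x hx hm
  exact (hx (uIoc_subset_uIcc hm) 0 (by simp)).deriv

theorem prim_abs_le (g : L2) {y : ℝ} (hy : y ∈ Icc (0 : ℝ) 1) : |prim g y| ≤ ‖g‖ := by
  refine (intervalIntegral.abs_integral_le_integral_abs hy.1).trans ?_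
  refine le_trans ?_ (integral_abs_L2_le g)
  rw [integral_leb]
  refine intervalIntegral.integral_mono_interval le_rfl hy.1 hy.2
    (Eventually.of_forall fun _ => abs_nonneg _) (intervalIntegrable_L2 g).abs

theorem prim_congr {g : L2} {h : ℝ → ℝ} (hgh : g =ᵐ[leb] h) {y : ℝ} (hy : y ∈ Icc (0 : ℝ) 1) :
    prim g y = ∫ s in (0 : ℝ)..y, h s := by
  unfold prim
  rw [intervalIntegral.integral_of_le hy.1, intervalIntegral.integral_of_le hy.1,
    integral_Ioc_eq_integral_Ioo, integral_Ioc_eq_integral_Ioo]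
  exact integral_congr_ae (ae_restrict_of_ae_restrict_of_subset (Ioo_subset_Ioo le_rfl hy.2) hgh)

theorem prim_add (f g : L2) {y : ℝ} (hy : y ∈ Icc (0 : ℝ) 1) :
    prim (f + g) y = prim f y + prim g y := by
  rw [prim_congr (Lp.coeFn_add f g) hy]
  exact intervalIntegral.integral_add (intervalIntegrable_L2_of_mem f hy)
    (intervalIntegrable_L2_of_mem g hy)

theorem prim_smul (c : ℝ) (g : L2) {y : ℝ} (hy : y ∈ Icc (0 : ℝ) 1) :
    prim (c • g) y = c * prim g y := by
  rw [prim_congr (Lp.coeFn_smul c g) hy]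
  exact intervalIntegral.integral_const_mul _ _

theorem ae_mem_Icc : ∀ᵐ y ∂leb, y ∈ Icc (0 : ℝ) 1 :=
  (ae_restrict_mem measurableSet_Ioo).mono fun _ h => Ioo_subset_Icc_self h

theorem memLp_of_continuousOn {c : ℝ → ℝ} (hc : ContinuousOn c (Icc 0 1)) : MemLp c 2 leb := by
  obtain ⟨C, hC⟩ := isCompact_Icc.exists_bound_of_continuousOn hc
  refine MemLp.of_bound
    ((hc.mono Ioo_subset_Icc_self).aestronglyMeasurable measurableSet_Ioo) C ?_
  exact ae_mem_Icc.mono hC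

/-- The Volterra operator `(V g)(y) = ∫₀^y g` on `L²(0,1)`. -/
noncomputable def volterra : L2 →L[ℝ] L2 :=
  LinearMap.mkContinuous
    { toFun := fun g => (memLp_of_continuousOn (prim_continuousOn g)).toLp
      map_add' := fun f g => by
        rw [← MemLp.toLp_add]
        refine MemLp.toLp_congr _ _ ?_
        filter_upwards [ae_mem_Icc] with y hy
        exact prim_add f g hy
      map_smul' := fun c g => by
        rw [RingHom.id_apply, ← MemLp.toLp_const_smul]
        refine MemLp.toLp_congr _ _ ?_
        filter_upwards [ae_mem_Icc] with y hy
        exact prim_smul c g hy } 1 fun g => by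
    have h := Lp.norm_le_of_ae_bound (p := 2)
      (f := (memLp_of_continuousOn (prim_continuousOn g)).toLp) (norm_nonneg g) (by
        filter_upwards [MemLp.coeFn_toLp (memLp_of_continuousOn (prim_continuousOn g)),
          ae_mem_Icc] with y h1 h2
        rw [h1]
        exact prim_abs_le g h2)
    simpa [measureUnivNNReal] using h

theorem volterra_ae (g : L2) : ∀ᵐ y ∂leb, volterra g y = prim g y :=
  MemLp.coeFn_toLp (memLp_of_continuousOn (prim_continuousOn g))

/-- The embedding `ℝ → L²(0,1)` of the constant functions. -/
noncomputable def const : ℝ →L[ℝ] L2 := Lp.constL 2 leb ℝ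

theorem const_ae (a : ℝ) : ∀ᵐ y ∂leb, const a y = a := Lp.coeFn_const 2 leb a

/-- The mean value on `(0,1)`. -/
noncomputable def mean : L2 →L[ℝ] ℝ := innerSL ℝ (const 1)

theorem mean_eq (g : L2) : mean g = prim g 1 := by
  change inner ℝ (const 1) g = _
  rw [inner_L2, prim, ← integral_leb]
  refine integral_congr_ae ?_
  filter_upwards [const_ae 1] with y hy
  rw [hy, one_mul]

theorem const_add_volterra_ae (a : ℝ) (g : L2) :
    ∀ᵐ y ∂leb, (const a + volterra g) y = a + prim g y := by
  filter_upwards [Lp.coeFn_add (const a) (volterra g), const_ae a, volterra_ae g] with y h1 h2 h3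
  rw [h1, Pi.add_apply, h2, h3]

/-- The traces of `a + V g`; they are unique because continuous functions that agree almost everywhere
on `[0, 1]` are equal there. -/
theorem hasTraceAt_const_add_volterra (a : ℝ) (g : L2) {y b : ℝ} (hy : y ∈ Icc (0 : ℝ) 1) :
    HasTraceAt (const a + volterra g) y b ↔ b = a + prim g y := by
  have hc : ContinuousOn (fun y => a + prim g y) (Icc 0 1) :=
    continuousOn_const.add (prim_continuousOn g)
  constructor
  · rintro ⟨c, hcc, hae, rfl⟩
    refine Measure.eqOn_Icc_of_ae_eq volume zero_ne_one ?_ hcc hc hy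
    rw [← Measure.restrict_congr_set Ioo_ae_eq_Icc]
    filter_upwards [hae, const_add_volterra_ae a g] with x h1 h2
    rw [← h1, h2]
  · rintro rfl
    exact ⟨_, hc, const_add_volterra_ae a g, rfl⟩

theorem const_add_prim_ac (a : ℝ) (g : L2) :
    AbsolutelyContinuousOnInterval (fun y => a + prim g y) 0 1 := by
  have h1 : AbsolutelyContinuousOnInterval (fun _ : ℝ => a) 0 1 :=
    contDiffOn_const.absolutelyContinuousOnInterval
  exact h1.add (prim_ac g)

theorem const_add_prim_deriv_ae (a : ℝ) (g : L2) :
    ∀ᵐ x, x ∈ uIoc (0 : ℝ) 1 → deriv (fun y => a + prim g y) x = g x := by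
  filter_upwards [prim_deriv_ae g] with x hx hm
  rw [deriv_const_add, hx hm]

/-- Integration by parts: the boundary terms of `⟪z_y, z⟫`, for `z = a + V g`, `z_y = g`. -/
theorem inner_const_add_volterra (a : ℝ) (g : L2) :
    inner ℝ g (const a + volterra g) = ((a + mean g) ^ 2 - a ^ 2) / 2 := by
  have h1 := (const_add_prim_ac a g).integral_deriv_mul_eq_sub (const_add_prim_ac a g)
  have h2 : ∫ x in (0 : ℝ)..1, (deriv (fun y => a + prim g y) x * (a + prim g x)
      + (a + prim g x) * deriv (fun y => a + prim g y) x)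
      = 2 * ∫ x in (0 : ℝ)..1, g x * (a + prim g x) := by
    rw [← intervalIntegral.integral_const_mul]
    refine intervalIntegral.integral_congr_ae ?_
    filter_upwards [const_add_prim_deriv_ae a g] with x hx hm
    rw [hx hm]; ring
  rw [h2, prim_zero_right, ← mean_eq] at h1
  have h3 : inner ℝ g (const a + volterra g) = ∫ x in (0 : ℝ)..1, g x * (a + prim g x) := by
    rw [inner_L2, ← integral_leb]
    refine integral_congr_ae ?_
    filter_upwards [const_add_volterra_ae a g] with x hx
    rw [hx]
  rw [h3]
  linarith

theorem IsTest.apply_eq_zero {χ : ℝ → ℝ} (hχ : IsTest χ) {x : ℝ} (hx : x ∉ Ioo (0 : ℝ) 1) :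
    χ x = 0 := by
  by_contra h
  exact hx (hχ.supp (subset_tsupport χ h))

theorem IsTest.ac {χ : ℝ → ℝ} (hχ : IsTest χ) : AbsolutelyContinuousOnInterval χ 0 1 :=
  (hχ.smooth.of_le (by simp)).contDiffOn.absolutelyContinuousOnInterval

theorem hasWeakDeriv_const_add_volterra (a : ℝ) (g : L2) :
    HasWeakDeriv (const a + volterra g) g := by
  intro χ hχ
  have h1 := (const_add_prim_ac a g).integral_mul_deriv_eq_deriv_mul hχ.ac
  rw [hχ.apply_eq_zero (x := 0) (by simp), hχ.apply_eq_zero (x := 1) (by simp), mul_zero, mul_zero,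
    sub_zero, zero_sub] at h1
  have h2 : ∫ x, (const a + volterra g) x * deriv χ x ∂leb
      = ∫ x in (0 : ℝ)..1, (a + prim g x) * deriv χ x := by
    rw [← integral_leb]
    refine integral_congr_ae ?_
    filter_upwards [const_add_volterra_ae a g] with x hx
    rw [hx]
  rw [h2, h1, integral_leb]
  congr 1
  refine intervalIntegral.integral_congr_ae ?_
  filter_upwards [const_add_prim_deriv_ae a g] with x hx hm
  rw [hx hm]

theorem IsTest.exists_H10 {χ : ℝ → ℝ} (hχ : IsTest χ) :
    ∃ w : H10, w.fn =ᵐ[leb] χ ∧ w.dx =ᵐ[leb] deriv χ := by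
  have h1 : MemLp χ 2 leb := memLp_of_continuousOn hχ.smooth.continuous.continuousOn
  have h2 : MemLp (deriv χ) 2 leb :=
    memLp_of_continuousOn (hχ.smooth.continuous_deriv (by simp)).continuousOn
  have h3 : (h1.toLp, h2.toLp) ∈ testGraph := ⟨χ, hχ, h1.coeFn_toLp, h2.coeFn_toLp⟩
  exact ⟨⟨_, Submodule.le_topologicalClosure _ h3⟩, h1.coeFn_toLp, h2.coeFn_toLp⟩

/-- The definition of the weak derivative extends from test functions to `H¹₀(0,1)`. -/
theorem hasWeakDeriv_iff (u g : L2) :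
    HasWeakDeriv u g ↔ ∀ w : H10, inner ℝ u w.dx = -inner ℝ g w.fn := by
  constructor
  · intro h w
    have hcl : IsClosed {p : L2 × L2 | inner ℝ u p.2 = -inner ℝ g p.1} :=
      isClosed_eq (by fun_prop) (by fun_prop)
    refine closure_minimal (s := (testGraph : Set (L2 × L2))) ?_ hcl w.2
    rintro p ⟨χ, hχ, h1, h2⟩
    have := h χ hχ
    change inner ℝ u p.2 = -inner ℝ g p.1
    rw [inner_L2, inner_L2]
    have e1 : ∫ x, u x * p.2 x ∂leb = ∫ x, u x * deriv χ x ∂leb :=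
      integral_congr_ae (h2.mono fun x hx => by simp only [hx])
    have e2 : ∫ x, g x * p.1 x ∂leb = ∫ x, g x * χ x ∂leb :=
      integral_congr_ae (h1.mono fun x hx => by simp only [hx])
    rw [e1, e2, this]
  · intro h χ hχ
    obtain ⟨w, h1, h2⟩ := hχ.exists_H10
    have := h w
    rw [inner_L2, inner_L2] at this
    have e1 : ∫ x, u x * w.dx x ∂leb = ∫ x, u x * deriv χ x ∂leb :=
      integral_congr_ae (h2.mono fun x hx => by simp only [hx])
    have e2 : ∫ x, g x * w.fn x ∂leb = ∫ x, g x * χ x ∂leb :=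
      integral_congr_ae (h1.mono fun x hx => by simp only [hx])
    rw [← e1, ← e2, this]

theorem HasWeakDeriv.sub {u g u' g' : L2} (h : HasWeakDeriv u g) (h' : HasWeakDeriv u' g') :
    HasWeakDeriv (u - u') (g - g') := by
  rw [hasWeakDeriv_iff] at *
  intro w
  rw [inner_sub_left, inner_sub_left, h, h']; ring

theorem H10.hasWeakDeriv (u : H10) : HasWeakDeriv u.fn u.dx := by
  intro χ hχ
  have hcl : IsClosed {p : L2 × L2 | ∀ w : H10, inner ℝ p.1 w.dx = -inner ℝ p.2 w.fn} := by
    rw [ofPred_forall]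
    exact isClosed_iInter fun w => isClosed_eq (by fun_prop) (by fun_prop)
  refine (hasWeakDeriv_iff _ _).2 ?_ χ hχ
  refine closure_minimal (s := (testGraph : Set (L2 × L2))) ?_ hcl u.2
  rintro p ⟨θ, hθ, h1, h2⟩
  refine (hasWeakDeriv_iff _ _).1 fun χ hχ => ?_
  have h3 := hθ.ac.integral_mul_deriv_eq_deriv_mul hχ.ac
  rw [hχ.apply_eq_zero (x := 0) (by simp), hχ.apply_eq_zero (x := 1) (by simp), mul_zero, mul_zero,
    sub_zero, zero_sub, ← integral_leb, ← integral_leb] at h3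
  have e1 : ∫ x, p.1 x * deriv χ x ∂leb = ∫ x, θ x * deriv χ x ∂leb :=
    integral_congr_ae (h1.mono fun x hx => by simp only [hx])
  have e2 : ∫ x, p.2 x * χ x ∂leb = ∫ x, deriv θ x * χ x ∂leb :=
    integral_congr_ae (h2.mono fun x hx => by simp only [hx])
  rw [e1, e2, h3]

/-- The fundamental lemma of the calculus of variations. -/
theorem eq_zero_of_forall_test {g : L2} (h : ∀ χ, IsTest χ → ∫ x, g x * χ x ∂leb = 0) : g = 0 := by
  have hloc : LocallyIntegrableOn g (Ioo 0 1) volume :=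
    IntegrableOn.locallyIntegrableOn (integrable_L2 g)
  have := isOpen_Ioo.ae_eq_zero_of_integral_contDiff_smul_eq_zero hloc fun χ h1 h2 h3 => by
    rw [← h χ ⟨h1, h2, h3⟩]
    rw [← setIntegral_eq_integral_of_forall_compl_eq_zero (s := Ioo (0 : ℝ) 1)]
    · simp only [smul_eq_mul, mul_comm]
    · intro x hx
      rw [IsTest.apply_eq_zero ⟨h1, h2, h3⟩ hx, zero_smul]
  refine Lp.ext ?_
  filter_upwards [(ae_restrict_iff' measurableSet_Ioo).2 this, Lp.coeFn_zero ℝ 2 leb] with x h1 h2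
  rw [h1, h2]; rfl

theorem eq_zero_of_forall_H10 {g : L2} (h : ∀ w : H10, inner ℝ g w.fn = 0) : g = 0 := by
  refine eq_zero_of_forall_test fun χ hχ => ?_
  obtain ⟨w, h1, h2⟩ := hχ.exists_H10
  rw [← h w, inner_L2]
  exact integral_congr_ae (h1.mono fun x hx => by simp only [hx])

theorem HasWeakDeriv.unique {u g g' : L2} (h : HasWeakDeriv u g) (h' : HasWeakDeriv u g') :
    g = g' := by
  rw [hasWeakDeriv_iff] at h h'
  refine sub_eq_zero.1 (eq_zero_of_forall_H10 fun w => ?_)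
  rw [inner_sub_left]
  linarith [h w, h' w]

theorem H10.ext_fn {u w : H10} (h : u.fn = w.fn) : u = w := by
  refine Subtype.ext (Prod.ext h ?_)
  have h1 := u.hasWeakDeriv
  rw [h] at h1
  exact h1.unique w.hasWeakDeriv

/-- A test function of mean value `0` is the derivative of a test function. -/
theorem IsTest.exists_primitive {θ : ℝ → ℝ} (hθ : IsTest θ) (h0 : ∫ x, θ x ∂leb = 0) :
    ∃ χ, IsTest χ ∧ deriv χ = θ := by
  have hc := hθ.smooth.continuous
  set χ : ℝ → ℝ := fun y => ∫ s in (0 : ℝ)..y, θ s with hχ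
  have hd : ∀ y, HasDerivAt χ (θ y) y := fun y => (hc.integral_hasStrictDerivAt 0 y).hasDerivAt
  have hd' : deriv χ = θ := funext fun y => (hd y).deriv
  obtain ⟨a, b, ha, hb, hab⟩ : ∃ a b : ℝ, 0 < a ∧ b < 1 ∧ tsupport θ ⊆ Icc a b := by
    rcases (tsupport θ).eq_empty_or_nonempty with he | hne
    · exact ⟨1 / 2, 1 / 2, by norm_num, by norm_num, by simp [he]⟩
    · obtain ⟨a, ha, ha'⟩ := hθ.compact.isCompact.exists_isLeast hne
      obtain ⟨b, hb, hb'⟩ := hθ.compact.isCompact.exists_isGreatest hne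
      exact ⟨a, b, (hθ.supp ha).1, (hθ.supp hb).2, fun x hx => ⟨ha' hx, hb' hx⟩⟩
  have hz : ∀ x, x ∉ Icc a b → θ x = 0 := fun x hx => by
    by_contra h
    exact hx (hab (subset_tsupport θ h))
  have hχ0 : ∀ x, x ∉ Icc a b → χ x = 0 := by
    intro x hx
    rcases lt_or_ge x a with h | h
    · refine (intervalIntegral.integral_congr (g := fun _ => (0 : ℝ)) fun s hs => ?_).trans (by simp)
      refine hz s fun hs' => ?_
      rcases le_total 0 x with h1 | h1
      · rw [uIcc_of_le h1] at hs; linarith [hs.2, hs'.1]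
      · rw [uIcc_of_ge h1] at hs; linarith [hs.2, hs'.1]
    · have hbx : b < x := by
        by_contra h1
        exact hx ⟨h, not_lt.1 h1⟩
      rw [integral_leb] at h0
      have h1 := intervalIntegral.integral_add_adjacent_intervals (hc.intervalIntegrable 0 1)
        (hc.intervalIntegrable (μ := volume) 1 x)
      rw [h0, zero_add] at h1
      rw [hχ]
      simp only
      rw [← h1]
      refine (intervalIntegral.integral_congr (g := fun _ => (0 : ℝ)) fun s hs => ?_).trans (by simp)
      refine hz s fun hs' => ?_
      rcases le_total 1 x with h1 | h1
      · rw [uIcc_of_le h1] at hs; linarith [hs.1, hs'.2]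
      · rw [uIcc_of_ge h1] at hs; linarith [hs.1, hs'.2]
  have hts : tsupport χ ⊆ Icc a b := by
    refine closure_minimal (fun x hx => ?_) isClosed_Icc
    by_contra h
    exact hx (hχ0 x h)
  refine ⟨χ, ⟨?_, ?_, hts.trans fun x hx => ⟨ha.trans_le hx.1, hx.2.trans_lt hb⟩⟩, hd'⟩
  · rw [contDiff_infty_iff_deriv, hd']
    exact ⟨fun y => (hd y).differentiableAt, hθ.smooth⟩
  · exact HasCompactSupport.of_support_subset_isCompact isCompact_Icc
      ((subset_tsupport χ).trans hts)

theorem exists_test_integral_eq_one : ∃ χ, IsTest χ ∧ ∫ x, χ x ∂leb = 1 := by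
  let B : ContDiffBump (1 / 2 : ℝ) := ⟨1 / 8, 1 / 4, by norm_num, by norm_num⟩
  have hB : IsTest (B.normed volume) := by
    refine ⟨B.contDiff_normed, B.hasCompactSupport_normed, ?_⟩
    rw [B.tsupport_normed_eq, Real.closedBall_eq_Icc]
    intro x hx
    have h1 : (1 / 2 : ℝ) - 1 / 4 ≤ x := hx.1
    have h2 : x ≤ (1 / 2 : ℝ) + 1 / 4 := hx.2
    constructor <;> linarith
  refine ⟨_, hB, ?_⟩
  exact (setIntegral_eq_integral_of_forall_compl_eq_zero fun x hx => hB.apply_eq_zero hx).trans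
    B.integral_normed

theorem integrable_mul_test (u : L2) {χ : ℝ → ℝ} (hχ : IsTest χ) :
    Integrable (fun x => u x * χ x) leb :=
  (Lp.memLp u).integrable_mul (memLp_of_continuousOn hχ.smooth.continuous.continuousOn)

/-- The lemma of du Bois-Reymond. -/
theorem HasWeakDeriv.eq_const {u : L2} (h : HasWeakDeriv u 0) : ∃ a, u = const a := by
  obtain ⟨χ₀, hχ₀, h1⟩ := exists_test_integral_eq_one
  refine ⟨∫ x, u x * χ₀ x ∂leb, sub_eq_zero.1 (eq_zero_of_forall_test fun χ hχ => ?_)⟩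
  set a := ∫ x, u x * χ₀ x ∂leb with ha
  set m := ∫ x, χ x ∂leb with hm
  have hI : ∀ {χ : ℝ → ℝ}, IsTest χ → Integrable χ leb := fun {χ} hχ =>
    (memLp_of_continuousOn hχ.smooth.continuous.continuousOn).integrable one_le_two
  have hθ : IsTest fun x => χ x - m * χ₀ x := by
    refine ⟨hχ.smooth.sub (contDiff_const.mul hχ₀.smooth),
      hχ.compact.sub hχ₀.compact.mul_left, ?_⟩
    refine (tsupport_sub χ _).trans (union_subset hχ.supp ?_)
    exact (tsupport_mul_subset_right (f := fun _ => m)).trans hχ₀.supp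
  obtain ⟨Θ, hΘ, hd⟩ := hθ.exists_primitive (by
    rw [integral_sub (hI hχ) ((hI hχ₀).const_mul m), integral_const_mul, h1, ← hm]; ring)
  have h2 := h Θ hΘ
  have h3 : ∫ x, (0 : L2) x * Θ x ∂leb = 0 := by
    refine (integral_congr_ae (g := fun _ => (0 : ℝ)) ?_).trans (by simp)
    filter_upwards [Lp.coeFn_zero ℝ 2 leb] with x hx
    rw [hx]; simp
  rw [h3, neg_zero, hd] at h2
  have h4 : ∫ x, u x * (χ x - m * χ₀ x) ∂leb = (∫ x, u x * χ x ∂leb) - m * a := by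
    rw [ha, ← integral_const_mul, ← integral_sub (integrable_mul_test u hχ)
      ((integrable_mul_test u hχ₀).const_mul m)]
    congr 1; ext x; ring
  have h5 : ∫ x, (u - const a) x * χ x ∂leb = (∫ x, u x * χ x ∂leb) - a * m := by
    rw [hm, ← integral_const_mul, ← integral_sub (integrable_mul_test u hχ)
      ((hI hχ).const_mul a)]
    refine integral_congr_ae ?_
    filter_upwards [Lp.coeFn_sub u (const a), const_ae a] with x h6 h7
    rw [h6, Pi.sub_apply, h7]; ring
  rw [h5]
  linarith

/-- The functions of `H¹(0,1)` are the primitives of their weak derivatives. -/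
theorem HasWeakDeriv.exists_eq {u g : L2} (h : HasWeakDeriv u g) :
    ∃ a, u = const a + volterra g := by
  have h1 := h.sub (hasWeakDeriv_const_add_volterra 0 g)
  rw [sub_self, map_zero, zero_add] at h1
  obtain ⟨a, ha⟩ := h1.eq_const
  exact ⟨a, sub_eq_iff_eq_add.1 ha⟩

/-! ### The topology of the energy space -/

instance : CompleteSpace H10 :=
  (Submodule.isClosed_topologicalClosure testGraph).completeSpace_coe

/-- The embedding `H¹₀(0,1) → L²(0,1)`. -/
noncomputable def H10.fnL : H10 →L[ℝ] L2 := (ContinuousLinearMap.fst ℝ L2 L2).comp H10Sub.subtypeL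

/-- The derivative `H¹₀(0,1) → L²(0,1)`. -/
noncomputable def H10.dxL : H10 →L[ℝ] L2 := (ContinuousLinearMap.snd ℝ L2 L2).comp H10Sub.subtypeL

theorem H10.continuous_fn : Continuous H10.fn := H10.fnL.continuous

theorem H10.continuous_dx : Continuous H10.dx := H10.dxL.continuous

/-- The identity map from the product norm to the energy norm. It is continuous because the energy is
a continuous quadratic form; the open mapping theorem gives the continuity of the inverse. -/
noncomputable def energyEquiv (P : Params) : (H10 × L2 × H10 × L2 × L2L2) ≃L[ℝ] Energy P :=
  let f : (H10 × L2 × H10 × L2 × L2L2) →ₗ[ℝ] Energy P :=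
    { toFun := fun x => Energy.mk x.1 x.2.1 x.2.2.1 x.2.2.2.1 x.2.2.2.2
      map_add' := fun _ _ => rfl
      map_smul' := fun _ _ => rfl }
  have hf : Continuous f := by
    refine continuous_of_continuousAt_zero f ?_
    have hn : ∀ x, ‖f x‖ = √(Energy.innerE (f x) (f x)) := fun x => by
      rw [← Energy.norm_sq_eq, Real.sqrt_sq (norm_nonneg _)]
    have hc : Continuous fun x => √(Energy.innerE (f x) (f x)) := by
      have h1 := H10.continuous_fn
      have h2 := H10.continuous_dx
      change Continuous fun x : H10 × L2 × H10 × L2 × L2L2 =>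
        √(P.ρ * inner ℝ x.2.1 x.2.1 + P.J * inner ℝ x.2.2.2.1 x.2.2.2.1
          + P.δ * inner ℝ x.2.2.1.dx x.2.2.1.dx + P.μ * inner ℝ x.1.dx x.1.dx
          + P.b * (inner ℝ x.1.dx x.2.2.1.fn + inner ℝ x.1.dx x.2.2.1.fn)
          + P.ξ * inner ℝ x.2.2.1.fn x.2.2.1.fn + P.η * inner ℝ x.2.2.2.2 x.2.2.2.2)
      fun_prop
    rw [ContinuousAt, map_zero, tendsto_zero_iff_norm_tendsto_zero]
    simp only [hn]
    have h0 := hc.tendsto 0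
    rwa [← hn, map_zero, norm_zero] at h0
  ContinuousLinearEquiv.ofBijective ⟨f, hf⟩
    (LinearMap.ker_eq_bot_of_injective fun _ _ h => h)
    (LinearMap.range_eq_top.2 fun y => ⟨y, rfl⟩)

variable {P : Params}

namespace Energy

/-- The component `u` as a continuous linear map. -/
noncomputable def uL : Energy P →L[ℝ] H10 :=
  (ContinuousLinearMap.fst ℝ _ _).comp (energyEquiv P).symm.toContinuousLinearMap

/-- The component `φ` as a continuous linear map. -/
noncomputable def φL : Energy P →L[ℝ] H10 :=
  (ContinuousLinearMap.fst ℝ _ _).comp ((ContinuousLinearMap.snd ℝ _ _).comp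
    ((ContinuousLinearMap.snd ℝ _ _).comp (energyEquiv P).symm.toContinuousLinearMap))

/-- The component `ψ` as a continuous linear map. -/
noncomputable def ψL : Energy P →L[ℝ] L2 :=
  (ContinuousLinearMap.fst ℝ _ _).comp ((ContinuousLinearMap.snd ℝ _ _).comp
    ((ContinuousLinearMap.snd ℝ _ _).comp ((ContinuousLinearMap.snd ℝ _ _).comp
      (energyEquiv P).symm.toContinuousLinearMap)))

theorem uL_apply (U : Energy P) : uL U = U.u := by
  obtain ⟨x, rfl⟩ := (energyEquiv P).surjective U
  simp only [uL, ContinuousLinearMap.comp_apply, ContinuousLinearEquiv.coe_coe,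
    ContinuousLinearEquiv.symm_apply_apply]
  rfl

theorem φL_apply (U : Energy P) : φL U = U.φ := by
  obtain ⟨x, rfl⟩ := (energyEquiv P).surjective U
  simp only [φL, ContinuousLinearMap.comp_apply, ContinuousLinearEquiv.coe_coe,
    ContinuousLinearEquiv.symm_apply_apply]
  rfl

theorem ψL_apply (U : Energy P) : ψL U = U.ψ := by
  obtain ⟨x, rfl⟩ := (energyEquiv P).surjective U
  simp only [ψL, ContinuousLinearMap.comp_apply, ContinuousLinearEquiv.coe_coe,
    ContinuousLinearEquiv.symm_apply_apply]
  rfl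

instance : TopologicalSpace.SeparableSpace (Energy P) := by
  have : Fact ((2 : ENNReal) ≠ ⊤) := ⟨by norm_num⟩
  have h1 : TopologicalSpace.SeparableSpace L2 := inferInstance
  have h2 : TopologicalSpace.SeparableSpace L2L2 := inferInstance
  have h3 : TopologicalSpace.SeparableSpace H10 := inferInstance
  exact (energyEquiv P).surjective.denseRange.separableSpace (energyEquiv P).continuous

theorem inner_eq (U V : Energy P) : inner ℝ U V = innerE U V := rfl

end Energy

/-! ### The generator in weak form -/

/-- The functions `z(x, y) = f(x)`. -/
noncomputable def constX : L2 →L[ℝ] L2L2 := const.compLpL 2 leb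

/-- The Volterra operator in the variable `y`. -/
noncomputable def volterraX : L2L2 →L[ℝ] L2L2 := volterra.compLpL 2 leb

/-- The mean value in the variable `y`. -/
noncomputable def meanX : L2L2 →L[ℝ] L2 := mean.compLpL 2 leb

theorem constX_ae (f : L2) : ∀ᵐ x ∂leb, constX f x = const (f x) := const.coeFn_compLpL f

theorem volterraX_ae (g : L2L2) : ∀ᵐ x ∂leb, volterraX g x = volterra (g x) :=
  volterra.coeFn_compLpL g

theorem meanX_ae (g : L2L2) : ∀ᵐ x ∂leb, meanX g x = mean (g x) := mean.coeFn_compLpL g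

theorem constX_add_volterraX_ae (f : L2) (g : L2L2) :
    ∀ᵐ x ∂leb, (constX f + volterraX g) x = const (f x) + volterra (g x) := by
  filter_upwards [Lp.coeFn_add (constX f) (volterraX g), constX_ae f, volterraX_ae g]
    with x h1 h2 h3
  rw [h1, Pi.add_apply, h2, h3]

theorem add_meanX_ae (f : L2) (g : L2L2) :
    ∀ᵐ x ∂leb, (f + meanX g) x = f x + mean (g x) := by
  filter_upwards [Lp.coeFn_add f (meanX g), meanX_ae g] with x h1 h2
  rw [h1, Pi.add_apply, h2]

/-- The graph of `𝒜` in weak form, as the set of pairs `(U, W)` with `W = 𝒜 U`: the elliptic equations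
are tested against `H¹₀(0,1)`, and `z` is given by `ψ` and `z_y = -τ W.z` through the Volterra
operator, so that the trace `z(·, 1)` is `ψ` minus `τ` times the mean of `W.z`. -/
noncomputable def graphA (P : Params) : Submodule ℝ (Energy P × Energy P) where
  carrier := {p | p.2.u.fn = p.1.v ∧ p.2.φ.fn = p.1.ψ ∧
    p.1.z = constX p.1.ψ - P.τ • volterraX p.2.z ∧
    (∀ w : H10, P.μ * inner ℝ p.1.u.dx w.dx + P.b * inner ℝ p.1.φ.fn w.dx
      + P.ρ * inner ℝ p.2.v w.fn = 0) ∧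
    ∀ w : H10, P.δ * inner ℝ p.1.φ.dx w.dx + P.b * inner ℝ p.1.u.dx w.fn
      + P.ξ * inner ℝ p.1.φ.fn w.fn + P.μ₁ * inner ℝ p.1.ψ w.fn
      + P.μ₂ * inner ℝ (p.1.ψ - P.τ • meanX p.2.z) w.fn + P.J * inner ℝ p.2.ψ w.fn = 0}
  zero_mem' := by
    have e1 : (0 : Energy P).v = 0 := rfl
    have e2 : (0 : Energy P).ψ = 0 := rfl
    have e3 : (0 : Energy P).z = 0 := rfl
    have e4 : (0 : Energy P).u.dx = 0 := rfl
    have e5 : (0 : Energy P).φ.dx = 0 := rfl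
    have e6 : (0 : Energy P).φ.fn = 0 := rfl
    refine ⟨rfl, rfl, ?_, fun w => ?_, fun w => ?_⟩
    · simp [e2, e3]
    · simp [e1, e4, e6]
    · simp [e2, e3, e4, e5, e6]
  add_mem' := by
    rintro ⟨U, W⟩ ⟨U', W'⟩ ⟨h1, h2, h3, h4, h5⟩ ⟨k1, k2, k3, k4, k5⟩
    have e0 : (W + W').u.fn = W.u.fn + W'.u.fn := rfl
    have e1 : ∀ U V : Energy P, (U + V).v = U.v + V.v := fun _ _ => rfl
    have e2 : ∀ U V : Energy P, (U + V).ψ = U.ψ + V.ψ := fun _ _ => rfl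
    have e3 : ∀ U V : Energy P, (U + V).z = U.z + V.z := fun _ _ => rfl
    have e4 : ∀ U V : Energy P, (U + V).u.dx = U.u.dx + V.u.dx := fun _ _ => rfl
    have e5 : ∀ U V : Energy P, (U + V).φ.dx = U.φ.dx + V.φ.dx := fun _ _ => rfl
    have e6 : ∀ U V : Energy P, (U + V).φ.fn = U.φ.fn + V.φ.fn := fun _ _ => rfl
    simp only at h1 h2 h3 h4 h5 k1 k2 k3 k4 k5
    simp only [mem_ofPred_eq, Prod.mk_add_mk, e0, e1, e2, e3, e4, e5, e6]
    refine ⟨by rw [h1, k1], by rw [h2, k2], ?_, fun w => ?_, fun w => ?_⟩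
    · rw [h3, k3, map_add, map_add, smul_add]; abel
    · simp only [inner_add_left]
      linarith [h4 w, k4 w]
    · have := h5 w
      have := k5 w
      simp only [inner_add_left, inner_sub_left, map_add, smul_add] at *
      linarith
  smul_mem' := by
    rintro c ⟨U, W⟩ ⟨h1, h2, h3, h4, h5⟩
    have e0 : (c • W).u.fn = c • W.u.fn := rfl
    have e1 : ∀ U : Energy P, (c • U).v = c • U.v := fun _ => rfl
    have e2 : ∀ U : Energy P, (c • U).ψ = c • U.ψ := fun _ => rfl
    have e3 : ∀ U : Energy P, (c • U).z = c • U.z := fun _ => rfl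
    have e4 : ∀ U : Energy P, (c • U).u.dx = c • U.u.dx := fun _ => rfl
    have e5 : ∀ U : Energy P, (c • U).φ.dx = c • U.φ.dx := fun _ => rfl
    have e6 : ∀ U : Energy P, (c • U).φ.fn = c • U.φ.fn := fun _ => rfl
    simp only at h1 h2 h3 h4 h5
    simp only [mem_ofPred_eq, Prod.smul_mk, e0, e1, e2, e3, e4, e5, e6]
    refine ⟨by rw [h1], by rw [h2], ?_, fun w => ?_, fun w => ?_⟩
    · rw [h3, map_smul, map_smul, smul_sub, smul_comm c]
    · simp only [real_inner_smul_left]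
      linear_combination c * h4 w
    · have := h5 w
      simp only [inner_sub_left, map_smul, real_inner_smul_left] at *
      linear_combination c * this

theorem mem_graphA {U W : Energy P} : (U, W) ∈ graphA P ↔ W.u.fn = U.v ∧ W.φ.fn = U.ψ ∧
    U.z = constX U.ψ - P.τ • volterraX W.z ∧
    (∀ w : H10, P.μ * inner ℝ U.u.dx w.dx + P.b * inner ℝ U.φ.fn w.dx
      + P.ρ * inner ℝ W.v w.fn = 0) ∧
    ∀ w : H10, P.δ * inner ℝ U.φ.dx w.dx + P.b * inner ℝ U.u.dx w.fn
      + P.ξ * inner ℝ U.φ.fn w.fn + P.μ₁ * inner ℝ U.ψ w.fn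
      + P.μ₂ * inner ℝ (U.ψ - P.τ • meanX W.z) w.fn + P.J * inner ℝ W.ψ w.fn = 0 :=
  Iff.rfl

/-- The functions `z` with a weak derivative in `y` and a trace at `y = 0`. -/
theorem z_eq_of_hasWeakDeriv {z zy : L2L2} {ψ : L2} (h : ∀ᵐ x ∂leb, HasWeakDeriv (z x) (zy x))
    (h0 : ∀ᵐ x ∂leb, HasTraceAt (z x) 0 (ψ x)) : z = constX ψ + volterraX zy := by
  refine Lp.ext ?_
  filter_upwards [h, h0, constX_add_volterraX_ae ψ zy] with x h1 h2 h3
  obtain ⟨a, ha⟩ := h1.exists_eq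
  rw [ha, hasTraceAt_const_add_volterra a _ ⟨le_rfl, zero_le_one⟩, prim_zero_right, add_zero] at h2
  rw [h3, ha, h2]

theorem hasTraceAt_one_iff {z zy : L2L2} {ψ z1 : L2} (h : z = constX ψ + volterraX zy) :
    (∀ᵐ x ∂leb, HasTraceAt (z x) 1 (z1 x)) ↔ z1 = ψ + meanX zy := by
  have key : ∀ᵐ x ∂leb, (HasTraceAt (z x) 1 (z1 x) ↔ z1 x = (ψ + meanX zy) x) := by
    filter_upwards [constX_add_volterraX_ae ψ zy, add_meanX_ae ψ zy] with x h1 h2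
    rw [h, h1, hasTraceAt_const_add_volterra _ _ ⟨zero_le_one, le_rfl⟩, h2, mean_eq]
  constructor
  · intro h1
    refine Lp.ext ?_
    filter_upwards [key, h1] with x h2 h3
    exact h2.1 h3
  · rintro rfl
    filter_upwards [key] with x h2
    exact h2.2 rfl

theorem hasTraceAt_zero {z zy : L2L2} {ψ : L2} (h : z = constX ψ + volterraX zy) :
    ∀ᵐ x ∂leb, HasTraceAt (z x) 0 (ψ x) := by
  filter_upwards [constX_add_volterraX_ae ψ zy] with x h1
  rw [h, h1, hasTraceAt_const_add_volterra _ _ ⟨le_rfl, zero_le_one⟩, prim_zero_right, add_zero]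

theorem hasWeakDeriv_of_eq {z zy : L2L2} {ψ : L2} (h : z = constX ψ + volterraX zy) :
    ∀ᵐ x ∂leb, HasWeakDeriv (z x) (zy x) := by
  filter_upwards [constX_add_volterraX_ae ψ zy] with x h1
  rw [h, h1]
  exact hasWeakDeriv_const_add_volterra _ _

/-- The operator `𝒜` coincides with its weak form. -/
theorem isA_iff {U W : Energy P} : IsA U W ↔ (U, W) ∈ graphA P := by
  have hρ := P.ρ_pos.ne'
  have hJ := P.J_pos.ne'
  have hτ := P.τ_pos.ne'
  have hμ := P.μ_pos.ne'
  have hδ := P.δ_pos.ne'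
  rw [mem_graphA]
  constructor
  · rintro ⟨hD, uxx, φxx, z1, zy, h1, h2, h3, h4, hu, hv, hφ, hψ, hz⟩
    have hzy : zy = -(P.τ • W.z) := by
      rw [hz, smul_smul]
      field_simp
      simp
    have hzeq := z_eq_of_hasWeakDeriv h4 hD.trace
    have hz1 := (hasTraceAt_one_iff hzeq).1 h3
    refine ⟨hu, hφ, ?_, fun w => ?_, fun w => ?_⟩
    · rw [hzeq, hzy, map_neg, map_smul, sub_eq_add_neg]
    · rw [(hasWeakDeriv_iff _ _).1 h1, (hasWeakDeriv_iff _ _).1 U.φ.hasWeakDeriv, hv,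
        inner_add_left, real_inner_smul_left, real_inner_smul_left]
      field_simp
      ring
    · have e : U.ψ - P.τ • meanX W.z = z1 := by
        rw [hz1, hzy, map_neg, map_smul, sub_eq_add_neg]
      rw [e, (hasWeakDeriv_iff _ _).1 h2, hψ]
      simp only [inner_sub_left, real_inner_smul_left]
      field_simp
      ring
  · rintro ⟨hu, hφ, hz, h4, h5⟩
    set zy : L2L2 := -(P.τ • W.z) with hzy
    have hzeq : U.z = constX U.ψ + volterraX zy := by
      rw [hz, hzy, map_neg, map_smul, sub_eq_add_neg]
    have hz1 := (hasTraceAt_one_iff hzeq).2 rfl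
    have hzw := hasWeakDeriv_of_eq hzeq
    set z1 := U.ψ + meanX zy with hz1'
    have e : U.ψ - P.τ • meanX W.z = z1 := by
      rw [hz1', hzy, map_neg, map_smul, sub_eq_add_neg]
    set uxx : L2 := P.μ⁻¹ • (P.ρ • W.v - P.b • U.φ.dx) with huxx
    set φxx : L2 := P.δ⁻¹ • (P.J • W.ψ + P.b • U.u.dx + P.ξ • U.φ.fn + P.μ₁ • U.ψ + P.μ₂ • z1)
      with hφxx
    have h1 : HasWeakDeriv U.u.dx uxx := by
      rw [hasWeakDeriv_iff]
      intro w
      have k1 := h4 w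
      have k2 := (hasWeakDeriv_iff _ _).1 U.φ.hasWeakDeriv w
      rw [k2] at k1
      rw [huxx, real_inner_smul_left, inner_sub_left, real_inner_smul_left, real_inner_smul_left]
      field_simp
      linarith
    have h2 : HasWeakDeriv U.φ.dx φxx := by
      rw [hasWeakDeriv_iff]
      intro w
      have k1 := h5 w
      rw [e] at k1
      rw [hφxx]
      simp only [inner_add_left, real_inner_smul_left]
      field_simp
      linarith
    refine ⟨⟨⟨uxx, h1⟩, ⟨W.u, hu⟩, ⟨φxx, h2⟩, ⟨W.φ, hφ⟩, ⟨zy, hzw⟩, hasTraceAt_zero hzeq⟩,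
      uxx, φxx, z1, zy, h1, h2, hz1, hzw, hu, ?_, hφ, ?_, ?_⟩
    · rw [huxx]
      match_scalars <;> field_simp
      ring
    · rw [hφxx]
      match_scalars <;> field_simp <;> ring
    · rw [hzy]
      match_scalars
      field_simp

theorem InDomain.exists_isA {U : Energy P} (h : InDomain U) : ∃ W, IsA U W := by
  obtain ⟨uxx, h1⟩ := h.u_mem
  obtain ⟨φxx, h2⟩ := h.φ_mem
  obtain ⟨w, hw⟩ := h.v_mem
  obtain ⟨w', hw'⟩ := h.ψ_mem
  obtain ⟨zy, hzy⟩ := h.z_mem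
  have hz1 := (hasTraceAt_one_iff (z_eq_of_hasWeakDeriv hzy h.trace)).2 rfl
  exact ⟨Energy.mk w _ w' _ _, h, uxx, φxx, _, zy, h1, h2, hz1, hzy, hw, rfl, hw', rfl, rfl⟩

/-! ### The transport equation in the delay variable -/

/-- The theorem of Lax and Milgram, for an operator that is coercive with constant `1`. -/
theorem exists_equiv_of_coercive {E : Type} [NormedAddCommGroup E] [InnerProductSpace ℝ E]
    [CompleteSpace E] (M : E →L[ℝ] E) (hM : ∀ x, ‖x‖ * ‖x‖ ≤ inner ℝ (M x) x) :
    ∃ e : E ≃L[ℝ] E, ∀ x, e x = M x := by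
  have hc : IsCoercive ((innerSL ℝ).comp M : E →L[ℝ] E →L[ℝ] ℝ) :=
    ⟨1, one_pos, fun x => by simpa using hM x⟩
  refine ⟨hc.continuousLinearEquivOfBilin, fun x => ?_⟩
  refine ext_inner_right ℝ fun y => ?_
  rw [hc.continuousLinearEquivOfBilin_apply]
  rfl

/-- The solution operator `(ψ, w) ↦ z` of `k z + z_y = w`, `z(0) = ψ`. The trace of the solution at
`y = 1` is `β ψ + r`, where `|β| ≤ 1` and `r` depends only on `w`. -/
theorem exists_transport {k : ℝ} (hk : 0 < k) : ∃ β : ℝ, |β| ≤ 1 ∧ ∀ w : L2L2, ∃ r : L2,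
    ∀ ψ : L2, ∃ z : L2L2, z = constX ψ + volterraX (w - k • z) ∧
      ψ + meanX (w - k • z) = β • ψ + r := by
  -- `1 + k V` is coercive, as `⟪V g, g⟫` is half the square of the mean of `g`.
  obtain ⟨e, he⟩ := exists_equiv_of_coercive (ContinuousLinearMap.id ℝ L2 + k • volterra)
    fun g => by
      have h := inner_const_add_volterra 0 g
      rw [map_zero, zero_add] at h
      simp only [_root_.add_apply, ContinuousLinearMap.id_apply,
        _root_.smul_apply, inner_add_left, real_inner_smul_left,
        real_inner_self_eq_norm_mul_norm]
      rw [real_inner_comm, h]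
      have : 0 ≤ k * (((0 + mean g) ^ 2 - 0 ^ 2) / 2) := by
        have := sq_nonneg (mean g)
        rw [zero_add]
        apply mul_nonneg hk.le
        linarith
      linarith
  have he' : ∀ y, e.symm y = y - k • volterra (e.symm y) := fun y => by
    have h := he (e.symm y)
    rw [ContinuousLinearEquiv.apply_symm_apply] at h
    exact eq_sub_of_add_eq h.symm
  set T : L2 →L[ℝ] L2 := e.symm.toContinuousLinearMap with hT
  have hTv : ∀ y, T y = y - k • volterra (T y) := he'
  set β : ℝ := 1 - k * mean (T (const 1)) with hβ
  refine ⟨β, ?_, fun w => ?_⟩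
  · -- `T 1` solves `k z + z_y = 0`, `z(0) = 1`, and `β = z(1)`: test the equation with `z`.
    have h1 : T (const 1) = const 1 + volterra (-(k • T (const 1))) := by
      conv_lhs => rw [hTv]
      rw [map_neg, map_smul, sub_eq_add_neg]
    have h2 := inner_const_add_volterra 1 (-(k • T (const 1)))
    rw [← h1, inner_neg_left, real_inner_smul_left, real_inner_self_eq_norm_sq, map_neg, map_smul,
      smul_eq_mul, ← sub_eq_add_neg, ← hβ] at h2
    rw [abs_le_one_iff_mul_self_le_one]
    nlinarith [mul_nonneg hk.le (sq_nonneg ‖T (const 1)‖)]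
  · set TX : L2L2 →L[ℝ] L2L2 := T.compLpL 2 leb with hTX
    have hTXae : ∀ g : L2L2, ∀ᵐ x ∂leb, TX g x = T (g x) := fun g => T.coeFn_compLpL g
    have hTXv : ∀ g, TX g = g - k • volterraX (TX g) := by
      intro g
      refine Lp.ext ?_
      filter_upwards [hTXae g, volterraX_ae (TX g), Lp.coeFn_sub g (k • volterraX (TX g)),
        Lp.coeFn_smul k (volterraX (TX g))] with x h1 h2 h3 h4
      rw [h3, Pi.sub_apply, h4, Pi.smul_apply, h2, h1]
      exact hTv _
    have hβψ : ∀ ψ, ψ - k • meanX (TX (constX ψ)) = β • ψ := by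
      intro ψ
      refine Lp.ext ?_
      filter_upwards [hTXae (constX ψ), constX_ae ψ, meanX_ae (TX (constX ψ)),
        Lp.coeFn_sub ψ (k • meanX (TX (constX ψ))), Lp.coeFn_smul k (meanX (TX (constX ψ))),
        Lp.coeFn_smul β ψ] with x h1 h2 h3 h4 h5 h6
      rw [h4, Pi.sub_apply, h5, Pi.smul_apply, h3, h1, h2, h6, Pi.smul_apply]
      have e1 : const (ψ x) = ψ x • const 1 := by
        rw [← map_smul, smul_eq_mul, mul_one]
      rw [e1, map_smul, map_smul, hβ]
      simp only [smul_eq_mul]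
      ring
    refine ⟨meanX (w - k • TX (volterraX w)), fun ψ =>
      ⟨TX (constX ψ + volterraX w), ?_, ?_⟩⟩
    · conv_lhs => rw [hTXv]
      rw [map_sub, map_smul]
      abel
    · rw [← hβψ, map_add, smul_add, map_sub, map_sub, map_add, map_smul, map_smul]
      abel

/-! ### Maximal dissipativity -/

/-- Maximality: the equation `l U - 𝒜 U = W` reduces to an elliptic problem for `(u, φ)`, which is
solved in the energy space itself, as its inner product is the principal part of the form. -/
theorem graphA_surj (hμ : P.μ₂ ≤ P.μ₁) {l : ℝ} (hl : 0 < l) (W : Energy P) :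
    ∃ U V, (U, V) ∈ graphA P ∧ l • U - V = W := by
  have hρ := P.ρ_pos
  have hJ := P.J_pos
  have hτ := P.τ_pos
  have hμ₂ := P.μ₂_pos
  obtain ⟨β, hβ, hz⟩ := exists_transport (mul_pos hl hτ)
  obtain ⟨r, hr⟩ := hz (P.τ • W.z)
  set d : ℝ := P.J * l + P.μ₁ + P.μ₂ * β with hd
  -- The delay term is dominated by the damping, as `|β| ≤ 1` and `μ₂ ≤ μ₁`.
  have hd0 : 0 ≤ d := by
    have h1 := (abs_le.1 hβ).1
    have h2 := mul_pos hJ hl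
    nlinarith
  set p : Energy P →L[ℝ] L2 := H10.fnL.comp Energy.uL with hp
  set q : Energy P →L[ℝ] L2 := H10.fnL.comp Energy.φL with hq
  have hpa : ∀ U, p U = U.u.fn := fun U => by
    rw [hp, ContinuousLinearMap.comp_apply, Energy.uL_apply]; rfl
  have hqa : ∀ U, q U = U.φ.fn := fun U => by
    rw [hq, ContinuousLinearMap.comp_apply, Energy.φL_apply]; rfl
  set F₁ : L2 := P.ρ • (l • W.u.fn + W.v) with hF₁
  set F₂ : L2 := d • W.φ.fn - P.μ₂ • r + P.J • W.ψ with hF₂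
  obtain ⟨e, he⟩ := exists_equiv_of_coercive (ContinuousLinearMap.id ℝ (Energy P)
      + (P.ρ * l ^ 2) • p.adjoint.comp p + (d * l) • q.adjoint.comp q) fun U => by
    simp only [_root_.add_apply, ContinuousLinearMap.id_apply,
      _root_.smul_apply, ContinuousLinearMap.comp_apply, inner_add_left,
      real_inner_smul_left, ContinuousLinearMap.adjoint_inner_left,
      real_inner_self_eq_norm_mul_norm]
    have h1 : 0 ≤ P.ρ * l ^ 2 * (‖p U‖ * ‖p U‖) := by positivity
    have h2 : 0 ≤ d * l * (‖q U‖ * ‖q U‖) := by positivity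
    linarith
  set Y : Energy P := e.symm (p.adjoint F₁ + q.adjoint F₂) with hY
  have hweak : ∀ V : Energy P, Energy.innerE Y V + P.ρ * l ^ 2 * inner ℝ Y.u.fn V.u.fn
      + d * l * inner ℝ Y.φ.fn V.φ.fn = inner ℝ F₁ V.u.fn + inner ℝ F₂ V.φ.fn := by
    intro V
    have h1 := he Y
    rw [hY, ContinuousLinearEquiv.apply_symm_apply, ← hY] at h1
    have h2 := congrArg (fun X => inner ℝ X V) h1
    simp only [_root_.add_apply, ContinuousLinearMap.id_apply,
      _root_.smul_apply, ContinuousLinearMap.comp_apply, inner_add_left,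
      real_inner_smul_left, ContinuousLinearMap.adjoint_inner_left, hpa, hqa] at h2
    exact h2.symm
  set ψ : L2 := l • Y.φ.fn - W.φ.fn with hψ
  obtain ⟨z, hz1, hz2⟩ := hr ψ
  set U : Energy P := Energy.mk Y.u (l • Y.u.fn - W.u.fn) Y.φ ψ z with hU
  have hzτ : P.τ • W.z - (l * P.τ) • z = -(P.τ • (l • z - W.z)) := by
    rw [smul_sub, smul_smul, mul_comm l, neg_sub]
  rw [hzτ, map_neg, map_smul, ← sub_eq_add_neg] at hz1 hz2
  refine ⟨U, l • U - W, mem_graphA.2 ⟨rfl, rfl, hz1, fun w => ?_, fun w => ?_⟩, sub_sub_self _ _⟩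
  · have h := hweak (Energy.mk w 0 0 0 0)
    change P.ρ * inner ℝ Y.v 0 + P.J * inner ℝ Y.ψ 0 + P.δ * inner ℝ Y.φ.dx 0
      + P.μ * inner ℝ Y.u.dx w.dx + P.b * (inner ℝ Y.u.dx 0 + inner ℝ w.dx Y.φ.fn)
      + P.ξ * inner ℝ Y.φ.fn 0 + P.η * inner ℝ Y.z 0 + P.ρ * l ^ 2 * inner ℝ Y.u.fn w.fn
      + d * l * inner ℝ Y.φ.fn 0 = inner ℝ F₁ w.fn + inner ℝ F₂ 0 at h
    change P.μ * inner ℝ Y.u.dx w.dx + P.b * inner ℝ Y.φ.fn w.dx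
      + P.ρ * inner ℝ (l • (l • Y.u.fn - W.u.fn) - W.v) w.fn = 0
    rw [hF₁] at h
    simp only [inner_zero_right, inner_add_left, inner_sub_left, real_inner_smul_left] at h ⊢
    rw [real_inner_comm Y.φ.fn w.dx] at h
    linear_combination h
  · have h := hweak (Energy.mk 0 0 w 0 0)
    change P.ρ * inner ℝ Y.v 0 + P.J * inner ℝ Y.ψ 0 + P.δ * inner ℝ Y.φ.dx w.dx
      + P.μ * inner ℝ Y.u.dx 0 + P.b * (inner ℝ Y.u.dx w.fn + inner ℝ 0 Y.φ.fn)
      + P.ξ * inner ℝ Y.φ.fn w.fn + P.η * inner ℝ Y.z 0 + P.ρ * l ^ 2 * inner ℝ Y.u.fn 0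
      + d * l * inner ℝ Y.φ.fn w.fn = inner ℝ F₁ 0 + inner ℝ F₂ w.fn at h
    change P.δ * inner ℝ Y.φ.dx w.dx + P.b * inner ℝ Y.u.dx w.fn + P.ξ * inner ℝ Y.φ.fn w.fn
      + P.μ₁ * inner ℝ ψ w.fn + P.μ₂ * inner ℝ (ψ - P.τ • meanX (l • z - W.z)) w.fn
      + P.J * inner ℝ (l • ψ - W.ψ) w.fn = 0
    rw [hz2, hψ]
    rw [hF₂] at h
    simp only [inner_zero_right, inner_zero_left, inner_add_left, inner_sub_left,
      real_inner_smul_left] at h ⊢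
    linear_combination h + (l * inner ℝ Y.φ.fn w.fn - inner ℝ W.φ.fn w.fn) * hd.symm

/-- Dissipativity. Up to the terms that cancel, `⟪𝒜 U, U⟫` is
`-μ₁ ‖ψ‖² - μ₂ ⟪z(·,1), ψ⟫ - η (‖z(·,1)‖² - ‖ψ‖²) / (2 τ)`, and the two bounds on `η` make the
coefficients of `‖z(·,1)‖²` and `‖ψ‖²` nonpositive after Young's inequality. -/
theorem graphA_dissipative (hη₁ : P.τ * P.μ₂ ≤ P.η) (hη₂ : P.η ≤ P.τ * (2 * P.μ₁ - P.μ₂))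
    {U W : Energy P} (h : (U, W) ∈ graphA P) : inner ℝ W U ≤ 0 := by
  have hτ := P.τ_pos
  obtain ⟨hu, hφ, hz, h4, h5⟩ := mem_graphA.1 h
  set zy : L2L2 := -(P.τ • W.z) with hzy
  set z1 : L2 := U.ψ + meanX zy with hz1
  have hzeq : U.z = constX U.ψ + volterraX zy := by
    rw [hz, hzy, map_neg, map_smul, sub_eq_add_neg]
  have e1 : U.ψ - P.τ • meanX W.z = z1 := by
    rw [hz1, hzy, map_neg, map_smul, sub_eq_add_neg]
  have hzz : inner ℝ zy U.z = (‖z1‖ ^ 2 - ‖U.ψ‖ ^ 2) / 2 := by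
    rw [← real_inner_self_eq_norm_sq, ← real_inner_self_eq_norm_sq, inner_L2, inner_L2,
      L2.inner_def, ← integral_sub (by exact (Lp.memLp z1).integrable_mul (Lp.memLp z1))
        (by exact (Lp.memLp U.ψ).integrable_mul (Lp.memLp U.ψ)), ← integral_div]
    refine integral_congr_ae ?_
    filter_upwards [constX_add_volterraX_ae U.ψ zy, add_meanX_ae U.ψ zy] with x h1 h2
    rw [hzeq, h1, inner_const_add_volterra, hz1, h2]
    ring
  have h4' := h4 W.u
  have h5' := h5 W.φ
  rw [e1, hu] at *
  rw [hφ] at h5'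
  rw [Energy.inner_eq, Energy.innerE, hu, hφ]
  rw [hzy, inner_neg_left, real_inner_smul_left] at hzz
  rw [real_inner_self_eq_norm_sq] at h5'
  rw [real_inner_comm U.u.dx W.u.dx, real_inner_comm U.φ.dx W.φ.dx, real_inner_comm U.φ.fn W.u.dx,
    real_inner_comm U.φ.fn U.ψ]
  set q : ℝ := inner ℝ W.z U.z with hq
  have hcs : -(‖z1‖ * ‖U.ψ‖) ≤ inner ℝ z1 U.ψ := (abs_le.1 (abs_real_inner_le_norm z1 U.ψ)).1
  have hcs' : -inner ℝ z1 U.ψ ≤ (‖z1‖ ^ 2 + ‖U.ψ‖ ^ 2) / 2 := by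
    nlinarith [sq_nonneg (‖z1‖ - ‖U.ψ‖)]
  have hq' : P.τ * q = -((‖z1‖ ^ 2 - ‖U.ψ‖ ^ 2) / 2) := by linarith
  have key : P.τ * (-P.μ₁ * ‖U.ψ‖ ^ 2 + P.μ₂ * ((‖z1‖ ^ 2 + ‖U.ψ‖ ^ 2) / 2) + P.η * q) ≤ 0 := by
    have k1 := mul_nonneg (sub_nonneg.2 hη₁) (sq_nonneg ‖z1‖)
    have k2 := mul_nonneg (sub_nonneg.2 hη₂) (sq_nonneg ‖U.ψ‖)
    have k3 : P.τ * (P.η * q) = P.η * -((‖z1‖ ^ 2 - ‖U.ψ‖ ^ 2) / 2) := by rw [← hq']; ring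
    rw [mul_add, k3]
    linarith
  have key' := nonpos_of_mul_nonpos_right key hτ
  have := mul_le_mul_of_nonneg_left hcs' P.μ₂_pos.le
  linarith

theorem graphA_single {W : Energy P} (h : ((0 : Energy P), W) ∈ graphA P) : W = 0 := by
  obtain ⟨hu, hφ, hz, h4, h5⟩ := mem_graphA.1 h
  have hρ := P.ρ_pos.ne'
  have hJ := P.J_pos.ne'
  have hτ := P.τ_pos.ne'
  have e1 : (0 : Energy P).v = 0 := rfl
  have e2 : (0 : Energy P).ψ = 0 := rfl
  have e3 : (0 : Energy P).z = 0 := rfl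
  have e4 : (0 : Energy P).u.dx = 0 := rfl
  have e5 : (0 : Energy P).φ.dx = 0 := rfl
  have e6 : (0 : Energy P).φ.fn = 0 := rfl
  have hWz : W.z = 0 := by
    rw [e2, e3, map_zero, zero_sub, eq_comm, neg_eq_zero, smul_eq_zero] at hz
    have hz := hz.resolve_left hτ
    refine Lp.ext ?_
    filter_upwards [volterraX_ae W.z, Lp.coeFn_zero L2 2 leb] with x h1 h2
    rw [hz, h2] at h1
    have h3 := hasWeakDeriv_const_add_volterra 0 (W.z x)
    rw [map_zero, zero_add, ← h1] at h3
    rw [h2]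
    have h4 := hasWeakDeriv_const_add_volterra 0 0
    rw [map_zero, map_zero, zero_add] at h4
    exact h3.unique h4
  have hWv : W.v = 0 := eq_zero_of_forall_H10 fun w => by
    have := h4 w
    rw [e4, e6] at this
    simpa [hρ] using this
  have hWψ : W.ψ = 0 := eq_zero_of_forall_H10 fun w => by
    have := h5 w
    rw [e2, e4, e5, e6, hWz] at this
    simpa [hJ] using this
  exact Prod.ext (H10.ext_fn hu) (Prod.ext hWv (Prod.ext (H10.ext_fn hφ) (Prod.ext hWψ hWz)))

theorem graphA_isMaxDissipative (hμ : P.μ₂ ≤ P.μ₁) (hη₁ : P.τ * P.μ₂ ≤ P.η)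
    (hη₂ : P.η ≤ P.τ * (2 * P.μ₁ - P.μ₂)) : IsMaxDissipative (graphA P) :=
  ⟨fun _ h => graphA_single h, fun _ _ h => graphA_dissipative hη₁ hη₂ h,
    fun _ hl W => graphA_surj hμ hl W⟩

/-! ### Truncation of the forcing term -/

/-- The function `f` on `[-R, R]`, extended to the line by the constants `f (-R)` and `f R`. -/
def trunc (f : ℝ → ℝ) (R x : ℝ) : ℝ := f (max (-R) (min x R))

theorem trunc_of_abs_le (f : ℝ → ℝ) {R x : ℝ} (h : |x| ≤ R) : trunc f R x = f x := by
  obtain ⟨h1, h2⟩ := abs_le.1 h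
  rw [trunc, min_eq_left h2, max_eq_right h1]

theorem abs_clamp_le {R : ℝ} (hR : 0 ≤ R) (x : ℝ) : |max (-R) (min x R)| ≤ R :=
  abs_le.2 ⟨le_max_left _ _, max_le (by linarith) (min_le_right _ _)⟩

theorem abs_clamp_le_abs {R : ℝ} (hR : 0 ≤ R) (x : ℝ) : |max (-R) (min x R)| ≤ |x| := by
  rcases le_total |x| R with h | h
  · obtain ⟨h1, h2⟩ := abs_le.1 h
    rw [min_eq_left h2, max_eq_right h1]
  · exact (abs_clamp_le hR x).trans h

theorem abs_clamp_sub_le (R x y : ℝ) :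
    |max (-R) (min x R) - max (-R) (min y R)| ≤ |x - y| :=
  (abs_max_sub_max_le_max _ _ _ _).trans (max_le (by simp)
    ((abs_min_sub_min_le_max _ _ _ _).trans (max_le le_rfl (by simp))))

theorem Growth.trunc {f : ℝ → ℝ} (hf : Growth f) {R : ℝ} (hR : 0 ≤ R) : Growth (trunc f R) := by
  obtain ⟨k, hk, θ, hθ, h⟩ := hf
  refine ⟨k, hk, θ, hθ, fun x y => (h _ _).trans ?_⟩
  have h1 := abs_clamp_sub_le R x y
  have h2 := Real.rpow_le_rpow (abs_nonneg _) (abs_clamp_le_abs hR x) hθ.le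
  have h3 := Real.rpow_le_rpow (abs_nonneg _) (abs_clamp_le_abs hR y) hθ.le
  gcongr

open scoped NNReal in
theorem Growth.exists_lipschitz_trunc {f : ℝ → ℝ} (hf : Growth f) {R : ℝ} (hR : 0 ≤ R) :
    ∃ K : ℝ≥0, LipschitzWith K (Porous.trunc f R) := by
  obtain ⟨k, hk, θ, hθ, h⟩ := hf
  refine ⟨⟨k * (R ^ θ + R ^ θ), by positivity⟩, LipschitzWith.of_dist_le_mul fun x y => ?_⟩
  rw [Real.dist_eq, Real.dist_eq]
  refine (h _ _).trans ?_
  have h1 := abs_clamp_sub_le R x y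
  have h2 := Real.rpow_le_rpow (abs_nonneg _) (abs_clamp_le hR x) hθ.le
  have h3 := Real.rpow_le_rpow (abs_nonneg _) (abs_clamp_le hR y) hθ.le
  change _ ≤ k * (R ^ θ + R ^ θ) * |x - y|
  gcongr

theorem integral_trunc_eq {f : ℝ → ℝ} {R x : ℝ} (h : |x| ≤ R) :
    ∫ s in (0 : ℝ)..x, trunc f R s = ∫ s in (0 : ℝ)..x, f s := by
  refine intervalIntegral.integral_congr fun s hs => trunc_of_abs_le f ?_
  have := abs_sub_left_of_mem_uIcc hs
  rw [sub_zero, sub_zero] at this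
  exact this.trans h

/-- Truncation keeps the primitive nonnegative, as `f (-R) ≤ 0 ≤ f R`. -/
theorem integral_trunc_nonneg {f : ℝ → ℝ} (hf : Growth f)
    (hf' : ∀ x : ℝ, 0 ≤ (∫ s in (0 : ℝ)..x, f s) ∧ (∫ s in (0 : ℝ)..x, f s) ≤ f x * x)
    {R : ℝ} (hR : 0 < R) (x : ℝ) : 0 ≤ ∫ s in (0 : ℝ)..x, trunc f R s := by
  have hc := (hf.trunc hR.le).continuous
  have hRR : |R| ≤ R := (abs_of_pos hR).le
  have hRR' : |-R| ≤ R := by rw [abs_neg]; exact hRR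
  rcases le_total |x| R with h | h
  · rw [integral_trunc_eq h]
    exact (hf' x).1
  rcases le_total 0 x with h0 | h0
  · rw [abs_of_nonneg h0] at h
    rw [← intervalIntegral.integral_add_adjacent_intervals (b := R)
      (hc.intervalIntegrable _ _) (hc.intervalIntegrable _ _), integral_trunc_eq hRR]
    have h1 : ∫ s in R..x, trunc f R s = ∫ s in R..x, f R := by
      refine intervalIntegral.integral_congr fun s hs => ?_
      rw [uIcc_of_le h] at hs
      simp only [trunc]
      rw [min_eq_right hs.1, max_eq_right (by linarith)]
    rw [h1, intervalIntegral.integral_const, smul_eq_mul]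
    have h2 : 0 ≤ f R := nonneg_of_mul_nonneg_left ((hf' R).1.trans (hf' R).2) hR
    have h3 := mul_nonneg (sub_nonneg.2 h) h2
    linarith [(hf' R).1]
  · rw [abs_of_nonpos h0] at h
    rw [← intervalIntegral.integral_add_adjacent_intervals (b := -R)
      (hc.intervalIntegrable _ _) (hc.intervalIntegrable _ _), integral_trunc_eq hRR']
    have h1 : ∫ s in (-R)..x, trunc f R s = ∫ s in (-R)..x, f (-R) := by
      refine intervalIntegral.integral_congr fun s hs => ?_
      rw [uIcc_of_ge (by linarith)] at hs
      simp only [trunc]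
      rw [min_eq_left (by linarith [hs.2]), max_eq_left hs.2]
    rw [h1, intervalIntegral.integral_const, smul_eq_mul]
    have h2 : f (-R) ≤ 0 := by
      have := (hf' (-R)).1.trans (hf' (-R)).2
      by_contra hc
      nlinarith [not_le.1 hc]
    have h3 := mul_nonneg_of_nonpos_of_nonpos (show x - -R ≤ 0 by linarith) h2
    linarith [(hf' (-R)).1]

/-! ### The Nemytskii operator and its potential -/

variable {g : ℝ → ℝ}

/-- The Nemytskii operator `φ ↦ g ∘ φ` from `H¹₀(0,1)` to `L²(0,1)`. -/
noncomputable def nemytskii (hg : Growth g) (φ : H10) : L2 :=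
  (hg.memLp φ).toLp (fun x => g (φ.fn x))

theorem nemytskii_ae (hg : Growth g) (φ : H10) :
    ∀ᵐ x ∂leb, nemytskii hg φ x = g (φ.fn x) :=
  (hg.memLp φ).coeFn_toLp

theorem opF_eq (hg : Growth g) (U : Energy P) :
    opF hg U = Energy.mk 0 0 0 (-(1 / P.J) • nemytskii hg U.φ) 0 := rfl

/-- Truncation does not affect states with `|φ| ≤ R`, in particular those with `‖φ_x‖ ≤ R`. -/
theorem opF_trunc {f : ℝ → ℝ} (hf : Growth f) {R : ℝ} (hR : 0 ≤ R) {U : Energy P}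
    (hU : ‖U.φ.dx‖ ≤ R) : opF (hf.trunc hR) U = opF hf U := by
  rw [opF_eq, opF_eq]
  congr 2
  refine Lp.ext ?_
  filter_upwards [nemytskii_ae hf U.φ, nemytskii_ae (hf.trunc hR) U.φ, U.φ.ae_bound] with x h1 h2 h3
  rw [h1, h2, trunc_of_abs_le f (h3.trans hU)]

/-- The map `U ↦ φ` from the energy space to `L²(0,1)`. -/
noncomputable def Energy.φfn : Energy P →L[ℝ] L2 := H10.fnL.comp Energy.φL

theorem Energy.φfn_apply (U : Energy P) : Energy.φfn U = U.φ.fn := by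
  rw [Energy.φfn, ContinuousLinearMap.comp_apply, Energy.φL_apply]; rfl

/-- The map `U ↦ φ_x` from the energy space to `L²(0,1)`. -/
noncomputable def Energy.φdx : Energy P →L[ℝ] L2 := H10.dxL.comp Energy.φL

theorem Energy.φdx_apply (U : Energy P) : Energy.φdx U = U.φ.dx := by
  rw [Energy.φdx, ContinuousLinearMap.comp_apply, Energy.φL_apply]; rfl

open scoped NNReal in
theorem exists_lipschitz_opF (hg : Growth g) {K : ℝ≥0} (hK : LipschitzWith K g) :
    ∃ L : ℝ≥0, LipschitzWith L (opF hg : Energy P → Energy P) := by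
  set E := (energyEquiv P).toContinuousLinearMap
  refine ⟨⟨‖E‖ * (|1 / P.J| * (K * ‖(Energy.φfn : Energy P →L[ℝ] L2)‖)), by positivity⟩,
    LipschitzWith.of_dist_le_mul fun U V => ?_⟩
  have h1 : ‖nemytskii hg U.φ - nemytskii hg V.φ‖ ≤ K * ‖U.φ.fn - V.φ.fn‖ := by
    refine Lp.norm_le_mul_norm_of_ae_le_mul ?_
    filter_upwards [nemytskii_ae hg U.φ, nemytskii_ae hg V.φ,
      Lp.coeFn_sub (nemytskii hg U.φ) (nemytskii hg V.φ), Lp.coeFn_sub U.φ.fn V.φ.fn]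
      with x h1 h2 h3 h4
    rw [h3, h4, Pi.sub_apply, Pi.sub_apply, h1, h2]
    exact hK.norm_sub_le _ _
  have h2 : ‖U.φ.fn - V.φ.fn‖ ≤ ‖(Energy.φfn : Energy P →L[ℝ] L2)‖ * ‖U - V‖ := by
    rw [← Energy.φfn_apply, ← Energy.φfn_apply, ← map_sub]
    exact ContinuousLinearMap.le_opNorm _ _
  have h3 : opF hg U - opF hg V
      = E (0, 0, 0, -(1 / P.J) • (nemytskii hg U.φ - nemytskii hg V.φ), 0) := by
    have e : ∀ a c : L2, (Energy.mk 0 0 0 a 0 : Energy P) - Energy.mk 0 0 0 c 0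
        = Energy.mk (0 - 0) (0 - 0) (0 - 0) (a - c) (0 - 0) := fun _ _ => rfl
    rw [opF_eq, opF_eq, smul_sub, e]
    simp only [sub_zero]
    rfl
  have h4 : ‖((0, 0, 0, -(1 / P.J) • (nemytskii hg U.φ - nemytskii hg V.φ), 0) :
      H10 × L2 × H10 × L2 × L2L2)‖ = |1 / P.J| * ‖nemytskii hg U.φ - nemytskii hg V.φ‖ := by
    rw [← Real.norm_eq_abs, ← norm_neg (1 / P.J), ← norm_smul]
    simp [Prod.norm_def]
  rw [dist_eq_norm, dist_eq_norm, h3]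
  refine (E.le_opNorm _).trans ?_
  rw [h4]
  change _ ≤ ‖E‖ * (|1 / P.J| * (K * ‖(Energy.φfn : Energy P →L[ℝ] L2)‖)) * ‖U - V‖
  calc ‖E‖ * (|1 / P.J| * ‖nemytskii hg U.φ - nemytskii hg V.φ‖)
      ≤ ‖E‖ * (|1 / P.J| * (K * (‖(Energy.φfn : Energy P →L[ℝ] L2)‖ * ‖U - V‖))) := by
        gcongr
        exact h1.trans (by gcongr)
    _ = _ := by ring

theorem continuous_opF (hg : Growth g) : Continuous (opF hg : Energy P → Energy P) := by
  rw [continuous_iff_continuousAt]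
  intro U
  set R : ℝ := ‖U.φ.dx‖ + 1
  have hR : 0 ≤ R := by positivity
  obtain ⟨K, hK⟩ := hg.exists_lipschitz_trunc hR
  obtain ⟨L, hL⟩ := exists_lipschitz_opF (P := P) (hg.trunc hR) hK
  refine hL.continuous.continuousAt.congr ?_
  have hc : Continuous fun V : Energy P => ‖Energy.φdx V‖ := by fun_prop
  have h1 : ‖Energy.φdx U‖ < R := by rw [Energy.φdx_apply]; exact lt_add_one _
  filter_upwards [hc.continuousAt.eventually_lt_const h1] with V hV
  rw [Energy.φdx_apply] at hV
  exact opF_trunc hg hR hV.le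

/-- The potential energy `∫₀¹ ĝ(φ) dx`, where `ĝ` is the primitive of `g`. -/
noncomputable def potential (g : ℝ → ℝ) (φ : H10) : ℝ := ∫ x, (∫ s in (0 : ℝ)..φ.fn x, g s) ∂leb

theorem integrable_potential (hg : Growth g) (φ : H10) :
    Integrable (fun x => ∫ s in (0 : ℝ)..φ.fn x, g s) leb := by
  have hc : Continuous fun y => ∫ s in (0 : ℝ)..y, g s :=
    intervalIntegral.continuous_primitive (fun a b => hg.continuous.intervalIntegrable a b) 0
  obtain ⟨C, hC⟩ := (isCompact_Icc (a := -‖φ.dx‖) (b := ‖φ.dx‖)).exists_bound_of_continuousOn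
    hc.continuousOn
  refine Integrable.of_bound
    (hc.comp_aestronglyMeasurable (Lp.aestronglyMeasurable φ.fn)) C ?_
  filter_upwards [φ.ae_bound] with x hx
  exact hC _ (abs_le.1 hx)

theorem potential_nonneg (hg : ∀ x : ℝ, 0 ≤ ∫ s in (0 : ℝ)..x, g s) (φ : H10) :
    0 ≤ potential g φ := integral_nonneg fun _ => hg _

theorem potential_trunc {f : ℝ → ℝ} {R : ℝ} {φ : H10} (hφ : ‖φ.dx‖ ≤ R) :
    potential (trunc f R) φ = potential f φ := by
  refine integral_congr_ae ?_
  filter_upwards [φ.ae_bound] with x hx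
  exact integral_trunc_eq (hx.trans hφ)

open scoped NNReal in
/-- The Nemytskii operator of `g` is the `L²`-gradient of the potential energy. -/
theorem abs_potential_sub_le (hg : Growth g) {K : ℝ≥0} (hK : LipschitzWith K g) (φ χ : H10) :
    |potential g χ - potential g φ - inner ℝ (nemytskii hg φ) (χ.fn - φ.fn)|
      ≤ K * ‖χ.fn - φ.fn‖ ^ 2 := by
  have hI := fun a b => hg.continuous.intervalIntegrable (μ := volume) a b
  have hpt : ∀ a c : ℝ, |(∫ s in (0 : ℝ)..c, g s) - (∫ s in (0 : ℝ)..a, g s) - g a * (c - a)|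
      ≤ K * (c - a) ^ 2 := by
    intro a c
    have h1 : (∫ s in (0 : ℝ)..c, g s) - (∫ s in (0 : ℝ)..a, g s) - g a * (c - a)
        = ∫ s in a..c, (g s - g a) := by
      rw [intervalIntegral.integral_interval_sub_left (hI _ _) (hI _ _),
        intervalIntegral.integral_sub (hI _ _) (by simp), intervalIntegral.integral_const,
        smul_eq_mul, mul_comm]
    rw [h1, ← Real.norm_eq_abs]
    refine (intervalIntegral.norm_integral_le_of_norm_le_const (C := K * |c - a|)
      fun s hs => ?_).trans_eq ?_
    · refine (hK.norm_sub_le _ _).trans ?_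
      rw [Real.norm_eq_abs]
      refine mul_le_mul_of_nonneg_left ?_ K.2
      exact abs_sub_left_of_mem_uIcc (uIoc_subset_uIcc hs)
    · rw [mul_assoc, ← sq, sq_abs]
  have hsub := Lp.coeFn_sub χ.fn φ.fn
  have hin : inner ℝ (nemytskii hg φ) (χ.fn - φ.fn)
      = ∫ x, g (φ.fn x) * (χ.fn x - φ.fn x) ∂leb := by
    rw [inner_L2]
    refine integral_congr_ae ?_
    filter_upwards [hsub, nemytskii_ae hg φ] with x h1 h2
    rw [h1, h2, Pi.sub_apply]
  have hsq : ‖χ.fn - φ.fn‖ ^ 2 = ∫ x, (χ.fn x - φ.fn x) ^ 2 ∂leb := by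
    rw [← real_inner_self_eq_norm_sq, inner_L2]
    refine integral_congr_ae ?_
    filter_upwards [hsub] with x h1
    rw [h1, Pi.sub_apply, sq]
  have hm : MemLp (fun x => χ.fn x - φ.fn x) 2 leb := (Lp.memLp χ.fn).sub (Lp.memLp φ.fn)
  have hi : Integrable (fun x => g (φ.fn x) * (χ.fn x - φ.fn x)) leb :=
    (hg.memLp φ).integrable_mul hm
  have hpot : potential g χ - potential g φ
      = ∫ x, ((∫ s in (0 : ℝ)..χ.fn x, g s) - ∫ s in (0 : ℝ)..φ.fn x, g s) ∂leb :=
    (integral_sub (integrable_potential hg χ) (integrable_potential hg φ)).symm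
  have hi' : Integrable (fun x => (∫ s in (0 : ℝ)..χ.fn x, g s) - ∫ s in (0 : ℝ)..φ.fn x, g s) leb :=
    (integrable_potential hg χ).sub (integrable_potential hg φ)
  rw [hin, hsq, hpot, ← integral_sub hi' hi, ← integral_const_mul, ← Real.norm_eq_abs]
  exact norm_integral_le_of_norm_le (hm.integrable_sq.const_mul _)
    (Eventually.of_forall fun x => hpt _ _)

/-! ### The energy inequality -/

open scoped NNReal

variable {S : ℝ → Energy P →L[ℝ] Energy P}

/-- The total energy of a state: kinetic, elastic and delay energy, and the potential of the forcing
term `g`. -/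
noncomputable def totalEnergy (g : ℝ → ℝ) (U : Energy P) : ℝ := ‖U‖ ^ 2 / 2 + potential g U.φ

theorem continuous_totalEnergy (hg : Growth g) {K : ℝ≥0} (hK : LipschitzWith K g) :
    Continuous (totalEnergy g : Energy P → ℝ) := by
  have h1 : Continuous fun U : Energy P => ‖U‖ ^ 2 / 2 := by fun_prop
  refine h1.add (continuous_iff_continuousAt.2 fun V => ?_)
  have h2 : Tendsto (fun U : Energy P => potential g U.φ - potential g V.φ
      - inner ℝ (nemytskii hg V.φ) (Energy.φfn U - Energy.φfn V)) (𝓝 V) (𝓝 0) := by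
    refine squeeze_zero_norm (a := fun U => K * ‖Energy.φfn U - Energy.φfn V‖ ^ 2) (fun U => ?_) ?_
    · rw [Energy.φfn_apply, Energy.φfn_apply]
      exact abs_potential_sub_le hg hK V.φ U.φ
    · have : Continuous fun U : Energy P => (K : ℝ) * ‖Energy.φfn U - Energy.φfn V‖ ^ 2 := by
        fun_prop
      simpa using this.tendsto V
  have h3 : Continuous fun U : Energy P => potential g V.φ
      + inner ℝ (nemytskii hg V.φ) (Energy.φfn U - Energy.φfn V) := by fun_prop
  have h4 := h2.add (h3.tendsto V)
  simp only [sub_self, inner_zero_right, add_zero, zero_add] at h4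
  refine h4.congr fun U => ?_
  ring

/-- Along the semigroup, `φ` is differentiable in `L²(0,1)`, with derivative `ψ`. -/
theorem tendsto_φfn_semigroup (hS : IsExtendedSemigroup S) (hA : IsGenerator IsA S) (X : Energy P) :
    Tendsto (fun h : ℝ => h⁻¹ • (Energy.φfn (S h X) - Energy.φfn X)) (𝓝[>] 0) (𝓝 X.ψ) := by
  have hd : HasDerivAt (fun t => ∫ s in (0 : ℝ)..t, S s X) (S 0 X) 0 :=
    ((hS.continuous_orbit X).integral_hasStrictDerivAt 0 0).hasDerivAt
  rw [hS.of_nonpos 0 le_rfl] at hd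
  have h1 := ((Energy.ψL.continuous.tendsto _).comp hd.tendsto_slope_zero_right)
  rw [Energy.ψL_apply] at h1
  refine h1.congr' ?_
  filter_upwards [self_mem_nhdsWithin] with h hh
  have h2 := (mem_graphA.1 (isA_iff.1 (hS.generator_integral hA X (le_of_lt hh)))).2.1
  rw [← Energy.φfn_apply, ← Energy.ψL_apply] at h2
  simp only [Function.comp, map_smul, zero_add, intervalIntegral.integral_same, sub_zero, ← h2,
    map_sub]

/-- The upper right derivative of the energy of a mild solution is not positive at the initial time.
The solution is `S k X + q k` with `q k` of order `k`; `S` contracts, and the work of the forcing term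
on `ψ` is balanced by the change of the potential. -/
theorem eventually_totalEnergy_lt (hS : IsExtendedSemigroup S) (hA : IsGenerator IsA S)
    (hg : Growth g) {K : ℝ≥0} (hK : LipschitzWith K g) {X : Energy P} {T : ℝ} (hT : 0 < T)
    {U : ℝ → Energy P} (hU : Continuous U) (h : IsMildOn S (opF hg) X T U) {r : ℝ} (hr : 0 < r) :
    ∀ᶠ k in 𝓝[>] (0 : ℝ), k⁻¹ * (totalEnergy g (U k) - totalEnergy g X) < r := by
  have hF : Continuous (opF hg : Energy P → Energy P) := continuous_opF hg
  set q : ℝ → Energy P := duhamel S fun s => opF hg (U s) with hq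
  have h0 : U 0 = X := hS.mild_zero h hT.le
  have hq1 : Tendsto (fun k : ℝ => k⁻¹ • q k) (𝓝[>] 0) (𝓝 (opF hg X)) := by
    rw [← h0]; exact hS.tendsto_duhamel (hF.comp hU)
  have hk0 : Tendsto (fun k : ℝ => k) (𝓝[>] 0) (𝓝 0) := tendsto_id'.2 nhdsWithin_le_nhds
  have hq0 : Tendsto q (𝓝[>] 0) (𝓝 0) := by
    have := (hk0.smul hq1)
    rw [zero_smul] at this
    refine this.congr' ?_
    filter_upwards [self_mem_nhdsWithin] with k hk
    rw [smul_inv_smul₀ (ne_of_gt hk)]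
  have hUk : ∀ᶠ k in 𝓝[>] (0 : ℝ), U k = S k X + q k := by
    filter_upwards [Ioo_mem_nhdsGT hT] with k hk
    exact h.2 k ⟨hk.1.le, hk.2.le⟩
  -- The kinetic and elastic part.
  have hkin : Tendsto (fun k : ℝ => inner ℝ (S k X) (k⁻¹ • q k) + inner ℝ (k⁻¹ • q k) (q k) / 2)
      (𝓝[>] 0) (𝓝 (inner ℝ X (opF hg X))) := by
    have h1 := ((hS.tendsto X).inner (𝕜 := ℝ) hq1).add
      ((hq1.inner (𝕜 := ℝ) hq0).div_const 2)
    simpa using h1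
  -- The potential part: `φ` moves with velocity `ψ`.
  have hφ : Tendsto (fun k : ℝ => k⁻¹ • (Energy.φfn (U k) - Energy.φfn X)) (𝓝[>] 0) (𝓝 X.ψ) := by
    have h1 := (tendsto_φfn_semigroup hS hA X).add ((Energy.φfn.continuous.tendsto _).comp hq1)
    have h2 : Energy.φfn (opF hg X) = 0 := Energy.φfn_apply _
    rw [h2, add_zero] at h1
    refine h1.congr' ?_
    filter_upwards [hUk] with k hk
    rw [hk, Function.comp, map_smul, map_add, ← smul_add]
    congr 1
    abel
  have hφ0 : Tendsto (fun k : ℝ => Energy.φfn (U k) - Energy.φfn X) (𝓝[>] 0) (𝓝 0) := by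
    have h1 : Continuous fun k => Energy.φfn (U k) - Energy.φfn X := by fun_prop
    have h2 := h1.tendsto 0
    rw [h0, sub_self] at h2
    exact h2.mono_left nhdsWithin_le_nhds
  have hpot : Tendsto (fun k : ℝ => inner ℝ (nemytskii hg X.φ)
      (k⁻¹ • (Energy.φfn (U k) - Energy.φfn X)) + K * (‖k⁻¹ • (Energy.φfn (U k) - Energy.φfn X)‖
        * ‖Energy.φfn (U k) - Energy.φfn X‖)) (𝓝[>] 0) (𝓝 (inner ℝ (nemytskii hg X.φ) X.ψ)) := by
    have h1 := (tendsto_const_nhds (x := nemytskii hg X.φ)).inner (𝕜 := ℝ) hφ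
    have h2 := h1.add ((hφ.norm.mul hφ0.norm).const_mul (K : ℝ))
    simpa using h2
  have hcancel : inner ℝ X (opF hg X) + inner ℝ (nemytskii hg X.φ) X.ψ = 0 := by
    have hJ := P.J_pos.ne'
    have e : inner ℝ X (opF hg X) = P.ρ * inner ℝ X.v (0 : L2)
        + P.J * inner ℝ X.ψ (-(1 / P.J) • nemytskii hg X.φ) + P.δ * inner ℝ X.φ.dx (0 : L2)
        + P.μ * inner ℝ X.u.dx (0 : L2)
        + P.b * (inner ℝ X.u.dx (0 : L2) + inner ℝ (0 : L2) X.φ.fn)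
        + P.ξ * inner ℝ X.φ.fn (0 : L2) + P.η * inner ℝ X.z (0 : L2L2) := rfl
    rw [e]
    simp only [inner_zero_right, inner_zero_left, real_inner_smul_right,
      real_inner_comm (nemytskii hg X.φ) X.ψ]
    field_simp
    ring
  have hsum := hkin.add hpot
  rw [hcancel] at hsum
  filter_upwards [hsum.eventually_lt_const hr, hUk, self_mem_nhdsWithin] with k hk hUk hk0
  have hk0 : (0 : ℝ) < k := hk0
  refine lt_of_le_of_lt ?_ hk
  have hki : 0 < k⁻¹ := inv_pos.2 hk0
  have h1 : ‖U k‖ ^ 2 ≤ ‖X‖ ^ 2 + 2 * inner ℝ (S k X) (q k) + inner ℝ (q k) (q k) := by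
    rw [hUk, norm_add_sq_real, real_inner_self_eq_norm_sq]
    gcongr
    exact hS.norm_le k X
  have h2 := (abs_le.1 (abs_potential_sub_le hg hK X.φ (U k).φ)).2
  rw [← Energy.φfn_apply, ← Energy.φfn_apply] at h2
  have h3 : k⁻¹ * ((‖U k‖ ^ 2 - ‖X‖ ^ 2) / 2)
      ≤ inner ℝ (S k X) (k⁻¹ • q k) + inner ℝ (k⁻¹ • q k) (q k) / 2 := by
    rw [real_inner_smul_left, real_inner_smul_right]
    have := mul_le_mul_of_nonneg_left h1 hki.le
    linarith
  have h4 : k⁻¹ * (potential g (U k).φ - potential g X.φ) ≤ inner ℝ (nemytskii hg X.φ)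
      (k⁻¹ • (Energy.φfn (U k) - Energy.φfn X)) + K * (‖k⁻¹ • (Energy.φfn (U k) - Energy.φfn X)‖
        * ‖Energy.φfn (U k) - Energy.φfn X‖) := by
    rw [real_inner_smul_right, norm_smul, Real.norm_of_nonneg hki.le]
    have := mul_le_mul_of_nonneg_left h2 hki.le
    linarith
  simp only [totalEnergy]
  linarith

/-- The energy does not increase along mild solutions with a Lipschitz forcing term. -/
theorem totalEnergy_le (hS : IsExtendedSemigroup S) (hA : IsGenerator IsA S)
    (hg : Growth g) {K : ℝ≥0} (hK : LipschitzWith K g) {X : Energy P} {T : ℝ} {U : ℝ → Energy P}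
    (h : IsMildOn S (opF hg) X T U) {t : ℝ} (ht : t ∈ Icc 0 T) :
    totalEnergy g (U t) ≤ totalEnergy g X := by
  have hT : 0 ≤ T := ht.1.trans ht.2
  obtain ⟨V, hVc, hVU, hV⟩ := h.exists_continuous hT
  rw [← hVU ht]
  have hc : Continuous fun t => totalEnergy g (V t) := (continuous_totalEnergy hg hK).comp hVc
  refine image_le_of_liminf_slope_right_le_deriv_boundary (f := fun t => totalEnergy g (V t))
    (B := fun _ => totalEnergy g X) (B' := fun _ => 0) hc.continuousOn ?_ continuousOn_const
    (fun x _ => hasDerivWithinAt_const _ _ _) (fun a ha r hr => Eventually.frequently ?_) ht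
  · rw [hS.mild_zero hV hT]
  · have h1 := hS.mild_restart (continuous_opF hg) hVc hV ha.1
    have h2 := eventually_totalEnergy_lt hS hA hg hK (sub_pos.2 ha.2) (by fun_prop) h1 hr
    have h3 : Tendsto (fun z => z - a) (𝓝[>] a) (𝓝[>] 0) := by
      refine tendsto_nhdsWithin_iff.2 ⟨?_, ?_⟩
      · have : Continuous fun z : ℝ => z - a := by fun_prop
        simpa using (this.tendsto a).mono_left nhdsWithin_le_nhds
      · filter_upwards [self_mem_nhdsWithin] with z hz
        exact sub_pos.2 (mem_Ioi.1 hz)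
    filter_upwards [h3.eventually h2] with z hz
    rw [add_sub_cancel] at hz
    rwa [slope_def_module, smul_eq_mul]

/-! ### Mild solutions of the original problem -/

/-- An a priori bound for `‖φ_x(t)‖` along the solution with initial value `X`. -/
noncomputable def radius (f : ℝ → ℝ) (X : Energy P) : ℝ :=
  ‖(Energy.φdx : Energy P →L[ℝ] L2)‖ * √(2 * totalEnergy f X)

variable {f : ℝ → ℝ}

theorem radius_nonneg (X : Energy P) : 0 ≤ radius f X := by unfold radius; positivity

theorem norm_φ_dx_le_radius (hf' : ∀ x : ℝ, 0 ≤ ∫ s in (0 : ℝ)..x, f s) (U : Energy P) :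
    ‖U.φ.dx‖ ≤ radius f U := by
  rw [← Energy.φdx_apply, radius]
  refine (ContinuousLinearMap.le_opNorm _ _).trans ?_
  gcongr
  refine Real.le_sqrt_of_sq_le ?_
  have := potential_nonneg hf' U.φ
  rw [totalEnergy]
  linarith

theorem IsMildOn.of_trunc {hf : Growth f} {R : ℝ} {hR : 0 ≤ R} {X : Energy P} {T : ℝ}
    {U : ℝ → Energy P} (h : IsMildOn S (opF (hf.trunc hR)) X T U)
    (hb : ∀ t ∈ Icc 0 T, ‖(U t).φ.dx‖ ≤ R) : IsMildOn S (opF hf) X T U :=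
  h.congr_nonlinearity fun t ht => opF_trunc hf hR (hb t ht)

theorem IsMildOn.trunc {hf : Growth f} {R : ℝ} (hR : 0 ≤ R) {X : Energy P} {T : ℝ}
    {U : ℝ → Energy P} (h : IsMildOn S (opF hf) X T U)
    (hb : ∀ t ∈ Icc 0 T, ‖(U t).φ.dx‖ ≤ R) : IsMildOn S (opF (hf.trunc hR)) X T U :=
  h.congr_nonlinearity fun t ht => (opF_trunc hf hR (hb t ht)).symm

section APriori

variable (hS : IsExtendedSemigroup S) (hA : IsGenerator IsA S) (hf : Growth f)
  (hf' : ∀ x : ℝ, 0 ≤ (∫ s in (0 : ℝ)..x, f s) ∧ (∫ s in (0 : ℝ)..x, f s) ≤ f x * x)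

include hS hA hf hf'

/-- The a priori bound for the truncated problem does not depend on the level `R ≥ radius f X`, since
the truncation does not change the initial energy. -/
theorem norm_φ_dx_le_of_trunc {R : ℝ} (hR : 0 < R) {X : Energy P} (hX : radius f X ≤ R) {T : ℝ}
    {U : ℝ → Energy P} (h : IsMildOn S (opF (hf.trunc hR.le)) X T U) {t : ℝ} (ht : t ∈ Icc 0 T) :
    ‖(U t).φ.dx‖ ≤ radius f X := by
  obtain ⟨K, hK⟩ := hf.exists_lipschitz_trunc hR.le
  have h1 := totalEnergy_le hS hA (hf.trunc hR.le) hK h ht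
  have h2 : totalEnergy (Porous.trunc f R) X = totalEnergy f X := by
    rw [totalEnergy, totalEnergy,
      potential_trunc ((norm_φ_dx_le_radius (fun x => (hf' x).1) X).trans hX)]
  rw [h2] at h1
  refine (norm_φ_dx_le_radius (f := Porous.trunc f R) (integral_trunc_nonneg hf hf' hR) _).trans ?_
  unfold radius
  gcongr

/-- The a priori bound for the original problem: on the compact interval `[0, T]` a mild solution is
bounded, so it solves the truncated problem for some `R`. -/
theorem norm_φ_dx_le {X : Energy P} {T : ℝ} {U : ℝ → Energy P} (h : IsMildOn S (opF hf) X T U)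
    {t : ℝ} (ht : t ∈ Icc 0 T) : ‖(U t).φ.dx‖ ≤ radius f X := by
  have hc : ContinuousOn (fun t => Energy.φdx (U t)) (Icc 0 T) :=
    Energy.φdx.continuous.comp_continuousOn h.1
  obtain ⟨C, hC⟩ := isCompact_Icc.exists_bound_of_continuousOn hc
  have hR : 0 < max C (radius f X) + 1 := by
    have := radius_nonneg (f := f) X
    have := le_max_right C (radius f X)
    linarith
  have h1 : IsMildOn S (opF (hf.trunc hR.le)) X T U := h.trunc hR.le fun s hs => by
    rw [← Energy.φdx_apply]
    linarith [hC s hs, le_max_left C (radius f X)]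
  exact norm_φ_dx_le_of_trunc hS hA hf hf' hR (by linarith [le_max_right C (radius f X)]) h1 ht

/-- The global mild solution of the problem truncated at a level above the a priori bound never
meets the truncation. -/
theorem exists_isMild (X : Energy P) : ∃ U, IsMild S (opF hf) X U := by
  have hR : 0 < radius f X + 1 := by linarith [radius_nonneg (f := f) X]
  obtain ⟨K, hK⟩ := hf.exists_lipschitz_trunc hR.le
  obtain ⟨L, hL⟩ := exists_lipschitz_opF (P := P) (hf.trunc hR.le) hK
  obtain ⟨U, hU⟩ := hS.exists_mild hL X
  refine ⟨U, isMild_of_isMildOn fun T _ =>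
    IsMildOn.of_trunc (hR := hR.le) (hU.isMildOn T) fun t ht => ?_⟩
  have := norm_φ_dx_le_of_trunc hS hA hf hf' hR (by linarith) (hU.isMildOn T) ht
  linarith

/-- Two mild solutions solve the problem truncated at the larger of their a priori bounds, which has a
Lipschitz constant that depends only on the initial values. -/
theorem exists_continuous_dependence : ∃ C : Energy P → Energy P → ℝ, (∀ X Y, 0 < C X Y) ∧
    ∀ (X Y : Energy P) (T : ℝ) (U V : ℝ → Energy P), IsMildOn S (opF hf) X T U →
      IsMildOn S (opF hf) Y T V → ∀ t ∈ Icc 0 T,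
        ‖U t - V t‖ ≤ Real.exp (C X Y * T) * ‖X - Y‖ := by
  have hR : ∀ X Y : Energy P, 0 ≤ max (radius f X) (radius f Y) := fun X Y =>
    (radius_nonneg X).trans (le_max_left _ _)
  choose K hK using fun X Y : Energy P => hf.exists_lipschitz_trunc (hR X Y)
  choose L hL using fun X Y : Energy P => exists_lipschitz_opF (P := P) (hf.trunc (hR X Y)) (hK X Y)
  -- The summand `1` only makes the constant positive.
  refine ⟨fun X Y => L X Y + 1, fun X Y => by positivity, fun X Y T U V hU hV t ht => ?_⟩
  have hU' := hU.trunc (hR X Y) fun s hs =>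
    (norm_φ_dx_le hS hA hf hf' hU hs).trans (le_max_left _ _)
  have hV' := hV.trunc (hR X Y) fun s hs =>
    (norm_φ_dx_le hS hA hf hf' hV hs).trans (le_max_right _ _)
  refine (hS.mild_dist_le (hL X Y) hU' hV' ht).trans ?_
  rw [mul_comm]
  gcongr
  · exact ht.1
  · exact (lt_add_one _).le
  · exact ht.2

theorem isStrong_of_isMild {X Y : Energy P} (hXY : IsA X Y) {U : ℝ → Energy P}
    (h : IsMild S (opF hf) X U) : IsStrong IsA (opF hf) X U := by
  obtain ⟨K, hK⟩ := hf.exists_lipschitz_trunc (radius_nonneg (f := f) X)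
  obtain ⟨L, hL⟩ := exists_lipschitz_opF (P := P) (hf.trunc (radius_nonneg (f := f) X)) hK
  refine hS.isStrong_of_lipschitzOn hA (continuous_opF hf) h fun T hT => ?_
  have h1 := (h.isMildOn T).trunc (radius_nonneg (f := f) X) fun s hs =>
    norm_φ_dx_le hS hA hf hf' (h.isMildOn T) hs
  obtain ⟨V, hVc, hVU, hV⟩ := h1.exists_continuous hT
  obtain ⟨C, hC⟩ := hS.mild_lipschitzOn hA hL hXY hT hVc hV
  exact ⟨C, fun s hs t ht => by rw [← hVU hs, ← hVU ht]; exact hC hs ht⟩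

end APriori

end Porous

theorem theorem1 (P : Porous.Params)
    (hμ : P.μ₂ ≤ P.μ₁)
    (hη₁ : P.τ * P.μ₂ ≤ P.η) (hη₂ : P.η ≤ P.τ * (2 * P.μ₁ - P.μ₂))
    (f : ℝ → ℝ) (hf : Porous.Growth f)
    (hf' : ∀ x : ℝ, 0 ≤ (∫ s in (0 : ℝ)..x, f s) ∧ (∫ s in (0 : ℝ)..x, f s) ≤ f x * x) :
    ∃ S : ℝ → Porous.Energy P →L[ℝ] Porous.Energy P,
      Porous.IsContractionSemigroup S ∧
      Porous.IsGenerator Porous.IsA S ∧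
      (∀ U₀ : Porous.Energy P, ∃ U : ℝ → Porous.Energy P,
        Porous.IsMild S (Porous.opF hf) U₀ U ∧ U 0 = U₀ ∧
        ∀ V : ℝ → Porous.Energy P, Porous.IsMild S (Porous.opF hf) U₀ V →
          Set.EqOn V U (Set.Ici 0)) ∧
      (∃ C : Porous.Energy P → Porous.Energy P → ℝ, (∀ X Y, 0 < C X Y) ∧
        ∀ (T : ℝ) (U₁ U₂ : ℝ → Porous.Energy P), 0 ≤ T →
          Porous.IsMildOn S (Porous.opF hf) (U₁ 0) T U₁ →
          Porous.IsMildOn S (Porous.opF hf) (U₂ 0) T U₂ →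
          ∀ t ∈ Set.Icc 0 T,
            ‖U₁ t - U₂ t‖ ≤ Real.exp (C (U₁ 0) (U₂ 0) * T) * ‖U₁ 0 - U₂ 0‖) ∧
      (∀ U₀ : Porous.Energy P, Porous.InDomain U₀ →
        ∀ U : ℝ → Porous.Energy P, Porous.IsMild S (Porous.opF hf) U₀ U →
          Porous.IsStrong Porous.IsA (Porous.opF hf) U₀ U) := by
  obtain ⟨S, hS, hG, hneg⟩ := (Porous.graphA_isMaxDissipative hμ hη₁ hη₂).exists_semigroup
  have hE : Porous.IsExtendedSemigroup S := ⟨hS, hneg⟩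
  have hA : Porous.IsGenerator Porous.IsA S := fun x y => Porous.isA_iff.trans (hG x y)
  obtain ⟨C, hC, hdep⟩ := Porous.exists_continuous_dependence hE hA hf hf'
  refine ⟨S, hS, hA, fun U₀ => ?_, ⟨C, hC, fun T U₁ U₂ _ h₁ h₂ => hdep _ _ T U₁ U₂ h₁ h₂⟩,
    fun U₀ hU₀ U hU => ?_⟩
  · obtain ⟨U, hU⟩ := Porous.exists_isMild hE hA hf hf' U₀
    refine ⟨U, hU, hE.mild_zero (hU.isMildOn 0) le_rfl, fun V hV t ht => ?_⟩
    have := hdep U₀ U₀ t V U (hV.isMildOn t) (hU.isMildOn t) t ⟨ht, le_rfl⟩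
    rw [sub_self, norm_zero, mul_zero] at this
    exact sub_eq_zero.1 (norm_le_zero_iff.1 this)
  · obtain ⟨W, hW⟩ := hU₀.exists_isA
    exact Porous.isStrong_of_isMild hE hA hf hf' hW hU
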